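/- **Model.** Let $(X_t,\xi_t)_{t\ge 1}$ be iid couples with values in $\mathcal X\times\mathbb R$ ($\mathcal X$ a measurable space), with $\xi_t$ independent of $X_t$, and let $Y_t=\mu(X_t)+\sigma(X_t)\xi_t$ for measurable $\mu,\sigma:\mathcal X\to\mathbb R$, $\sigma>0$. Let $D_0$ be a holdout sample of $n\geq 0$ elements of $\mathcal X\times\mathbb R$, independent of $(X_t,\xi_t)_{t\ge1}$, and $\mathcal F_t=\sigma(D_0,(X_k,Y_k)_{1\le k\le t})$. Assume that $\xi_1$ has a symmetric continuous Lebesgue density $f$, positive in the interior of its support and (weakly) decreasing on $[0,\infty)$, with $\sup f<\infty$, $\sup_x|x|f(x)<\infty$, $\mathbb E\xi_1^2=1$, and that $\sup_x 1/\sigma(x)<\infty$, $\sup_x\sigma(x)<\infty$. Write $\bar F(z)=\mathbb P(\xi_1>z)$, let $\bar F^{-1}$ be its inverse, and let $\Phi$ be the standard normal c.d.f. For an $\mathcal F_{t-1}$-measurable rule $C_t(\cdot)$ (a random set $C_t(x)\subset\mathbb R$ for each $x$, such that the event $y\in C_t(x)$ is measurable jointly in $\mathcal F_{t-1}$, $x$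 and $y$), $\mathbb P(Y_t\in C_t(X_t)\mid X_t=x)$ denotes, for every $x\in\mathcal X$, the version $\mathbb P(\mu(x)+\sigma(x)\xi_t\in C_t(x))$; $|\cdot|$ is Lebesgue measure. **Procedure.** Fix $\alpha\in(0,1)$, $B>0$, $c>0$, $\beta\in(1/2,1)$, $q_1\in[0,B]$, a measurable selection $S:\mathcal X\to\{0,1\}$ with $\mathbb P(S(X_1)=1)>0$, and $\mathcal F_{t-1}$-measurable estimators $\hat\mu_t(x)\in\mathbb R$, $\hat\sigma_t(x)\ge 0$ (jointly measurable in $x$). Let $\mathcal C_t(x,q)=[\hat\mu_t(x)\pm\hat\sigma_t(x)\Phi^{-1}(\frac{q+B}{2B})]$ for $q\in(0,B)$, $\{\hat\mu_t(x)\}$ for $q\le0$, $\mathbb R$ for $q\ge B$. OnlineSCI is the recursion $$q_{t+1}=q_t+\gamma_{J(t)}\big(\mathbf 1\{Y_t\notin\mathcal C_t(X_t,q_t)\}\mathbf 1\{q_t\ge0\}+\mathbf 1\{q_t<0\}-\alpha\big)S(X_t),\quad J(t)=1+\sum_{i=1}^{t-1}S(X_i),\quad \gamma_j=cj^{-\beta},$$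 and its intervals are $\mathcal C^{SCI}_t(x)=\mathcal C_t(x,q_t)$. **Estimation assumptions.** For some $C_1,\nu_0,\tau_0>0$, $\nu,\tau\in(0,1/2]$ and all $t$ large enough, $$\mathbb P\Big(\mathbb E\big[|\hat\mu_t(X_t)-\mu(X_t)|+|\hat\sigma_t(X_t)-\sigma(X_t)|\,\big|\,\mathcal F_{t-1}\big]\ge C_1(\log t)^{\nu_0}t^{-\nu}\Big)\le\frac{3}{\pi^2t^3},$$ $$\sup_x\mathbb E[(\hat\mu_t(x)-\mu(x))^2]+\sup_x\mathbb E[(\hat\sigma_t(x)-\sigma(x))^2]\le C_1(\log t)^{2\tau_0}t^{-2\tau}.$$ Let $\rho(t)=(\log t)^{1/2}t^{-\beta/3}$ if $\beta<3/4$ and $\rho(t)=(\log t)^{1/2}t^{1/2-\beta}+t^{\beta-1}$ if $\beta\ge3/4$, and let $\mathcal C^*(x)=[\mu(x)\pm\sigma(x)\bar F^{-1}(\alpha/2)]$, of length $2\sigma(x)\bar F^{-1}(\alpha/2)$. **Conclusion.** (i) There are $C_0>0$ and $T_0\ge1$ such that for all $t\ge T_0$ and all $x\in\mathcal X$, $$\mathbb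 P(Y_t\in\mathcal C^{SCI}_t(X_t)\mid X_t=x)\ge1-\alpha-C_0\big[\rho(t)+(\log t)^{\tau_0}t^{-\tau}+(\log t)^{\nu_0}t^{-\nu}\big].$$ (ii) If $\beta>1-\tau$, there are $C_0>0$ and $T_0\ge1$ such that for all $t\ge T_0$, $x\in\mathcal X$ and $M>0$, $$\mathbb E\big[|\mathcal C^{SCI}_t(x)|\wedge M\big]\le|\mathcal C^*(x)|+C_0(\log t)^{\tau_0/2}t^{1/2-\tau/2-\beta/2}+M/t.$$ (iii) If $\beta>1-\tau$, there are $C_0>0$ and $T_0\ge1$ such that for every sequence of $\mathcal F_{t-1}$-measurable prediction set rules $\mathcal C'_t(\cdot)$ and every $\eta'_t>0$ tending to $0$ with $\mathbb P(Y_t\in\mathcal C'_t(X_t)\mid X_t=x)\ge1-\alpha-\eta'_t$ for all $t\ge1$ and $x\in\mathcal X$, one has for all $t\ge T_0$, $x\in\mathcal X$ and $M>0$, $$\mathbb E\big[|\mathcal C^{SCI}_t(x)|\wedge M\big]\le\mathbb E\big[|\mathcal C'_t(x)|\big]+C_0(\log t)^{\tau_0/2}t^{1/2-\tau/2-\beta/2}+C_0\eta'_t+M/t.$$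 -/

import Mathlib

open MeasureTheory ProbabilityTheory Filter Topology

noncomputable section

namespace OnlineSCI

variable {Ω 𝒳 : Type*}

/-! ### Model -/

/-- The information `𝓕_t = σ(D₀, (X_k, Y_k), 1 ≤ k ≤ t)`, where `D₀` is a holdout sample of size
`n`. -/
@[reducible] def past [MeasurableSpace 𝒳] {n : ℕ} (D₀ : Ω → Fin n → 𝒳 × ℝ) (X : ℕ → Ω → 𝒳) (Y : ℕ → Ω → ℝ)
    (t : ℕ) : MeasurableSpace Ω :=
  MeasurableSpace.comap D₀ inferInstance ⊔
    ⨆ k ∈ Finset.Icc 1 t, MeasurableSpace.comap (fun ω => (X k ω, Y k ω)) inferInstance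

/-- The iid regression model `Y_t = μ(X_t) + σ(X_t) ξ_t`, `t ≥ 1`: the couples `(X_t, ξ_t)`,
`t ≥ 1`, are iid, the noise is independent of the covariate, and the holdout sample is independent
of `(X_t, ξ_t)_{t ≥ 1}`. Time starts at `1`; nothing is assumed about index `0`. -/
structure IIDRegression [MeasurableSpace Ω] [MeasurableSpace 𝒳] (P : Measure Ω) {n : ℕ}
    (D₀ : Ω → Fin n → 𝒳 × ℝ) (X : ℕ → Ω → 𝒳) (ξ Y : ℕ → Ω → ℝ) (μ σ : 𝒳 → ℝ) : Prop where
  measurable_holdout : Measurable D₀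
  measurable_X : ∀ t, 1 ≤ t → Measurable (X t)
  measurable_noise : ∀ t, 1 ≤ t → Measurable (ξ t)
  measurable_mu : Measurable μ
  measurable_sigma : Measurable σ
  indep : iIndepFun (fun (i : ℕ) ω => (X (i + 1) ω, ξ (i + 1) ω)) P
  identDistrib : ∀ t, 1 ≤ t →
    IdentDistrib (fun ω => (X t ω, ξ t ω)) (fun ω => (X 1 ω, ξ 1 ω)) P P
  indep_noise : IndepFun (X 1) (ξ 1) P
  indep_holdout : IndepFun D₀ (fun ω (i : ℕ) => (X (i + 1) ω, ξ (i + 1) ω)) P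
  model : ∀ t, 1 ≤ t → ∀ ω, Y t ω = μ (X t ω) + σ (X t ω) * ξ t ω

/-- The noise has a bounded, symmetric, continuous Lebesgue density `f`, positive in the interior
of its support, with `sup |x| f(x) < ∞` and unit second moment; `σ` is positive with
`sup 1/σ < ∞`. -/
structure NoiseRegular [MeasurableSpace Ω] (P : Measure Ω) (ξ : Ω → ℝ) (f : ℝ → ℝ)
    (σ : 𝒳 → ℝ) : Prop where
  density_nonneg : ∀ x, 0 ≤ f x
  density : P.map ξ = volume.withDensity (fun x => ENNReal.ofReal (f x))
  continuous : Continuous f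
  symmetric : ∀ x, f (-x) = f x
  pos_on_support : ∀ x ∈ interior (tsupport f), 0 < f x
  bdd : BddAbove (Set.range f)
  bdd_mul : BddAbove (Set.range fun x => |x| * f x)
  second_moment : ∫ ω, (ξ ω) ^ 2 ∂P = 1
  sigma_pos : ∀ x, 0 < σ x
  inv_sigma_bdd : BddAbove (Set.range fun x => 1 / σ x)

/-- The noise density is decreasing on `[0, ∞)` and `σ` is bounded. -/
structure DecreasingDensity (f : ℝ → ℝ) (σ : 𝒳 → ℝ) : Prop where
  antitoneOn : AntitoneOn f (Set.Ici 0)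
  sigma_bdd : BddAbove (Set.range σ)

/-! ### Quantiles -/

/-- The quantile function `Φ⁻¹` of the standard normal distribution (used on `(0, 1)` only). -/
def normalQuantile (p : ℝ) : ℝ := sInf {z : ℝ | p ≤ cdf (gaussianReal 0 1) z}

/-- `F̄⁻¹(u) = inf {z : F̄(z) ≤ u}` where `F̄(z) = P(ξ > z)`. -/
def tailQuantile [MeasurableSpace Ω] (P : Measure Ω) (ξ : Ω → ℝ) (u : ℝ) : ℝ :=
  sInf {z : ℝ | P.real {ω | z < ξ ω} ≤ u}

/-! ### The procedure -/

/-- The prediction interval `[m ± s Φ⁻¹((q + B)/(2B))]` if `q ∈ (0, B)`, `{m}` if `q ≤ 0` and `ℝ` if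
`q ≥ B`. -/
def interval (B m s q : ℝ) : Set ℝ :=
  if q ≤ 0 then {m}
  else if B ≤ q then Set.univ
  else Set.Icc (m - s * normalQuantile ((q + B) / (2 * B)))
    (m + s * normalQuantile ((q + B) / (2 * B)))

open Classical in
/-- `react(y, C, q) = 1{y ∉ C} 1{q ≥ 0} + 1{q < 0}`. -/
def react (y : ℝ) (C : Set ℝ) (q : ℝ) : ℝ :=
  (if y ∉ C then 1 else 0) * (if 0 ≤ q then 1 else 0) + (if q < 0 then 1 else 0)

/-- The state `(q_{m+1}, J(m+1))` of OnlineSCI at time `m + 1`, for the selection rules `S_t(x, q)`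
and the prediction set rules `C_t(x, q)`: `J(t)` is one plus the number of selections before time
`t`, and `q_{t+1} = q_t + γ_{J(t)} (react(Y_t, C_t(X_t, q_t), q_t) - α) S_t(X_t, q_t)`. -/
def state (α q₁ : ℝ) (γ : ℕ → ℝ) (S : ℕ → Ω → 𝒳 → ℝ → Bool) (C : ℕ → Ω → 𝒳 → ℝ → Set ℝ)
    (X : ℕ → Ω → 𝒳) (Y : ℕ → Ω → ℝ) (ω : Ω) : ℕ → ℝ × ℕ
  | 0 => (q₁, 1)
  | m + 1 =>
    let q := (state α q₁ γ S C X Y ω m).1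
    let J := (state α q₁ γ S C X Y ω m).2
    let t := m + 1
    if S t ω (X t ω) q = true then
      (q + γ J * (react (Y t ω) (C t ω (X t ω) q) q - α), J + 1)
    else (q, J)

/-- The OnlineSCI threshold `q_t`, `t ≥ 1`. -/
def threshold (α q₁ : ℝ) (γ : ℕ → ℝ) (S : ℕ → Ω → 𝒳 → ℝ → Bool) (C : ℕ → Ω → 𝒳 → ℝ → Set ℝ)
    (X : ℕ → Ω → 𝒳) (Y : ℕ → Ω → ℝ) (t : ℕ) (ω : Ω) : ℝ :=
  (state α q₁ γ S C X Y ω (t - 1)).1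

/-- The OnlineSCI prediction sets `C_t(x) = C_t(x, q_t)` for the regression interval built on the
estimators `μ̂_t, σ̂_t`, the time-constant selection `S(x)` and the steps `γ_j = c j^{-β}`. -/
def sciSet (α B q₁ c β : ℝ) (S : 𝒳 → Bool) (muHat sigmaHat : ℕ → Ω → 𝒳 → ℝ)
    (X : ℕ → Ω → 𝒳) (Y : ℕ → Ω → ℝ) (t : ℕ) (ω : Ω) (x : 𝒳) : Set ℝ :=
  interval B (muHat t ω x) (sigmaHat t ω x)
    (threshold α q₁ (fun j => c * (j : ℝ) ^ (-β)) (fun _ _ z _ => S z)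
      (fun s ω' z q => interval B (muHat s ω' z) (sigmaHat s ω' z) q) X Y t ω)

/-- The oracle interval `C*(x) = [μ(x) ± σ(x) F̄⁻¹(α/2)]`. -/
def oracleSet [MeasurableSpace Ω] (P : Measure Ω) (ξ : Ω → ℝ) (μ σ : 𝒳 → ℝ) (α : ℝ) (x : 𝒳) :
    Set ℝ :=
  Set.Icc (μ x - σ x * tailQuantile P ξ (α / 2)) (μ x + σ x * tailQuantile P ξ (α / 2))

/-! ### Assumptions on the estimators, coverage, rates -/

/-- The estimator `θ̂_t(x)`, `t ≥ 1`, is `𝓕_{t-1}`-measurable, jointly in the point `x`. -/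
def IsEstimator [MeasurableSpace 𝒳] (F : ℕ → MeasurableSpace Ω) (thetaHat : ℕ → Ω → 𝒳 → ℝ) :
    Prop :=
  ∀ t, 1 ≤ t → Measurable[(F (t - 1)).prod inferInstance] fun p : Ω × 𝒳 => thetaHat t p.1 p.2

/-- The prediction set rule `C_t(x)`, `t ≥ 1`, is `𝓕_{t-1}`-measurable: the event `y ∈ C_t(x)` is
measurable in the past, the point `x` and the value `y`. -/
def IsSetRule [MeasurableSpace 𝒳] (F : ℕ → MeasurableSpace Ω) (C : ℕ → Ω → 𝒳 → Set ℝ) : Prop :=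
  ∀ t, 1 ≤ t →
    MeasurableSet[(F (t - 1)).prod inferInstance] {p : Ω × 𝒳 × ℝ | p.2.2 ∈ C t p.1 p.2.1}

/-- The conditional coverage probability `P(Y_t ∈ C_t(X_t) | X_t = x)` of an `𝓕_{t-1}`-measurable
set rule, at every point `x`: given `X_t = x`, the response is `μ(x) + σ(x) ξ_t`. That this is a
version of the conditional probability is `condCoverage_spec`. -/
def condCoverage [MeasurableSpace Ω] (P : Measure Ω) (ξ : ℕ → Ω → ℝ) (μ σ : 𝒳 → ℝ)
    (C : ℕ → Ω → 𝒳 → Set ℝ) (t : ℕ) (x : 𝒳) : ℝ :=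
  P.real {ω | μ x + σ x * ξ t ω ∈ C t ω x}

/-- With probability at least `1 - 3/(π² t³)`, the conditional expected estimation error given the
past is less than `C₁ (log t)^{ν₀} t^{-ν}`, for `t` large enough. -/
def ErrorInProbability [MeasurableSpace Ω] (P : Measure Ω) (F : ℕ → MeasurableSpace Ω)
    (X : ℕ → Ω → 𝒳) (μ σ : 𝒳 → ℝ) (muHat sigmaHat : ℕ → Ω → 𝒳 → ℝ) (C₁ ν₀ ν : ℝ) : Prop :=
  ∀ᶠ t : ℕ in atTop,
    P.real {ω | C₁ * Real.log t ^ ν₀ * (t : ℝ) ^ (-ν) ≤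
      (P[fun ω' => |muHat t ω' (X t ω') - μ (X t ω')| +
        |sigmaHat t ω' (X t ω') - σ (X t ω')| | F (t - 1)]) ω} ≤ 3 / (Real.pi ^ 2 * (t : ℝ) ^ 3)

/-- `sup_x E[(μ̂_t(x) - μ(x))²] + sup_x E[(σ̂_t(x) - σ(x))²] ≤ C₁ (log t)^{2τ₀} t^{-2τ}`, for `t`
large enough. -/
def ErrorPointwise [MeasurableSpace Ω] (P : Measure Ω) (μ σ : 𝒳 → ℝ)
    (muHat sigmaHat : ℕ → Ω → 𝒳 → ℝ) (C₁ τ₀ τ : ℝ) : Prop :=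
  ∀ᶠ t : ℕ in atTop,
    (⨆ x, ∫⁻ ω, ENNReal.ofReal ((muHat t ω x - μ x) ^ 2) ∂P) +
      (⨆ x, ∫⁻ ω, ENNReal.ofReal ((sigmaHat t ω x - σ x) ^ 2) ∂P) ≤
    ENNReal.ofReal (C₁ * Real.log t ^ (2 * τ₀) * (t : ℝ) ^ (-(2 * τ)))

/-- The rate `ρ(t)`, for `β ∈ (1/2, 1)`. -/
def rho (β : ℝ) (t : ℕ) : ℝ :=
  if β < 3 / 4 then Real.log t ^ (1 / 2 : ℝ) * (t : ℝ) ^ (-(β / 3))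
  else Real.log t ^ (1 / 2 : ℝ) * (t : ℝ) ^ (1 / 2 - β) + (t : ℝ) ^ (β - 1)

/-! ### Helper facts -/

theorem volume_oracleSet [MeasurableSpace Ω] (P : Measure Ω) (ξ : Ω → ℝ) (μ σ : 𝒳 → ℝ) (α : ℝ)
    (x : 𝒳) :
    volume (oracleSet P ξ μ σ α x) = ENNReal.ofReal (2 * σ x * tailQuantile P ξ (α / 2)) := by
  rw [oracleSet, Real.volume_Icc]
  congr 1
  ring

/-- `J(t) = 1 + ∑_{1 ≤ i < t} S_i(X_i, q_i)`. -/
theorem state_count (α q₁ : ℝ) (γ : ℕ → ℝ) (S : ℕ → Ω → 𝒳 → ℝ → Bool)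
    (C : ℕ → Ω → 𝒳 → ℝ → Set ℝ) (X : ℕ → Ω → 𝒳) (Y : ℕ → Ω → ℝ) (ω : Ω) (m : ℕ) :
    (state α q₁ γ S C X Y ω m).2 =
      1 + ∑ i ∈ Finset.Icc 1 m, (S i ω (X i ω) (threshold α q₁ γ S C X Y i ω)).toNat := by
  induction m with
  | zero => simp [state]
  | succ m ih =>
    rw [Finset.sum_Icc_succ_top (by omega), ← add_assoc, ← ih]
    simp only [state, threshold, Nat.add_sub_cancel]
    split_ifs with h <;> simp [h]

theorem indepFun_assoc [MeasurableSpace Ω] {P : Measure Ω} [IsProbabilityMeasure P]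
    {A B C : Type*} [MeasurableSpace A] [MeasurableSpace B] [MeasurableSpace C]
    {f : Ω → A} {g : Ω → B} {h : Ω → C} (hf : Measurable f) (hg : Measurable g)
    (hh : Measurable h) (h1 : IndepFun f (fun ω => (g ω, h ω)) P) (h2 : IndepFun g h P) :
    IndepFun (fun ω => (f ω, g ω)) h P := by
  have : IsProbabilityMeasure (P.map f) := Measure.isProbabilityMeasure_map hf.aemeasurable
  have : IsProbabilityMeasure (P.map g) := Measure.isProbabilityMeasure_map hg.aemeasurable
  have : IsProbabilityMeasure (P.map h) := Measure.isProbabilityMeasure_map hh.aemeasurable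
  have h3 : IndepFun f g P := h1.comp measurable_id measurable_fst
  rw [indepFun_iff_map_prod_eq_prod_map_map hf.aemeasurable (hg.prodMk hh).aemeasurable,
    (indepFun_iff_map_prod_eq_prod_map_map hg.aemeasurable hh.aemeasurable).1 h2,
    ← Measure.prodAssoc_prod] at h1
  rw [indepFun_iff_map_prod_eq_prod_map_map (hf.prodMk hg).aemeasurable hh.aemeasurable,
    (indepFun_iff_map_prod_eq_prod_map_map hf.aemeasurable hg.aemeasurable).1 h3]
  apply MeasurableEquiv.prodAssoc.map_measurableEquiv_injective
  rw [← h1, Measure.map_map MeasurableEquiv.prodAssoc.measurable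
    ((hf.prodMk hg).prodMk hh)]
  rfl

theorem past_le_comap [MeasurableSpace 𝒳] {𝒱 : Type*} [MeasurableSpace 𝒱] {n : ℕ}
    (D₀ : Ω → Fin n → 𝒳 × ℝ) (X : ℕ → Ω → 𝒳) (Y : ℕ → Ω → ℝ) (V : Ω → 𝒱) {s : ℕ}
    (hD : ∃ g : 𝒱 → Fin n → 𝒳 × ℝ, Measurable g ∧ D₀ = g ∘ V)
    (hXY : ∀ k, 1 ≤ k → k ≤ s →
      ∃ g : 𝒱 → 𝒳 × ℝ, Measurable g ∧ (fun ω => (X k ω, Y k ω)) = g ∘ V) :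
    past D₀ X Y s ≤ MeasurableSpace.comap V inferInstance := by
  refine sup_le ?_ (iSup₂_le fun k hk => ?_)
  · obtain ⟨g, hg, rfl⟩ := hD
    rw [← MeasurableSpace.comap_comp]
    exact MeasurableSpace.comap_mono hg.comap_le
  · rw [Finset.mem_Icc] at hk
    obtain ⟨g, hg, h⟩ := hXY k hk.1 hk.2
    rw [h, ← MeasurableSpace.comap_comp]
    exact MeasurableSpace.comap_mono hg.comap_le

theorem exists_data_event [MeasurableSpace 𝒳] {𝒱 : Type*} [MeasurableSpace 𝒱] {n : ℕ}
    (D₀ : Ω → Fin n → 𝒳 × ℝ) (X : ℕ → Ω → 𝒳) (Y : ℕ → Ω → ℝ) (μ σ : 𝒳 → ℝ) (ζ : Ω → ℝ)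
    (C : ℕ → Ω → 𝒳 → Set ℝ) (V : Ω → 𝒱) {s : ℕ}
    (hpast : past D₀ X Y s ≤ MeasurableSpace.comap V inferInstance) (hμ : Measurable μ)
    (hσ : Measurable σ) (hζ : ∃ g : 𝒱 → ℝ, Measurable g ∧ ζ = g ∘ V)
    (hC : MeasurableSet[(past D₀ X Y s).prod inferInstance]
      {p : Ω × 𝒳 × ℝ | p.2.2 ∈ C (s + 1) p.1 p.2.1}) :
    ∃ E : Set (𝒱 × 𝒳), MeasurableSet E ∧
      ∀ ω x, (V ω, x) ∈ E ↔ μ x + σ x * ζ ω ∈ C (s + 1) ω x := by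
  let _ : MeasurableSpace Ω := MeasurableSpace.comap V inferInstance
  have hV : Measurable V := comap_measurable V
  obtain ⟨g, hg, rfl⟩ := hζ
  have hle : ((past D₀ X Y s).prod inferInstance : MeasurableSpace (Ω × 𝒳 × ℝ)) ≤
      Prod.instMeasurableSpace := sup_le_sup (MeasurableSpace.comap_mono hpast) le_rfl
  have hf : Measurable fun p : Ω × 𝒳 => (p.1, p.2, μ p.2 + σ p.2 * (g ∘ V) p.1) := by
    fun_prop
  have hE := hf (hle _ hC)
  have hcomap : (Prod.instMeasurableSpace : MeasurableSpace (Ω × 𝒳)) =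
      MeasurableSpace.comap (Prod.map V id) inferInstance := by
    simp only [MeasurableSpace.prod, Prod.instMeasurableSpace, MeasurableSpace.comap_sup,
      MeasurableSpace.comap_comp]
    rw [show (Prod.fst ∘ Prod.map V id : Ω × 𝒳 → 𝒱) = V ∘ Prod.fst from rfl,
      show (Prod.snd ∘ Prod.map V id : Ω × 𝒳 → 𝒳) = Prod.snd from rfl,
      ← MeasurableSpace.comap_comp]
  rw [hcomap] at hE
  obtain ⟨E, hEm, hEeq⟩ := hE
  exact ⟨E, hEm, fun ω x => Set.ext_iff.1 hEeq (ω, x)⟩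

/-- `condCoverage` is a version of `x ↦ P(Y_t ∈ C_t(X_t) | X_t = x)`: integrated over any set `A`
against the law of `X_t`, it gives `P(X_t ∈ A, Y_t ∈ C_t(X_t))`. -/
theorem condCoverage_spec [MeasurableSpace Ω] [MeasurableSpace 𝒳] {P : Measure Ω}
    [IsProbabilityMeasure P] {n : ℕ} {D₀ : Ω → Fin n → 𝒳 × ℝ} {X : ℕ → Ω → 𝒳} {ξ Y : ℕ → Ω → ℝ}
    {μ σ : 𝒳 → ℝ} (hM : IIDRegression P D₀ X ξ Y μ σ) {C : ℕ → Ω → 𝒳 → Set ℝ}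
    (hC : IsSetRule (past D₀ X Y) C) {t : ℕ} (ht : 1 ≤ t) {A : Set 𝒳} (hA : MeasurableSet A) :
    P {ω | X t ω ∈ A ∧ Y t ω ∈ C t ω (X t ω)} =
      ∫⁻ x in A, ENNReal.ofReal (condCoverage P ξ μ σ C t x) ∂(P.map (X t)) := by
  obtain ⟨s, rfl⟩ : ∃ s, t = s + 1 := ⟨t - 1, by omega⟩
  have hX := hM.measurable_X (s + 1) ht
  have hξ := hM.measurable_noise (s + 1) ht
  have hμ := hM.measurable_mu
  have hσ := hM.measurable_sigma
  have hD := hM.measurable_holdout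
  have hZ : ∀ i : ℕ, Measurable fun ω => (X (i + 1) ω, ξ (i + 1) ω) := fun i =>
    (hM.measurable_X _ (by omega)).prodMk (hM.measurable_noise _ (by omega))
  -- the past data
  let W : Ω → (Finset.range s → 𝒳 × ℝ) := fun ω i => (X (i + 1) ω, ξ (i + 1) ω)
  have hW : Measurable W := measurable_pi_lambda _ fun i => hZ i
  have hWZ : IndepFun W (fun ω => (X (s + 1) ω, ξ (s + 1) ω)) P := by
    have h := hM.indep.indepFun_finset (Finset.range s) {s} (by simp) hZ
    exact h.comp measurable_id (measurable_pi_apply (⟨s, by simp⟩ : ({s} : Finset ℕ)))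
  have hDWZ : IndepFun D₀ (fun ω => (W ω, (X (s + 1) ω, ξ (s + 1) ω))) P := by
    refine hM.indep_holdout.comp (φ := id)
      (ψ := fun z : ℕ → 𝒳 × ℝ => ((fun i : Finset.range s => z i), z s)) measurable_id ?_
    fun_prop
  have h1 := indepFun_assoc hD hW (hZ s) hDWZ hWZ
  have hX1 : IndepFun (ξ (s + 1)) (X (s + 1)) P := by
    have hid := hM.identDistrib (s + 1) ht
    have hX1' := hM.measurable_X 1 le_rfl
    have hξ1' := hM.measurable_noise 1 le_rfl
    have hind := hM.indep_noise
    refine IndepFun.symm ?_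
    rw [indepFun_iff_map_prod_eq_prod_map_map hX.aemeasurable hξ.aemeasurable, hid.map_eq,
      (indepFun_iff_map_prod_eq_prod_map_map hX1'.aemeasurable hξ1'.aemeasurable).1 hind]
    have e1 := (hid.comp measurable_fst).map_eq
    have e2 := (hid.comp measurable_snd).map_eq
    simp only [Function.comp_def] at e1 e2
    rw [e1, e2]
  have h2 : IndepFun (fun ω => ((D₀ ω, W ω), ξ (s + 1) ω)) (X (s + 1)) P :=
    indepFun_assoc (hD.prodMk hW) hξ hX
      (h1.comp measurable_id (measurable_snd.prodMk measurable_fst)) hX1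
  set V : Ω → ((Fin n → 𝒳 × ℝ) × (Finset.range s → 𝒳 × ℝ)) × ℝ :=
    fun ω => ((D₀ ω, W ω), ξ (s + 1) ω) with hVdef
  have hV : Measurable V := (hD.prodMk hW).prodMk hξ
  obtain ⟨E, hEm, hEiff⟩ : ∃ E : Set ((((Fin n → 𝒳 × ℝ) × (Finset.range s → 𝒳 × ℝ)) × ℝ) × 𝒳),
      MeasurableSet E ∧
        ∀ ω x, (V ω, x) ∈ E ↔ μ x + σ x * ξ (s + 1) ω ∈ C (s + 1) ω x := by
    refine exists_data_event D₀ X Y μ σ (ξ (s + 1)) C V ?_ hμ hσ ⟨Prod.snd, measurable_snd, rfl⟩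
      (hC (s + 1) ht)
    refine past_le_comap D₀ X Y V ⟨fun v => v.1.1, by fun_prop, rfl⟩ fun k hk1 hk => ?_
    obtain ⟨j, rfl⟩ : ∃ j, k = j + 1 := ⟨k - 1, by omega⟩
    have hj : j ∈ Finset.range s := by simp; omega
    refine ⟨fun v => ((v.1.2 ⟨j, hj⟩).1,
      μ (v.1.2 ⟨j, hj⟩).1 + σ (v.1.2 ⟨j, hj⟩).1 * (v.1.2 ⟨j, hj⟩).2), by fun_prop, ?_⟩
    funext ω
    simp [hVdef, W, hM.model (j + 1) hk1 ω]
  have hmap := (indepFun_iff_map_prod_eq_prod_map_map hV.aemeasurable hX.aemeasurable).1 h2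
  have : IsProbabilityMeasure (P.map V) := Measure.isProbabilityMeasure_map hV.aemeasurable
  have : IsProbabilityMeasure (P.map (X (s + 1))) :=
    Measure.isProbabilityMeasure_map hX.aemeasurable
  have hEA : MeasurableSet (E ∩ Prod.snd ⁻¹' A) := hEm.inter (measurable_snd hA)
  calc P {ω | X (s + 1) ω ∈ A ∧ Y (s + 1) ω ∈ C (s + 1) ω (X (s + 1) ω)}
      = P.map (fun ω => (V ω, X (s + 1) ω)) (E ∩ Prod.snd ⁻¹' A) := by
        rw [Measure.map_apply (hV.prodMk hX) hEA]
        congr 1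
        ext ω
        have := hEiff ω (X (s + 1) ω)
        simp only [Set.mem_ofPred_eq, Set.mem_preimage, Set.mem_inter_iff, this,
          hM.model (s + 1) ht ω]
        tauto
    _ = ∫⁻ x in A, ENNReal.ofReal (condCoverage P ξ μ σ C (s + 1) x) ∂(P.map (X (s + 1))) := by
        rw [hmap, Measure.prod_apply_symm hEA, ← lintegral_indicator hA]
        congr 1
        funext x
        by_cases hx : x ∈ A
        · rw [Set.indicator_of_mem hx, condCoverage, ofReal_measureReal,
            Measure.map_apply hV (measurable_prodMk_right hEA)]
          congr 1
          ext ω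
          have := hEiff ω x
          simp [hx, this]
        · rw [Set.indicator_of_notMem hx]
          have : (fun v => (v, x)) ⁻¹' (E ∩ Prod.snd ⁻¹' A) = ∅ := by
            ext v
            simp [hx]
          rw [this, measure_empty]

end OnlineSCI

end

/-! OnlineSCI is a Robbins–Monro scheme for the equation `idealMiss q = α`. With the true location
and scale, the interval at level `q` has the same miscoverage at every covariate: twice the noise
tail at `radius B q` when `q < B`, and zero from `B` on. This is nonincreasing in `q` and equals `α`
at `qStar`, the level whose radius is the standardized oracle half-length `zStar`. The density is
bounded below by a positive constant on `[0, R]` for some `R > zStar`, and the thresholds never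
leave `[-c, B + c]`, so the pull towards `qStar` is at least linear in the distance
(`exists_drift`). Replacing the true location and scale by estimators changes the miscoverage by at
most a constant times the estimation error, uniformly in the level: a shift is paid by `sup f`, a
rescaling by `sup |x| f(x)` (`abs_miss_sub_idealMiss_le`).

Let `m_t` be the moment of order `2k` of `q_t - qStar` and `ε_t` the truncated estimation error
averaged over the covariate. Expanding the power and integrating out `(X_t, ξ_t)`, which is
independent of the past, gives `m_{t+1} ≤ (1 - A t^{-β}) m_t + C t^{-β} (E ε_t^{2k} + t^{-βk})`
(`exists_moment_recursion`). The steps are random, but `J(t) ≤ t` keeps the contraction, and a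
Chernoff bound `J(t) ≥ r t` keeps the noise small. Since `β < 1`, the contraction is faster than the
decay of any power of `t`, so `m_t` is of the order of the forcing term
(`exists_le_mul_of_recursion`).

Two choices of `k` are used. With `k = 1` and the mean-square assumption, `E|q_t - qStar|` is of
order `(log t)^{τ₀} t^{-τ} + t^{-β/2}`. With `k` large and the assumption in probability, Markov's
inequality gives `P(|q_t - qStar| > δ) ≤ 1/t` for every fixed `δ > 0`.

Coverage follows because the ideal miscoverage exceeds `α` by at most a multiple of `|q_t - qStar|`,
and `t^{-β/2}` is within `rho`. For the length, the radius is Lipschitz in the level near `qStar`,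
while the event of being far from `qStar` costs `M/t` because of the truncation. Domination is a
Neyman–Pearson argument (`UnimodalDensity.volume_Icc_add_le`): a coverage deficit `η'` cannot save
more than `σ(x) η' / f(zStar)` of length with respect to the oracle interval. -/

noncomputable section

namespace OnlineSCI

/-! ### Symmetric unimodal densities -/

/-- `ν` has the continuous symmetric density `f`, nonincreasing on `[0, ∞)`. -/
structure UnimodalDensity (ν : Measure ℝ) (f : ℝ → ℝ) : Prop where
  nonneg : ∀ x, 0 ≤ f x
  eq : ν = volume.withDensity (fun x => ENNReal.ofReal (f x))
  continuous : Continuous f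
  symmetric : ∀ x, f (-x) = f x
  antitoneOn : AntitoneOn f (Set.Ici 0)

/-- The tail function `z ↦ ν (z, ∞)`. -/
def tail (ν : Measure ℝ) (z : ℝ) : ℝ := ν.real (Set.Ioi z)

/-- The quantile function of the tail. -/
def upperQuantile (ν : Measure ℝ) (u : ℝ) : ℝ := sInf {z : ℝ | tail ν z ≤ u}

section Tail

variable {ν : Measure ℝ}

theorem tail_nonneg (z : ℝ) : 0 ≤ tail ν z := measureReal_nonneg

variable [IsProbabilityMeasure ν]

theorem tail_le_one (z : ℝ) : tail ν z ≤ 1 := measureReal_le_one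

theorem tail_eq_one_sub_cdf (z : ℝ) : tail ν z = 1 - cdf ν z := by
  rw [tail, cdf_eq_real, ← Set.compl_Iic, probReal_compl_eq_one_sub measurableSet_Iic]

theorem tail_antitone : Antitone (tail ν) := fun a b h => by
  rw [tail_eq_one_sub_cdf, tail_eq_one_sub_cdf]
  linarith [monotone_cdf ν h]

theorem tail_sub {a b : ℝ} (h : a ≤ b) : tail ν a - tail ν b = ν.real (Set.Ioc a b) := by
  rw [tail, tail, ← Set.Ioc_union_Ioi_eq_Ioi h,
    measureReal_union (Set.disjoint_left.2 fun x hx hx' => (hx.2.trans_lt hx').false)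
      measurableSet_Ioi]
  ring

theorem tendsto_tail_atTop : Tendsto (tail ν) atTop (𝓝 0) := by
  have h := (tendsto_cdf_atTop ν).const_sub 1
  rw [sub_self] at h
  exact h.congr fun z => (tail_eq_one_sub_cdf z).symm

theorem tendsto_tail_atBot : Tendsto (tail ν) atBot (𝓝 1) := by
  have h := (tendsto_cdf_atBot ν).const_sub 1
  rw [sub_zero] at h
  exact h.congr fun z => (tail_eq_one_sub_cdf z).symm

end Tail

namespace UnimodalDensity

variable {ν : Measure ℝ} {f : ℝ → ℝ}

theorem apply_abs (h : UnimodalDensity ν f) (x : ℝ) : f |x| = f x := by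
  rcases abs_choice x with hx | hx <;> rw [hx]
  exact h.symmetric x

theorem noAtoms (h : UnimodalDensity ν f) (x : ℝ) : ν {x} = 0 := by
  rw [h.eq, withDensity_apply _ (measurableSet_singleton x)]
  simp

theorem le_of_abs_le (h : UnimodalDensity ν f) {x y : ℝ} (hxy : |x| ≤ |y|) : f y ≤ f x := by
  rw [← h.apply_abs x, ← h.apply_abs y]
  exact h.antitoneOn (abs_nonneg x) (abs_nonneg y) hxy

theorem real_Ici (h : UnimodalDensity ν f) (z : ℝ) : ν.real (Set.Ici z) = tail ν z := by
  rw [tail, Measure.real, Measure.real]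
  congr 1
  exact measure_congr ((ae_eq_set).2 ⟨measure_mono_null (t := {z}) (fun x hx => by
    simp only [Set.mem_sdiff, Set.mem_Ici, Set.mem_Ioi, not_lt] at hx
    exact le_antisymm hx.2 hx.1) (h.noAtoms z), by
      rw [Set.sdiff_eq_empty.2 Set.Ioi_subset_Ici_self, measure_empty]⟩)

variable [IsProbabilityMeasure ν]

theorem tail_sub_le_of_le (h : UnimodalDensity ν f) {a b K : ℝ} (hab : a ≤ b)
    (hK : ∀ x ∈ Set.Ioc a b, f x ≤ K) :
    tail ν a - tail ν b ≤ K * (b - a) := by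
  rcases hab.eq_or_lt with rfl | hlt
  · simp
  have hK0 : 0 ≤ K := (h.nonneg b).trans (hK b ⟨hlt, le_rfl⟩)
  rw [tail_sub hab, Measure.real, h.eq, withDensity_apply _ measurableSet_Ioc]
  refine ENNReal.toReal_le_of_le_ofReal (by nlinarith) ?_
  calc ∫⁻ x in Set.Ioc a b, ENNReal.ofReal (f x)
      ≤ ∫⁻ _ in Set.Ioc a b, ENNReal.ofReal K :=
        setLIntegral_mono measurable_const fun x hx => ENNReal.ofReal_le_ofReal (hK x hx)
    _ = ENNReal.ofReal (K * (b - a)) := by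
        rw [setLIntegral_const, Real.volume_Ioc, ← ENNReal.ofReal_mul hK0]

theorem le_tail_sub_of_le (h : UnimodalDensity ν f) {a b m : ℝ} (hab : a ≤ b) (hm0 : 0 ≤ m)
    (hm : ∀ x ∈ Set.Ioc a b, m ≤ f x) : m * (b - a) ≤ tail ν a - tail ν b := by
  rw [tail_sub hab, Measure.real]
  refine (ENNReal.ofReal_le_iff_le_toReal (measure_ne_top _ _)).1 ?_
  rw [h.eq, withDensity_apply _ measurableSet_Ioc]
  calc ENNReal.ofReal (m * (b - a)) = ∫⁻ _ in Set.Ioc a b, ENNReal.ofReal m := by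
        rw [setLIntegral_const, Real.volume_Ioc, ← ENNReal.ofReal_mul hm0]
    _ ≤ _ := setLIntegral_mono h.continuous.measurable.ennreal_ofReal
        fun x hx => ENNReal.ofReal_le_ofReal (hm x hx)

theorem tail_sub_le (h : UnimodalDensity ν f) {a b : ℝ} (hab : a ≤ b) :
    tail ν a - tail ν b ≤ f 0 * (b - a) :=
  h.tail_sub_le_of_le hab fun x _ => h.le_of_abs_le (by simp)

/-- The density is largest at the origin, so `f 0` is a Lipschitz constant of the tail. -/
theorem abs_tail_sub_le (h : UnimodalDensity ν f) (a b : ℝ) :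
    |tail ν a - tail ν b| ≤ f 0 * |a - b| := by
  rcases le_total a b with hab | hab
  · rw [abs_of_nonneg (by linarith [tail_antitone (ν := ν) hab]), abs_sub_comm,
      abs_of_nonneg (by linarith)]
    exact h.tail_sub_le hab
  · rw [abs_sub_comm, abs_of_nonneg (by linarith [tail_antitone (ν := ν) hab]),
      abs_of_nonneg (by linarith)]
    exact h.tail_sub_le hab

/-- By monotonicity, the value of `f` at the right end `R` bounds it below on `[0, R]`. This turns
gaps between radii into gaps between probabilities, for the noise as well as for the Gaussian. -/
theorem le_tail_sub (h : UnimodalDensity ν f) {a b R : ℝ} (ha : 0 ≤ a) (hab : a ≤ b) (hb : b ≤ R) :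
    f R * (b - a) ≤ tail ν a - tail ν b :=
  h.le_tail_sub_of_le hab (h.nonneg R) fun _ hx => h.antitoneOn (ha.trans hx.1.le)
    ((ha.trans hab).trans hb) (hx.2.trans hb)

theorem continuous_tail (h : UnimodalDensity ν f) : Continuous (tail ν) := by
  have : LipschitzWith (Real.toNNReal (f 0)) (tail ν) := LipschitzWith.of_dist_le_mul fun a b => by
    rw [Real.dist_eq, Real.dist_eq, Real.coe_toNNReal _ (h.nonneg 0)]
    exact h.abs_tail_sub_le a b
  exact this.continuous

theorem real_Icc (h : UnimodalDensity ν f) {a b : ℝ} (hab : a ≤ b) :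
    ν.real (Set.Icc a b) = tail ν a - tail ν b := by
  rw [← h.real_Ici a, tail, ← Set.Icc_union_Ioi_eq_Ici hab,
    measureReal_union (Set.disjoint_left.2 fun x hx hx' => (hx.2.trans_lt hx').false)
      measurableSet_Ioi]
  ring

theorem tail_neg (h : UnimodalDensity ν f) (z : ℝ) : tail ν (-z) = 1 - tail ν z := by
  rw [← h.real_Ici, tail, ← probReal_compl_eq_one_sub (μ := ν) measurableSet_Ioi, Set.compl_Ioi,
    Measure.real, Measure.real, h.eq, withDensity_apply _ measurableSet_Iic,
    withDensity_apply _ measurableSet_Ici]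
  congr 1
  -- The reflection `x ↦ -x` preserves Lebesgue measure and exchanges the two half-lines.
  rw [← lintegral_indicator measurableSet_Iic, ← lintegral_indicator measurableSet_Ici,
    ← lintegral_neg_eq_self]
  congr 1
  ext x
  by_cases hx : x ≤ z
  · rw [Set.indicator_of_mem (by simpa using hx), Set.indicator_of_mem (by simpa using hx),
      h.symmetric]
  · rw [Set.indicator_of_notMem (by simpa using hx), Set.indicator_of_notMem (by simpa using hx)]

theorem tail_zero (h : UnimodalDensity ν f) : tail ν 0 = 1 / 2 := by
  have := h.tail_neg 0
  rw [neg_zero] at this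
  linarith

/-- The tail is continuous, so its closed sublevel set contains its infimum, which gives `≤`. To the
left of the infimum the tail exceeds `u`, and the left limit gives `≥`. -/
theorem tail_upperQuantile (h : UnimodalDensity ν f) {u : ℝ} (hu : u ∈ Set.Ioo (0 : ℝ) 1) :
    tail ν (upperQuantile ν u) = u := by
  have hne : {z : ℝ | tail ν z ≤ u}.Nonempty :=
    ((tendsto_tail_atTop (ν := ν)).eventually (ge_mem_nhds hu.1)).exists
  have hbdd : BddBelow {z : ℝ | tail ν z ≤ u} := by
    obtain ⟨a, ha⟩ := ((tendsto_tail_atBot (ν := ν)).eventually (lt_mem_nhds hu.2)).exists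
    refine ⟨a, fun z hz => ?_⟩
    by_contra! hlt
    have := tail_antitone (ν := ν) hlt.le
    simp only [Set.mem_ofPred_eq] at hz
    linarith
  refine le_antisymm ((isClosed_le h.continuous_tail continuous_const).csInf_mem hne hbdd) ?_
  refine ge_of_tendsto (h.continuous_tail.continuousAt.continuousWithinAt
    (s := Set.Iio (upperQuantile ν u))) ?_
  filter_upwards [self_mem_nhdsWithin] with z hz
  by_contra! hlt
  exact (csInf_le hbdd hlt.le).not_gt hz

theorem upperQuantile_le_iff (h : UnimodalDensity ν f) {u z : ℝ} (hu : u ∈ Set.Ioo (0 : ℝ) 1) :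
    upperQuantile ν u ≤ z ↔ tail ν z ≤ u := by
  refine ⟨fun hz => (tail_antitone hz).trans (h.tail_upperQuantile hu).le, fun hz => ?_⟩
  obtain ⟨a, ha⟩ := ((tendsto_tail_atBot (ν := ν)).eventually (lt_mem_nhds hu.2)).exists
  refine csInf_le ⟨a, fun z hz => ?_⟩ hz
  by_contra! hlt
  have := tail_antitone (ν := ν) hlt.le
  simp only [Set.mem_ofPred_eq] at hz
  linarith

theorem upperQuantile_pos (h : UnimodalDensity ν f) {u : ℝ} (hu : u ∈ Set.Ioo (0 : ℝ) (1 / 2)) :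
    0 < upperQuantile ν u := by
  by_contra! hle
  rw [h.upperQuantile_le_iff ⟨hu.1, by linarith [hu.2]⟩, h.tail_zero] at hle
  linarith [hu.2]

/-- If `f` vanished at the quantile it would vanish beyond it, and the tail would stay equal to `u >
0` instead of tending to zero. -/
theorem pos_upperQuantile (h : UnimodalDensity ν f) {u : ℝ} (hu : u ∈ Set.Ioo (0 : ℝ) (1 / 2)) :
    0 < f (upperQuantile ν u) := by
  have hz := h.upperQuantile_pos hu
  have hT := h.tail_upperQuantile (u := u) ⟨hu.1, by linarith [hu.2]⟩
  refine (h.nonneg _).lt_of_ne fun h0 => ?_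
  obtain ⟨b, hb, hzb⟩ := (((tendsto_tail_atTop (ν := ν)).eventually (gt_mem_nhds hu.1)).and
    (eventually_ge_atTop (upperQuantile ν u))).exists
  have := h.tail_sub_le_of_le hzb (K := 0) fun x hx => by
    rw [h0]
    exact h.antitoneOn hz.le (hz.le.trans hx.1.le) hx.1.le
  linarith

/-- The bound has to be uniform in `z`, since the radius blows up as the level approaches `B`; the
Lipschitz constant `f 0` would leave a factor `z`. Beyond `a > 0` the density is at most `C / a`,
and this cancels the factor. If `b < 1/2` the left side is at most `1 ≤ 2 |b - 1|`. -/
theorem abs_tail_mul_sub_le (h : UnimodalDensity ν f) {C : ℝ} (hC : ∀ x, |x| * f x ≤ C) {b z : ℝ}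
    (hz : 0 ≤ z) : |tail ν (b * z) - tail ν z| ≤ (2 * C + 2) * |b - 1| := by
  have hC0 : 0 ≤ C := (mul_nonneg (abs_nonneg 0) (h.nonneg 0)).trans (hC 0)
  rcases hz.eq_or_lt with rfl | hz
  · simpa using by positivity
  have key : ∀ a c : ℝ, 0 < a → a ≤ c → tail ν a - tail ν c ≤ C / a * (c - a) := fun a c ha hac =>
    h.tail_sub_le_of_le hac fun x hx => by
      have h1 := hC x
      rw [abs_of_pos (ha.trans hx.1)] at h1
      rw [le_div_iff₀ ha]
      nlinarith [h.nonneg x, hx.1]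
  rcases lt_or_ge b (1 / 2) with hb2 | hb2
  · have h1 : 1 / 2 ≤ |b - 1| := by rw [abs_of_neg (by linarith)]; linarith
    have h2 : |tail ν (b * z) - tail ν z| ≤ 1 := by
      rw [abs_le]
      constructor <;> linarith [tail_nonneg (ν := ν) z, tail_nonneg (ν := ν) (b * z),
        tail_le_one (ν := ν) z, tail_le_one (ν := ν) (b * z)]
    nlinarith
  · have hbz : 0 < b * z := by positivity
    rcases le_total b 1 with hb1 | hb1
    · have hle : b * z ≤ z := by nlinarith
      rw [abs_of_nonneg (by linarith [tail_antitone (ν := ν) hle]), abs_of_nonpos (by linarith)]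
      refine (key _ _ hbz hle).trans ?_
      rw [div_mul_eq_mul_div, div_le_iff₀ hbz]
      have : 0 ≤ C * ((1 - b) * (b - 1 / 2)) * z :=
        mul_nonneg (mul_nonneg hC0 (mul_nonneg (by linarith) (by linarith))) hz.le
      have : 0 ≤ (1 - b) * (b * z) := mul_nonneg (by linarith) hbz.le
      nlinarith
    · have hle : z ≤ b * z := by nlinarith
      rw [abs_sub_comm, abs_of_nonneg (by linarith [tail_antitone (ν := ν) hle]),
        abs_of_nonneg (by linarith)]
      refine (key _ _ hz hle).trans ?_
      rw [div_mul_eq_mul_div, div_le_iff₀ hz]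
      have : 0 ≤ C * (b - 1) * z := mul_nonneg (mul_nonneg hC0 (by linarith)) hz.le
      have : 0 ≤ (b - 1) * z := mul_nonneg (by linarith) hz.le
      nlinarith

end UnimodalDensity

/-! ### The normal quantile and the radius of the prediction intervals -/

theorem unimodalDensity_gaussianReal :
    UnimodalDensity (gaussianReal 0 1) (gaussianPDFReal 0 1) where
  nonneg := gaussianPDFReal_nonneg 0 1
  eq := gaussianReal_of_var_ne_zero 0 one_ne_zero
  continuous := by
    unfold gaussianPDFReal
    fun_prop
  symmetric x := by simp [gaussianPDFReal]
  antitoneOn x hx y hy hxy := by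
    simp only [gaussianPDFReal]
    gcongr ?_ * Real.exp ?_
    simp only [sub_zero, NNReal.coe_one, mul_one]
    have : x ^ 2 ≤ y ^ 2 := pow_le_pow_left₀ hx hxy 2
    linarith

theorem normalQuantile_eq (p : ℝ) :
    normalQuantile p = upperQuantile (gaussianReal 0 1) (1 - p) := by
  rw [normalQuantile, upperQuantile]
  congr 1
  ext z
  simp only [Set.mem_ofPred_eq, tail_eq_one_sub_cdf]
  constructor <;> intro h <;> linarith

/-- These are default values of `sInf`: the set is all of `ℝ` for `p ≤ 0` and empty for `p ≥ 1`.
They matter only for the measurability of the quantile on the whole line. -/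
theorem normalQuantile_of_notMem {p : ℝ} (hp : p ∉ Set.Ioo (0 : ℝ) 1) : normalQuantile p = 0 := by
  rw [normalQuantile_eq, upperQuantile]
  rcases le_or_gt p 0 with h0 | h0
  · rw [show {z : ℝ | tail (gaussianReal 0 1) z ≤ 1 - p} = Set.univ from
      Set.eq_univ_of_forall fun z => (tail_le_one z).trans (by linarith), Real.sInf_univ]
  · have h1 : 1 ≤ p := by
      by_contra! h1
      exact hp ⟨h0, h1⟩
    rw [show {z : ℝ | tail (gaussianReal 0 1) z ≤ 1 - p} = ∅ from
      Set.eq_empty_of_forall_notMem fun z hz => ?_, Real.sInf_empty]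
    -- The Gaussian charges `(|z|, |z| + 1]`, so its tail at `z` is positive and cannot be at most
    -- `1 - p ≤ 0`.
    have h3 := unimodalDensity_gaussianReal.le_tail_sub (a := |z|) (b := |z| + 1) (abs_nonneg z)
      (by linarith) le_rfl
    have h4 : 0 < gaussianPDFReal 0 1 (|z| + 1) := gaussianPDFReal_pos 0 1 _ one_ne_zero
    have h5 := tail_antitone (ν := gaussianReal 0 1) (le_abs_self z)
    have h6 := tail_nonneg (ν := gaussianReal 0 1) (|z| + 1)
    simp only [Set.mem_ofPred_eq] at hz
    nlinarith

theorem measurable_normalQuantile : Measurable normalQuantile := by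
  refine measurable_of_Iic fun z => ?_
  have : normalQuantile ⁻¹' Set.Iic z =
      (Set.Ioo 0 1 ∩ {p | tail (gaussianReal 0 1) z ≤ 1 - p}) ∪
        ((Set.Ioo 0 1)ᶜ ∩ {_p | 0 ≤ z}) := by
    ext p
    by_cases hp : p ∈ Set.Ioo (0 : ℝ) 1
    · simp only [Set.mem_preimage, Set.mem_Iic, normalQuantile_eq,
        unimodalDensity_gaussianReal.upperQuantile_le_iff
          (u := 1 - p) ⟨by linarith [hp.2], by linarith [hp.1]⟩]
      simp [hp.1, hp.2]
    · simp only [Set.mem_preimage, Set.mem_Iic, normalQuantile_of_notMem hp]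
      simp [-Set.mem_Ioo, hp]
  rw [this]
  refine (measurableSet_Ioo.inter (measurableSet_le measurable_const ?_)).union
    (measurableSet_Ioo.compl.inter (MeasurableSet.const _))
  fun_prop

/-- The factor of `σ̂` in the half-length of the prediction interval at level `q < B`. -/
def radius (B q : ℝ) : ℝ := if q ≤ 0 then 0 else normalQuantile ((q + B) / (2 * B))

theorem measurable_radius (B : ℝ) : Measurable (radius B) :=
  Measurable.ite measurableSet_Iic measurable_const
    (measurable_normalQuantile.comp (by fun_prop))

/-- The Gaussian tail at the radius is affine in the positive part of the level. Every comparison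
between levels and radii below passes through this identity. -/
theorem tail_radius {B q : ℝ} (hB : 0 < B) (hq : q < B) :
    tail (gaussianReal 0 1) (radius B q) = 1 / 2 - max q 0 / (2 * B) := by
  rw [radius]
  split_ifs with h
  · rw [unimodalDensity_gaussianReal.tail_zero, max_eq_right h]
    simp
  · push Not at h
    rw [normalQuantile_eq, unimodalDensity_gaussianReal.tail_upperQuantile, max_eq_left h.le]
    · field_simp
      ring
    · constructor
      · rw [sub_pos, div_lt_one (by linarith)]
        linarith
      · linarith [show 0 < (q + B) / (2 * B) by positivity]

theorem gaussian_tail_strictAntiOn {a b : ℝ} (ha : 0 ≤ a) (hab : a < b) :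
    tail (gaussianReal 0 1) b < tail (gaussianReal 0 1) a := by
  have h3 := unimodalDensity_gaussianReal.le_tail_sub ha hab.le le_rfl
  have h4 : 0 < gaussianPDFReal 0 1 b := gaussianPDFReal_pos 0 1 _ one_ne_zero
  nlinarith

theorem radius_nonneg {B q : ℝ} (hq : q < B) : 0 ≤ radius B q := by
  rw [radius]
  split_ifs with h
  · rfl
  · push Not at h
    rw [normalQuantile_eq]
    refine (unimodalDensity_gaussianReal.upperQuantile_pos ⟨?_, ?_⟩).le
    · rw [sub_pos, div_lt_one (by linarith)]
      linarith
    · have : 1 / 2 < (q + B) / (2 * B) := by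
        rw [lt_div_iff₀ (by linarith)]
        linarith
      linarith

/-- The level at which the radius equals `z`. -/
def levelOf (B z : ℝ) : ℝ := B * (1 - 2 * tail (gaussianReal 0 1) z)

theorem levelOf_lt {B : ℝ} (hB : 0 < B) {z : ℝ} (hz : 0 ≤ z) : levelOf B z < B := by
  have h1 := gaussian_tail_strictAntiOn hz (lt_add_one z)
  have h2 := tail_nonneg (ν := gaussianReal 0 1) (z + 1)
  rw [levelOf]
  nlinarith

theorem levelOf_strictMono {B : ℝ} (hB : 0 < B) {a b : ℝ} (ha : 0 ≤ a) (hab : a < b) :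
    levelOf B a < levelOf B b := by
  have h1 := gaussian_tail_strictAntiOn ha hab
  rw [levelOf, levelOf]
  nlinarith

theorem levelOf_zero (B : ℝ) : levelOf B 0 = 0 := by
  rw [levelOf, unimodalDensity_gaussianReal.tail_zero]
  ring

theorem max_sub_levelOf {B : ℝ} (hB : 0 < B) {q : ℝ} (hq : q < B) (z : ℝ) :
    max q 0 - levelOf B z =
      2 * B * (tail (gaussianReal 0 1) z - tail (gaussianReal 0 1) (radius B q)) := by
  rw [tail_radius hB hq, levelOf]
  field_simp
  ring

/-- The radius is at most `z` exactly up to the level of `z`. -/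
theorem radius_le_iff {B : ℝ} (hB : 0 < B) {q : ℝ} (hq : q < B) {z : ℝ} (hz : 0 ≤ z) :
    radius B q ≤ z ↔ max q 0 ≤ levelOf B z := by
  have h := max_sub_levelOf hB hq z
  constructor
  · intro hr
    have := tail_antitone (ν := gaussianReal 0 1) hr
    nlinarith
  · intro hr
    by_contra! hlt
    have := gaussian_tail_strictAntiOn hz hlt
    nlinarith

end OnlineSCI

end

noncomputable section

namespace OnlineSCI

/-! ### Miscoverage as a function of the level -/

/-- The miscoverage of the interval at level `q` built on the true location and scale. -/
def idealMiss (ν : Measure ℝ) (B q : ℝ) : ℝ := if B ≤ q then 0 else 2 * tail ν (radius B q)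

/-- The miscoverage, for a response of location `a` and scale `b`, of the interval at level `q`
built on the location `m` and the scale `s`. -/
def miss (ν : Measure ℝ) (B m s q a b : ℝ) : ℝ := ν.real {z | a + b * z ∉ interval B m s q}

section Level

variable {ν : Measure ℝ} [IsProbabilityMeasure ν] {f : ℝ → ℝ} {B : ℝ}

theorem abs_max_sub_levelOf_le (hB : 0 < B) {q : ℝ} (hq : q < B) (z : ℝ) :
    |max q 0 - levelOf B z| ≤ 2 * B * gaussianPDFReal 0 1 0 * |radius B q - z| := by
  rw [max_sub_levelOf hB hq, abs_mul, abs_of_pos (by positivity), mul_assoc (2 * B),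
    abs_sub_comm _ z]
  exact mul_le_mul_of_nonneg_left (unimodalDensity_gaussianReal.abs_tail_sub_le _ _)
    (by positivity)

/-- Mean reversion. Continuity gives `R > z` with `f R > 0`. For levels between 0 and that of `R`,
the miscoverage has slope at least `k₁`. Outside this range it is no longer strictly monotone in a
controlled way, but it stays a fixed distance from `α`, and the bounded range of `q` turns that
distance into a linear bound. -/
theorem exists_drift (h : UnimodalDensity ν f) (hB : 0 < B) {z α c : ℝ} (hz : 0 < z)
    (hfz : 0 < f z) (hα : tail ν z = α / 2) (hc : 0 ≤ c) :
    ∃ κ > 0, ∀ q ∈ Set.Icc (-c) (B + c),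
      (q - levelOf B z) * (idealMiss ν B q - α) ≤ -κ * (q - levelOf B z) ^ 2 := by
  obtain ⟨R, hfR, hzR⟩ : ∃ R, 0 < f R ∧ z < R :=
    (((h.continuous.continuousAt.eventually (lt_mem_nhds hfz)).filter_mono
      nhdsWithin_le_nhds).and (self_mem_nhdsWithin (s := Set.Ioi z))).exists
  have hqz : 0 < levelOf B z := by
    have := levelOf_strictMono hB le_rfl hz
    rwa [levelOf_zero] at this
  have hqB := levelOf_lt hB hz.le
  have hg : 0 < gaussianPDFReal 0 1 0 := gaussianPDFReal_pos 0 1 _ one_ne_zero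
  set qz := levelOf B z
  set g := gaussianPDFReal 0 1 0
  -- The miscoverage moves by at least `2 f(R)` times the change of radius, and the level by at most
  -- `2 B g` times it.
  set k₁ := f R / (B * g)
  have hk₁ : 0 < k₁ := by positivity
  -- For `q ≤ 0` the excess over `α` is at least `k₁ * qz`, while `qz - q ≤ B + c`.
  set k₂ := k₁ * qz / (B + c)
  have hk₂ : 0 < k₂ := by positivity
  -- Beyond the level of `R` the deficit is at least `2 f(R) (R - z)`, while `q - qz ≤ B + c`.
  set k₃ := 2 * f R * (R - z) / (B + c)
  have hk₃ : 0 < k₃ := by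
    have : 0 < R - z := by linarith
    positivity
  refine ⟨min k₁ (min k₂ k₃), by positivity, fun q hq => ?_⟩
  set κ := min k₁ (min k₂ k₃)
  have h1 : κ ≤ k₁ := min_le_left _ _
  have h2 : κ ≤ k₂ := (min_le_right _ _).trans (min_le_left _ _)
  have h3 : κ ≤ k₃ := (min_le_right _ _).trans (min_le_right _ _)
  have hκ : 0 < κ := by positivity
  have hmax : ∀ hq : q < B, k₁ * |max q 0 - qz| ≤ 2 * f R * |radius B q - z| := fun hq => by
    have := abs_max_sub_levelOf_le hB hq z
    calc k₁ * |max q 0 - qz| ≤ k₁ * (2 * B * g * |radius B q - z|) := by gcongr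
      _ = 2 * f R * |radius B q - z| := by
        simp only [k₁]
        field_simp
  rcases le_or_gt q qz with hqq | hqq
  · have hlt : q < B := hqq.trans_lt hqB
    have hr : radius B q ≤ z := (radius_le_iff hB hlt hz.le).2 (max_le hqq hqz.le)
    have hm := hmax hlt
    rw [abs_of_nonpos (sub_nonpos.2 hr), abs_of_nonpos (sub_nonpos.2 (max_le hqq hqz.le))] at hm
    have ht := h.le_tail_sub (radius_nonneg hlt) hr hzR.le
    have hi : idealMiss ν B q = 2 * tail ν (radius B q) := by
      rw [idealMiss, if_neg (not_le.2 hlt)]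
    have hlow : κ * (qz - q) ≤ idealMiss ν B q - α := by
      have h4 : k₁ * (qz - max q 0) ≤ idealMiss ν B q - α := by linarith
      refine le_trans ?_ h4
      rcases le_or_gt q 0 with hq0 | hq0
      · rw [max_eq_right hq0]
        have h5 : qz - q ≤ B + c := by linarith [hq.1]
        calc κ * (qz - q) ≤ k₂ * (B + c) := by gcongr
          _ = k₁ * (qz - 0) := by
            simp only [k₂]
            field_simp
            ring
      · rw [max_eq_left hq0.le]
        gcongr
    nlinarith
  · have hq0 : 0 < q := hqz.trans hqq
    suffices hup : κ * (q - qz) ≤ α - idealMiss ν B q by nlinarith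
    rcases le_or_gt q (levelOf B R) with hqR | hqR
    · have hlt : q < B := hqR.trans_lt (levelOf_lt hB (hz.trans hzR).le)
      have hr : radius B q ≤ R := (radius_le_iff hB hlt (hz.trans hzR).le).2
        (max_le hqR (hq0.le.trans hqR))
      have hr' : z ≤ radius B q := by
        by_contra! hlt'
        have := (radius_le_iff hB hlt hz.le).1 hlt'.le
        linarith [le_max_left q 0]
      have hm := hmax hlt
      rw [max_eq_left hq0.le, abs_of_nonneg (sub_nonneg.2 hr'),
        abs_of_nonneg (sub_nonneg.2 hqq.le)] at hm
      have ht := h.le_tail_sub hz.le hr' hr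
      have hi : idealMiss ν B q = 2 * tail ν (radius B q) := by
        rw [idealMiss, if_neg (not_le.2 hlt)]
      have : κ * (q - qz) ≤ k₁ * (q - qz) := by gcongr
      linarith
    · have hi : idealMiss ν B q ≤ 2 * tail ν R := by
        rw [idealMiss]
        split_ifs with hBq
        · linarith [tail_nonneg (ν := ν) R]
        · push Not at hBq
          have : R ≤ radius B q := by
            by_contra! hlt'
            have := (radius_le_iff hB hBq (hz.trans hzR).le).1 hlt'.le
            linarith [le_max_left q 0]
          linarith [tail_antitone (ν := ν) this]
      have ht := h.le_tail_sub hz.le hzR.le le_rfl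
      have h5 : q - qz ≤ B + c := by linarith [hq.2]
      have : κ * (q - qz) ≤ k₃ * (B + c) := by gcongr
      have h6 : k₃ * (B + c) = 2 * f R * (R - z) := by
        simp only [k₃]
        field_simp
      linarith

/-- Only radii below `z` can push the miscoverage above `α`. There the Gaussian density is at least
its value at `z` and `f` is at most `f 0`, so the ratio of the two gives a constant valid for all
`q`, with no trouble near `B`. -/
theorem exists_idealMiss_le (h : UnimodalDensity ν f) (hB : 0 < B) {z α : ℝ}
    (hα : tail ν z = α / 2) :
    ∃ L ≥ 0, ∀ q, idealMiss ν B q ≤ α + L * |q - levelOf B z| := by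
  have hg : 0 < gaussianPDFReal 0 1 z := gaussianPDFReal_pos 0 1 _ one_ne_zero
  have hf0 := h.nonneg 0
  refine ⟨f 0 / (B * gaussianPDFReal 0 1 z), by positivity, fun q => ?_⟩
  have hnn : 0 ≤ f 0 / (B * gaussianPDFReal 0 1 z) * |q - levelOf B z| := by positivity
  rw [idealMiss]
  split_ifs with hBq
  · linarith [tail_nonneg (ν := ν) z]
  push Not at hBq
  rcases le_total z (radius B q) with hr | hr
  · linarith [tail_antitone (ν := ν) hr]
  have h1 := h.tail_sub_le hr
  have h2 := unimodalDensity_gaussianReal.le_tail_sub (radius_nonneg hBq) hr le_rfl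
  have h3 := max_sub_levelOf hB hBq z
  have h4 : 2 * B * gaussianPDFReal 0 1 z * (z - radius B q) ≤ |q - levelOf B z| := by
    have h5 := neg_le_abs (q - levelOf B z)
    have h6 := le_max_left q 0
    have h7 := mul_le_mul_of_nonneg_left h2 (by positivity : 0 ≤ 2 * B)
    nlinarith
  have h8 : 2 * (f 0 * (z - radius B q)) = f 0 / (B * gaussianPDFReal 0 1 z) *
      (2 * B * gaussianPDFReal 0 1 z * (z - radius B q)) := by field_simp
  have h9 := mul_le_mul_of_nonneg_left h4
    (by positivity : 0 ≤ f 0 / (B * gaussianPDFReal 0 1 z))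
  linarith

/-- The radius has infinite slope at `B`. Keeping `q` below the level of `R` confines it to `[0,
R]`, where the Gaussian density is bounded below. -/
theorem exists_radius_le (hB : 0 < B) {z R : ℝ} (hz : 0 ≤ z) (hzR : z ≤ R) :
    ∃ L ≥ 0, ∀ q ≤ levelOf B R, radius B q ≤ R ∧ radius B q ≤ z + L * |q - levelOf B z| := by
  have hg : 0 < gaussianPDFReal 0 1 R := gaussianPDFReal_pos 0 1 _ one_ne_zero
  have hR := hz.trans hzR
  have hR0 : 0 ≤ levelOf B R := by
    rcases hR.eq_or_lt with rfl | hR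
    · rw [levelOf_zero]
    · have := levelOf_strictMono hB le_rfl hR
      rw [levelOf_zero] at this
      exact this.le
  have hz0 : 0 ≤ levelOf B z := by
    rcases hz.eq_or_lt with rfl | hz
    · rw [levelOf_zero]
    · have := levelOf_strictMono hB le_rfl hz
      rw [levelOf_zero] at this
      exact this.le
  refine ⟨1 / (2 * B * gaussianPDFReal 0 1 R), by positivity, fun q hq => ?_⟩
  have hqB := hq.trans_lt (levelOf_lt hB hR)
  have hrR := (radius_le_iff hB hqB hR).2 (max_le hq hR0)
  refine ⟨hrR, ?_⟩
  rcases le_total (radius B q) z with hr | hr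
  · have : 0 ≤ 1 / (2 * B * gaussianPDFReal 0 1 R) * |q - levelOf B z| := by positivity
    linarith
  have h2 := unimodalDensity_gaussianReal.le_tail_sub hz hr hrR
  have h3 := max_sub_levelOf hB hqB z
  have h4 : 2 * B * gaussianPDFReal 0 1 R * (radius B q - z) ≤ |q - levelOf B z| := by
    have h5 : max q 0 - levelOf B z ≤ |q - levelOf B z| := by
      rcases max_cases q 0 with ⟨h, -⟩ | ⟨h, -⟩ <;> rw [h]
      · exact le_abs_self _
      · linarith [abs_nonneg (q - levelOf B z)]
    have h7 := mul_le_mul_of_nonneg_left h2 (by positivity : 0 ≤ 2 * B)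
    nlinarith
  have h9 := mul_le_mul_of_nonneg_left h4
    (by positivity : 0 ≤ 1 / (2 * B * gaussianPDFReal 0 1 R))
  have h8 : 1 / (2 * B * gaussianPDFReal 0 1 R) *
    (2 * B * gaussianPDFReal 0 1 R * (radius B q - z)) = radius B q - z := by field_simp
  linarith

theorem miss_of_nonpos (h : UnimodalDensity ν f) (B m s : ℝ) {q : ℝ} (a : ℝ) {b : ℝ} (hb : 0 < b)
    (hq : q ≤ 0) : miss ν B m s q a b = 1 := by
  have hset : {z | a + b * z ∉ interval B m s q} = {(m - a) / b}ᶜ := by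
    ext z
    simp only [interval, if_pos hq, Set.mem_singleton_iff, Set.mem_ofPred_eq, Set.mem_compl_iff,
      eq_div_iff hb.ne']
    constructor <;> intro h1 h2 <;> apply h1 <;> linarith
  rw [miss, hset, probReal_compl_eq_one_sub (measurableSet_singleton _), Measure.real, h.noAtoms]
  simp

/-- In units of the noise the interval is `u ± v r`, with `u = (m - a) / b` and `v = s / b`. Each
endpoint pays `f 0 * |u|` for the shift and `(2C + 2) * |v - 1|` for the scale. At `q ≤ 0` both
miscoverages are 1, and at `q ≥ B` both are 0. -/
theorem abs_miss_sub_idealMiss_le (h : UnimodalDensity ν f) (hB : 0 < B) {C : ℝ}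
    (hC : ∀ x, |x| * f x ≤ C) {s₀ : ℝ} (m : ℝ) {s : ℝ} (q a : ℝ) {b : ℝ} (hs : 0 ≤ s) (hb : 0 < b)
    (hbs : 1 / b ≤ s₀) :
    |miss ν B m s q a b - idealMiss ν B q| ≤
      s₀ * (2 * f 0 + 2 * (2 * C + 2)) * (|m - a| + |s - b|) := by
  have hf0 := h.nonneg 0
  have hs₀ : 0 < s₀ := (by positivity : 0 < 1 / b).trans_le hbs
  have hC0 : 0 ≤ C := (mul_nonneg (abs_nonneg 0) hf0).trans (hC 0)
  have hnn : 0 ≤ s₀ * (2 * f 0 + 2 * (2 * C + 2)) * (|m - a| + |s - b|) := by positivity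
  rcases le_or_gt q 0 with hq0 | hq0
  · rw [miss_of_nonpos h B m s a hb hq0, idealMiss, if_neg (by linarith), radius, if_pos hq0,
      h.tail_zero]
    simpa using hnn
  rcases le_or_gt B q with hqB | hqB
  · rw [miss, idealMiss, if_pos hqB]
    simpa [interval, if_neg (not_le.2 hq0), if_pos hqB] using hnn
  have hr := radius_nonneg hqB
  set r := radius B q with hrdef
  have hset : {z | a + b * z ∉ interval B m s q} =
      (Set.Icc ((m - a) / b - s / b * r) ((m - a) / b + s / b * r))ᶜ := by
    ext z
    simp only [interval, if_neg (not_le.2 hq0), if_neg (not_le.2 hqB), Set.mem_ofPred_eq,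
      Set.mem_compl_iff, Set.mem_Icc]
    rw [show normalQuantile ((q + B) / (2 * B)) = r by
      rw [hrdef, radius, if_neg (not_le.2 hq0)]]
    have e1 : (m - a) / b - s / b * r = (m - a - s * r) / b := by ring
    have e2 : (m - a) / b + s / b * r = (m - a + s * r) / b := by ring
    rw [e1, e2, div_le_iff₀ hb, le_div_iff₀ hb]
    constructor <;> rintro h1 ⟨h2, h3⟩ <;> apply h1 <;> constructor <;> linarith
  have hvr : 0 ≤ s / b * r := by positivity
  rw [miss, hset, probReal_compl_eq_one_sub measurableSet_Icc, h.real_Icc (by linarith), idealMiss,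
    if_neg (not_le.2 hqB)]
  set u := (m - a) / b
  set v := s / b
  have hu : |u| ≤ s₀ * |m - a| := by
    rw [abs_div, abs_of_pos hb, div_eq_mul_one_div, mul_comm]
    gcongr
  have hv : |v - 1| ≤ s₀ * |s - b| := by
    rw [show v - 1 = (s - b) / b by simp only [v]; field_simp, abs_div, abs_of_pos hb,
      div_eq_mul_one_div, mul_comm]
    gcongr
  have t1 := h.abs_tail_sub_le (u - v * r) (-(v * r))
  have t2 := h.abs_tail_sub_le (u + v * r) (v * r)
  have t3 := h.abs_tail_mul_sub_le hC (b := v) (z := r) hr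
  have t4 := h.tail_neg (v * r)
  rw [show u - v * r - -(v * r) = u by ring] at t1
  rw [show u + v * r - v * r = u by ring] at t2
  have hu' := mul_le_mul_of_nonneg_left hu hf0
  have hv' := mul_le_mul_of_nonneg_left hv (by positivity : 0 ≤ 2 * C + 2)
  have hrest : 0 ≤ s₀ * (2 * f 0) * |s - b| + s₀ * (2 * (2 * C + 2)) * |m - a| := by positivity
  rw [abs_le] at t1 t2 t3 ⊢
  constructor <;> nlinarith

theorem measurableSet_interval (B m s q : ℝ) : MeasurableSet (interval B m s q) := by
  rw [interval]
  split_ifs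
  exacts [measurableSet_singleton m, MeasurableSet.univ, measurableSet_Icc]

theorem volume_interval {m s q : ℝ} (hqB : q < B) :
    volume (interval B m s q) = ENNReal.ofReal (2 * s * radius B q) := by
  rw [interval, radius]
  split_ifs with h h'
  · simp
  · exact absurd hqB (not_lt.2 h')
  · rw [Real.volume_Icc]
    congr 1
    ring

/-- The reaction imposed at negative levels introduces no bias: it is 1, which is also the
miscoverage of a single point, as the noise has no atoms. -/
theorem integral_react (h : UnimodalDensity ν f) (B m s q a : ℝ) {b : ℝ} (hb : 0 < b) :
    ∫ z, react (a + b * z) (interval B m s q) q ∂ν = miss ν B m s q a b := by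
  rcases lt_or_ge q 0 with hq | hq
  · rw [miss_of_nonpos h B m s a hb hq.le]
    simp [react, hq, not_le.2 hq]
  · have hm : MeasurableSet {z | a + b * z ∉ interval B m s q} :=
      (measurableSet_interval B m s q).compl.preimage (by fun_prop)
    have : (fun z => react (a + b * z) (interval B m s q) q) =
        {z | a + b * z ∉ interval B m s q}.indicator 1 := by
      ext z
      by_cases hz : a + b * z ∈ interval B m s q <;> simp [react, hq, not_lt.2 hq, hz]
    rw [this, integral_indicator_one hm, miss]

end Level

/-! ### Minimal volume of sets of given probability -/

/-- Neyman–Pearson: the density is at least `f z` on `[-z, z]` and at most `f z` off it, so it is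
enough to compare the two measures on the two set differences. The additive form stays meaningful
when `A` has infinite volume. -/
theorem UnimodalDensity.volume_Icc_add_le {ν : Measure ℝ} [IsProbabilityMeasure ν]
    {f : ℝ → ℝ} (h : UnimodalDensity ν f) {z : ℝ} (hz : 0 ≤ z) {A : Set ℝ} (hA : MeasurableSet A) :
    ENNReal.ofReal (f z) * volume (Set.Icc (-z) z) + ν A ≤
      ENNReal.ofReal (f z) * volume A + ν (Set.Icc (-z) z) := by
  have hI : MeasurableSet (Set.Icc (-z) z) := measurableSet_Icc
  set I := Set.Icc (-z) z
  set θ := ENNReal.ofReal (f z)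
  have h1 : ν (A \ I) ≤ θ * volume (A \ I) := by
    rw [h.eq, withDensity_apply _ (hA.diff hI), ← setLIntegral_const]
    refine setLIntegral_mono measurable_const fun x hx => ENNReal.ofReal_le_ofReal ?_
    refine h.le_of_abs_le ?_
    rw [abs_of_nonneg hz]
    by_contra! hlt
    exact hx.2 ⟨(abs_lt.1 hlt).1.le, (abs_lt.1 hlt).2.le⟩
  have h2 : θ * volume (I \ A) ≤ ν (I \ A) := by
    rw [h.eq, withDensity_apply _ (hI.diff hA), ← setLIntegral_const]
    refine setLIntegral_mono h.continuous.measurable.ennreal_ofReal fun x hx =>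
      ENNReal.ofReal_le_ofReal ?_
    refine h.le_of_abs_le ?_
    rw [abs_of_nonneg hz]
    exact abs_le.2 hx.1
  rw [← measure_inter_add_sdiff (μ := volume) I hA, ← measure_inter_add_sdiff (μ := volume) A hI,
    ← measure_inter_add_sdiff (μ := ν) A hI, ← measure_inter_add_sdiff (μ := ν) I hA,
    Set.inter_comm I A, mul_add, mul_add]
  calc θ * volume (A ∩ I) + θ * volume (I \ A) + (ν (A ∩ I) + ν (A \ I))
      ≤ θ * volume (A ∩ I) + ν (I \ A) + (ν (A ∩ I) + θ * volume (A \ I)) := by gcongr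
    _ = _ := by ring

/-- The change of variable `x ↦ a + b x` multiplies volumes by `b`. Dividing by `f z` shows that `b
/ f z` is the exchange rate between probability and length. -/
theorem UnimodalDensity.volume_oracle_add_le {ν : Measure ℝ} [IsProbabilityMeasure ν]
    {f : ℝ → ℝ} (h : UnimodalDensity ν f) {z : ℝ} (hz : 0 ≤ z) (hfz : 0 < f z) (a : ℝ)
    {b : ℝ} (hb : 0 < b) {A : Set ℝ} (hA : MeasurableSet A) :
    volume (Set.Icc (a - b * z) (a + b * z)) + ENNReal.ofReal (b / f z) * ν {x | a + b * x ∈ A} ≤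
      volume A + ENNReal.ofReal (b / f z) * ν (Set.Icc (-z) z) := by
  have hmeas : Measurable fun x => a + b * x := by fun_prop
  have key := h.volume_Icc_add_le hz (A := {x | a + b * x ∈ A}) (hmeas hA)
  have hvol : volume {x | a + b * x ∈ A} = ENNReal.ofReal b⁻¹ * volume A := by
    have h1 : {x | a + b * x ∈ A} = (b * ·) ⁻¹' ((a + ·) ⁻¹' A) := rfl
    rw [h1, Real.volume_preimage_mul_left hb.ne', measure_preimage_add, abs_of_pos (by positivity)]
  rw [hvol, Real.volume_Icc] at key
  have h2 := mul_le_mul_right key (ENNReal.ofReal (b / f z))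
  rw [mul_add, mul_add, ← mul_assoc, ← mul_assoc, ← mul_assoc,
    ← ENNReal.ofReal_mul (by positivity), ← ENNReal.ofReal_mul (by positivity),
    ← ENNReal.ofReal_mul (by positivity), show b / f z * f z * b⁻¹ = 1 by field_simp,
    ENNReal.ofReal_one, one_mul, show b / f z * f z * (z - -z) = a + b * z - (a - b * z) by
      field_simp; ring] at h2
  rwa [Real.volume_Icc]

end OnlineSCI

end

noncomputable section

namespace OnlineSCI

/-! ### Elementary inequalities for the moment recursion -/

/-- Second-order Taylor remainder, by induction on the power: multiplying by `d + e` reproduces the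
remainder and adds one term quadratic in `e`. -/
theorem abs_add_pow_sub_le (d e : ℝ) (m : ℕ) :
    |(d + e) ^ (m + 2) - d ^ (m + 2) - (m + 2) * d ^ (m + 1) * e| ≤
      (m + 2) ^ 2 * e ^ 2 * (|d| + |e|) ^ m := by
  induction m with
  | zero =>
    rw [show (d + e) ^ (0 + 2) - d ^ (0 + 2) - (((0 : ℕ) : ℝ) + 2) * d ^ (0 + 1) * e = e ^ 2 by
      push_cast
      ring, abs_of_nonneg (sq_nonneg e)]
    push_cast
    nlinarith [sq_nonneg e]
  | succ m ih =>
    have h1 : (d + e) ^ (m + 1 + 2) - d ^ (m + 1 + 2) -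
        ((m + 1 : ℕ) + 2 : ℝ) * d ^ (m + 1 + 1) * e =
        (d + e) * ((d + e) ^ (m + 2) - d ^ (m + 2) - (m + 2) * d ^ (m + 1) * e) +
          (m + 2) * d ^ (m + 1) * e ^ 2 := by
      push_cast
      ring
    rw [h1]
    have h2 : |d + e| ≤ |d| + |e| := abs_add_le d e
    have h3 : |d ^ (m + 1)| ≤ (|d| + |e|) ^ (m + 1) := by
      rw [abs_pow]
      gcongr
      linarith [abs_nonneg e]
    calc _ ≤ |d + e| * |(d + e) ^ (m + 2) - d ^ (m + 2) - (m + 2) * d ^ (m + 1) * e| +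
          (m + 2) * |d ^ (m + 1)| * e ^ 2 := by
          refine (abs_add_le _ _).trans ?_
          rw [abs_mul, abs_mul, abs_mul, abs_of_nonneg (sq_nonneg e),
            abs_of_nonneg (by positivity : (0 : ℝ) ≤ m + 2)]
      _ ≤ (|d| + |e|) * ((m + 2) ^ 2 * e ^ 2 * (|d| + |e|) ^ m) +
          (m + 2) * (|d| + |e|) ^ (m + 1) * e ^ 2 := by gcongr
      _ = ((m + 2) ^ 2 + (m + 2)) * (e ^ 2 * (|d| + |e|) ^ (m + 1)) := by ring
      _ ≤ ((m + 1 : ℕ) + 2) ^ 2 * (e ^ 2 * (|d| + |e|) ^ (m + 1)) := by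
          gcongr
          push_cast
          nlinarith [(Nat.cast_nonneg m : (0 : ℝ) ≤ m)]
      _ = _ := by ring

theorem pow_mul_le_young {a b η : ℝ} (ha : 0 ≤ a) (hb : 0 ≤ b) (hη : 0 < η) (m : ℕ) :
    a ^ m * b ≤ η * a ^ (m + 1) + (η ^ m)⁻¹ * b ^ (m + 1) := by
  have h1 : 0 ≤ (η ^ m)⁻¹ * b ^ (m + 1) := by positivity
  have h2 : 0 ≤ η * a ^ (m + 1) := by positivity
  rcases le_total b (η * a) with h | h
  · have : a ^ m * b ≤ a ^ m * (η * a) := by gcongr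
    calc a ^ m * b ≤ η * a ^ (m + 1) := by rw [pow_succ]; linarith
      _ ≤ _ := by linarith
  · have : (η * a) ^ m * b ≤ b ^ m * b := by gcongr
    have h3 : a ^ m * b ≤ (η ^ m)⁻¹ * b ^ (m + 1) := by
      rw [inv_mul_eq_div, le_div_iff₀ (by positivity), pow_succ]
      rw [mul_pow] at this
      linarith
    linarith

/-- Lets the estimation error be absorbed: an arbitrarily small part of the drift is spent and only
`ε ^ (2k)` remains. -/
theorem exists_young (k : ℕ) (hk : 1 ≤ k) {η : ℝ} (hη : 0 < η) :
    ∃ K ≥ 0, ∀ d ε : ℝ, 0 ≤ ε →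
      2 * k * (|d| ^ (2 * k - 1) * ε) ≤ η * d ^ (2 * k) + K * ε ^ (2 * k) := by
  obtain ⟨j, rfl⟩ : ∃ j, k = j + 1 := ⟨k - 1, by omega⟩
  set η' := η / (2 * (j + 1 : ℕ))
  have hη' : 0 < η' := by positivity
  refine ⟨2 * (j + 1 : ℕ) * (η' ^ (2 * j + 1))⁻¹, by positivity, fun d ε hε => ?_⟩
  have h := pow_mul_le_young (abs_nonneg d) hε hη' (2 * j + 1)
  rw [show 2 * j + 1 + 1 = 2 * (j + 1) by ring] at h
  rw [show 2 * (j + 1) - 1 = 2 * j + 1 by omega]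
  rw [(even_two_mul (j + 1)).pow_abs d] at h
  have h2 := mul_le_mul_of_nonneg_left h (by positivity : (0 : ℝ) ≤ 2 * (j + 1 : ℕ))
  refine h2.trans_eq ?_
  simp only [η']
  field_simp

/-- With `j = k - 1`, the Taylor remainder is of order `γ² (d^{2j} + γ^{2j})`. Young's inequality in
`d²` and `γ` trades `γ² d^{2j}` for a small multiple of `γ d^{2k}` plus `γ^{k+1}`. This power,
rather than `γ²`, is what makes the moment of order `2k` decay like `t^{-βk}`. -/
theorem exists_pow_step (k : ℕ) (hk : 1 ≤ k) {η c : ℝ} (hη : 0 < η) (hc : 0 < c) :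
    ∃ K ≥ 0, ∀ d γ h : ℝ, 0 ≤ γ → γ ≤ c → |h| ≤ 1 →
      (d + γ * h) ^ (2 * k) ≤ d ^ (2 * k) + 2 * k * (γ * d ^ (2 * k - 1) * h) +
        η * (γ * d ^ (2 * k)) + K * γ ^ (k + 1) := by
  obtain ⟨j, rfl⟩ : ∃ j, k = j + 1 := ⟨k - 1, by omega⟩
  set K₀ : ℝ := ((2 * j : ℕ) + 2) ^ 2 * 2 ^ (2 * j)
  have hK₀ : 0 < K₀ := by positivity
  set η' := η / K₀
  have hη' : 0 < η' := by positivity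
  refine ⟨K₀ * ((η' ^ j)⁻¹ + c ^ j), by positivity, fun d γ h hγ hγc hh => ?_⟩
  have h1 := (abs_le.1 (abs_add_pow_sub_le d (γ * h) (2 * j))).2
  have hγh : |γ * h| ≤ γ := by
    rw [abs_mul, abs_of_nonneg hγ]
    nlinarith
  have h2 : (γ * h) ^ 2 ≤ γ ^ 2 := by
    rw [← sq_abs]
    gcongr
  have h3 : (|d| + |γ * h|) ^ (2 * j) ≤ 2 ^ (2 * j) * (d ^ (2 * j) + γ ^ (2 * j)) := by
    have hd : |d| ^ (2 * j) = d ^ (2 * j) := Even.pow_abs (by simp) d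
    have : |d| + |γ * h| ≤ 2 * max |d| γ := by
      linarith [le_max_left |d| γ, le_max_right |d| γ]
    calc (|d| + |γ * h|) ^ (2 * j) ≤ (2 * max |d| γ) ^ (2 * j) := by gcongr
      _ = 2 ^ (2 * j) * (max |d| γ) ^ (2 * j) := mul_pow _ _ _
      _ ≤ 2 ^ (2 * j) * (d ^ (2 * j) + γ ^ (2 * j)) := by
        gcongr
        have hd0 : 0 ≤ d ^ (2 * j) := by rw [← hd]; positivity
        rcases max_cases |d| γ with ⟨h, -⟩ | ⟨h, -⟩ <;> rw [h]
        · rw [hd]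
          linarith [pow_nonneg hγ (2 * j)]
        · linarith
  have h4 := pow_mul_le_young (sq_nonneg d) hγ hη' j
  have h5 : γ ^ (2 * j) * γ ^ 2 ≤ c ^ j * γ ^ (j + 2) := by
    have : γ ^ j ≤ c ^ j := by gcongr
    calc γ ^ (2 * j) * γ ^ 2 = γ ^ j * γ ^ (j + 2) := by ring
      _ ≤ _ := by gcongr
  have h6 : ((2 * j : ℕ) + 2 : ℝ) ^ 2 * (γ * h) ^ 2 * (|d| + |γ * h|) ^ (2 * j) ≤
      K₀ * (γ ^ 2 * (d ^ (2 * j) + γ ^ (2 * j))) := by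
    calc _ ≤ ((2 * j : ℕ) + 2 : ℝ) ^ 2 * γ ^ 2 * (2 ^ (2 * j) * (d ^ (2 * j) + γ ^ (2 * j))) := by
          gcongr
      _ = _ := by simp only [K₀]; ring
  have h7 : K₀ * (γ ^ 2 * (d ^ (2 * j) + γ ^ (2 * j))) ≤
      η * (γ * d ^ (2 * j + 2)) + K₀ * ((η' ^ j)⁻¹ + c ^ j) * γ ^ (j + 2) := by
    have h8 : γ * ((d ^ 2) ^ j * γ) ≤
        γ * (η' * (d ^ 2) ^ (j + 1) + (η' ^ j)⁻¹ * γ ^ (j + 1)) := by gcongr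
    have h9 : γ ^ 2 * (d ^ (2 * j) + γ ^ (2 * j)) ≤
        η' * (γ * d ^ (2 * j + 2)) + ((η' ^ j)⁻¹ + c ^ j) * γ ^ (j + 2) := by
      calc γ ^ 2 * (d ^ (2 * j) + γ ^ (2 * j))
          = γ * ((d ^ 2) ^ j * γ) + γ ^ (2 * j) * γ ^ 2 := by ring
        _ ≤ γ * (η' * (d ^ 2) ^ (j + 1) + (η' ^ j)⁻¹ * γ ^ (j + 1)) + c ^ j * γ ^ (j + 2) :=
          add_le_add h8 h5
        _ = _ := by ring
    calc _ ≤ K₀ * (η' * (γ * d ^ (2 * j + 2)) + ((η' ^ j)⁻¹ + c ^ j) * γ ^ (j + 2)) := by gcongr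
      _ = _ := by
        simp only [η']
        field_simp
  have h10 : ((2 * j : ℕ) + 2 : ℝ) * d ^ (2 * j + 1) * (γ * h) =
      2 * (j + 1 : ℕ) * (γ * d ^ (2 * (j + 1) - 1) * h) := by
    rw [show 2 * (j + 1) - 1 = 2 * j + 1 by omega]
    push_cast
    ring
  rw [h10] at h1
  rw [show 2 * (j + 1) = 2 * j + 2 by ring, show j + 1 + 1 = j + 2 by ring] at *
  linarith

/-! ### Deterministic recursions -/

/-- `b` is eventually positive and decays more slowly than any `∏ (1 - A t ^ (-β))`. -/
def SlowlyDecaying (β : ℝ) (b : ℕ → ℝ) : Prop :=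
  (∀ᶠ t in atTop, 0 < b t) ∧
    ∀ A > 0, ∀ᶠ t : ℕ in atTop, (1 - A * (t : ℝ) ^ (-β)) * b t ≤ b (t + 1)

theorem SlowlyDecaying.add {β : ℝ} {b b' : ℕ → ℝ} (hb : SlowlyDecaying β b)
    (hb' : SlowlyDecaying β b') : SlowlyDecaying β (fun t => b t + b' t) := by
  refine ⟨?_, fun A hA => ?_⟩
  · filter_upwards [hb.1, hb'.1] with t h1 h2 using add_pos h1 h2
  · filter_upwards [hb.2 A hA, hb'.2 A hA] with t h1 h2
    rw [mul_add]
    exact add_le_add h1 h2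

theorem tendsto_natCast_rpow_neg {p : ℝ} (hp : 0 < p) :
    Tendsto (fun t : ℕ => (t : ℝ) ^ (-p)) atTop (𝓝 0) :=
  (tendsto_rpow_neg_atTop hp).comp tendsto_natCast_atTop_atTop

/-- From `t` to `t + 1` the power loses at most a factor `1 - p / t`, the logarithm only grows, and
`p / t` is negligible against `t^{-β}` because `β < 1`. -/
theorem slowlyDecaying_rpow_log {β p s : ℝ} (hβ : β < 1) (hp : 0 ≤ p) (hs : 0 ≤ s) :
    SlowlyDecaying β (fun t => Real.log t ^ s * (t : ℝ) ^ (-p)) := by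
  refine ⟨?_, fun A hA => ?_⟩
  · filter_upwards [eventually_ge_atTop 2] with t ht
    have : (1 : ℝ) < t := by exact_mod_cast ht
    have := Real.log_pos this
    positivity
  · have h0 : ∀ᶠ t : ℕ in atTop, p * (t : ℝ) ^ (-(1 - β)) < A := by
      have := (tendsto_natCast_rpow_neg (p := 1 - β) (by linarith)).const_mul p
      rw [mul_zero] at this
      exact this.eventually (gt_mem_nhds hA)
    filter_upwards [h0, eventually_ge_atTop 2] with t h1 ht
    have ht1 : (1 : ℝ) < t := by exact_mod_cast ht
    have ht0 : (0 : ℝ) < t := by linarith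
    have hlog := Real.log_pos ht1
    have h2 : p / t ≤ A * (t : ℝ) ^ (-β) := by
      calc p / t = p * (t : ℝ) ^ (-(1 - β)) * (t : ℝ) ^ (-β) := by
            rw [mul_assoc, ← Real.rpow_add ht0, show -(1 - β) + -β = -1 by ring,
              Real.rpow_neg_one, div_eq_mul_inv]
        _ ≤ _ := by gcongr
    have h3 : (1 - p / t) * (t : ℝ) ^ (-p) ≤ ((t + 1 : ℕ) : ℝ) ^ (-p) := by
      have e1 : ((t + 1 : ℕ) : ℝ) = t * (1 + 1 / t) := by
        push_cast
        field_simp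
      have h4 : 1 - p / t ≤ (1 + 1 / t : ℝ) ^ (-p) := by
        rw [Real.rpow_def_of_pos (by positivity)]
        have h5 : Real.log (1 + 1 / t) ≤ 1 / t := by
          linarith [Real.log_le_sub_one_of_pos (by positivity : (0 : ℝ) < 1 + 1 / t)]
        have h6 := Real.add_one_le_exp (Real.log (1 + 1 / t) * -p)
        have h7 : Real.log (1 + 1 / t) * p ≤ 1 / t * p := by gcongr
        have h8 : 1 / t * p = p / t := by ring
        linarith
      rw [e1, Real.mul_rpow ht0.le (by positivity), mul_comm]
      gcongr
    have h9 : Real.log t ^ s ≤ Real.log (t + 1 : ℕ) ^ s := by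
      gcongr
      simp
    calc (1 - A * (t : ℝ) ^ (-β)) * (Real.log t ^ s * (t : ℝ) ^ (-p))
        ≤ (1 - p / t) * (Real.log t ^ s * (t : ℝ) ^ (-p)) := by gcongr
      _ = Real.log t ^ s * ((1 - p / t) * (t : ℝ) ^ (-p)) := by ring
      _ ≤ Real.log t ^ s * ((t + 1 : ℕ) : ℝ) ^ (-p) := by gcongr
      _ ≤ _ := by gcongr

theorem slowlyDecaying_rpow {β p : ℝ} (hβ : β < 1) (hp : 0 ≤ p) :
    SlowlyDecaying β (fun t => (t : ℝ) ^ (-p)) := by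
  simpa using slowlyDecaying_rpow_log hβ hp le_rfl

/-- Induction on `a t ≤ K * b t`. Once `C ≤ K A / 2`, half of the contraction pays for the forcing
term, and the other half is below the decay of `b` since `b` is slowly decaying. The ratio at the
starting time enters `K` for the base case. -/
theorem exists_le_mul_of_recursion {β A C : ℝ} (hβ : 0 < β) (hA : 0 < A) {a b : ℕ → ℝ}
    (hb : SlowlyDecaying β b)
    (hrec : ∀ᶠ t : ℕ in atTop,
      a (t + 1) ≤ (1 - A * (t : ℝ) ^ (-β)) * a t + C * (t : ℝ) ^ (-β) * b t) :
    ∃ K > 0, ∀ᶠ t in atTop, a t ≤ K * b t := by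
  have h0 : ∀ᶠ t : ℕ in atTop, A * (t : ℝ) ^ (-β) < 1 := by
    have := (tendsto_natCast_rpow_neg hβ).const_mul A
    rw [mul_zero] at this
    exact this.eventually (gt_mem_nhds one_pos)
  obtain ⟨T, hT⟩ := eventually_atTop.1 (((hb.1.and (hb.2 (A / 2) (by positivity))).and hrec).and h0)
  set K := max 1 (max (2 * C / A) (a T / b T))
  have hK : 0 < K := one_pos.trans_le (le_max_left _ _)
  have hK1 : 2 * C / A ≤ K := (le_max_left _ _).trans (le_max_right _ _)
  have hK2 : a T / b T ≤ K := (le_max_right _ _).trans (le_max_right _ _)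
  refine ⟨K, hK, eventually_atTop.2 ⟨T, fun t ht => ?_⟩⟩
  induction t, ht using Nat.le_induction with
  | base => rwa [← div_le_iff₀ (hT T le_rfl).1.1.1]
  | succ t ht ih =>
    obtain ⟨⟨⟨hbt, hslow⟩, hr⟩, h1⟩ := hT t ht
    have hx : 0 ≤ (t : ℝ) ^ (-β) := by positivity
    have h2 : (1 - A * (t : ℝ) ^ (-β)) * a t ≤ (1 - A * (t : ℝ) ^ (-β)) * (K * b t) :=
      mul_le_mul_of_nonneg_left ih (by linarith)
    have h3 : C ≤ K * (A / 2) := by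
      rw [div_le_iff₀ hA] at hK1
      linarith
    have h4 : C * (t : ℝ) ^ (-β) * b t ≤ K * (A / 2) * (t : ℝ) ^ (-β) * b t := by gcongr
    have h5 := mul_le_mul_of_nonneg_left hslow hK.le
    nlinarith

end OnlineSCI

end

noncomputable section

namespace OnlineSCI

/-! ### Integrating out an independent variable -/

section Freeze

open scoped ENNReal

variable {Ω Ω' 𝒵 : Type*} [mΩ : MeasurableSpace Ω] [MeasurableSpace Ω'] [MeasurableSpace 𝒵]
  {P : Measure Ω} [IsProbabilityMeasure P]

theorem integrable_of_abs_le {f : Ω → ℝ} (hf : Measurable f) {K : ℝ} (hK : ∀ ω, |f ω| ≤ K) :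
    Integrable f P :=
  (integrable_const K).mono' hf.aestronglyMeasurable (ae_of_all _ hK)

theorem lintegral_prodMk_of_indepFun {V : Ω → Ω'} {Z : Ω → 𝒵} (hV : Measurable V)
    (hZ : Measurable Z) (h : IndepFun V Z P) {φ : Ω' × 𝒵 → ℝ≥0∞} (hφ : Measurable φ) :
    ∫⁻ ω, φ (V ω, Z ω) ∂P = ∫⁻ ω, ∫⁻ z, φ (V ω, z) ∂(P.map Z) ∂P := by
  have : IsProbabilityMeasure (P.map Z) := Measure.isProbabilityMeasure_map hZ.aemeasurable
  rw [← lintegral_map hφ (hV.prodMk hZ),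
    (indepFun_iff_map_prod_eq_prod_map_map hV.aemeasurable hZ.aemeasurable).1 h,
    lintegral_prod _ hφ.aemeasurable, lintegral_map hφ.lintegral_prod_right' hV]

theorem integral_prodMk_of_indepFun {V : Ω → Ω'} {Z : Ω → 𝒵} (hV : Measurable V)
    (hZ : Measurable Z) (h : IndepFun V Z P) {φ : Ω' × 𝒵 → ℝ} (hφ : Measurable φ) {K : ℝ}
    (hK : ∀ p, |φ p| ≤ K) :
    ∫ ω, φ (V ω, Z ω) ∂P = ∫ ω, ∫ z, φ (V ω, z) ∂(P.map Z) ∂P := by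
  have : IsProbabilityMeasure (P.map Z) := Measure.isProbabilityMeasure_map hZ.aemeasurable
  have : IsProbabilityMeasure (P.map V) := Measure.isProbabilityMeasure_map hV.aemeasurable
  rw [← integral_map (f := φ) (hV.prodMk hZ).aemeasurable hφ.aestronglyMeasurable,
    (indepFun_iff_map_prod_eq_prod_map_map hV.aemeasurable hZ.aemeasurable).1 h,
    integral_prod _ (integrable_of_abs_le hφ hK), integral_map hV.aemeasurable]
  exact hφ.stronglyMeasurable.integral_prod_right'.aestronglyMeasurable

end Freeze

section FreezePast

open scoped ENNReal

variable {Ω 𝒵 : Type*} {F : MeasurableSpace Ω} [mΩ : MeasurableSpace Ω] [MeasurableSpace 𝒵]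
  {P : Measure Ω} [IsProbabilityMeasure P] {Z : Ω → 𝒵}

/-- The identity is regarded as a random variable with values in `Ω` equipped with the smaller
σ-algebra `F`. Independence from `F` then reduces the claim to Fubini for two independent variables.
-/
theorem lintegral_prodMk_of_indep (hF : F ≤ mΩ) (hZ : Measurable Z)
    (h : Indep F (MeasurableSpace.comap Z inferInstance) P) {φ : Ω × 𝒵 → ℝ≥0∞}
    (hφ : Measurable[F.prod inferInstance] φ) :
    ∫⁻ ω, φ (ω, Z ω) ∂P = ∫⁻ ω, ∫⁻ z, φ (ω, z) ∂(P.map Z) ∂P := by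
  refine @lintegral_prodMk_of_indepFun Ω Ω 𝒵 mΩ F _ P _ id Z (measurable_id'' hF) hZ ?_ φ hφ
  refine (@IndepFun_iff_Indep Ω Ω 𝒵 mΩ F _ id Z P).2 ?_
  rwa [MeasurableSpace.comap_id]

theorem integral_prodMk_of_indep (hF : F ≤ mΩ) (hZ : Measurable Z)
    (h : Indep F (MeasurableSpace.comap Z inferInstance) P) {φ : Ω × 𝒵 → ℝ}
    (hφ : Measurable[F.prod inferInstance] φ) {K : ℝ} (hK : ∀ p, |φ p| ≤ K) :
    ∫ ω, φ (ω, Z ω) ∂P = ∫ ω, ∫ z, φ (ω, z) ∂(P.map Z) ∂P := by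
  refine @integral_prodMk_of_indepFun Ω Ω 𝒵 mΩ F _ P _ id Z (measurable_id'' hF) hZ ?_ φ hφ K hK
  refine (@IndepFun_iff_Indep Ω Ω 𝒵 mΩ F _ id Z P).2 ?_
  rwa [MeasurableSpace.comap_id]

end FreezePast

/-! ### Consequences of the regression model -/

namespace IIDRegression

variable {Ω 𝒳 : Type*} [mΩ : MeasurableSpace Ω] [MeasurableSpace 𝒳] {P : Measure Ω}
  {n : ℕ} {D₀ : Ω → Fin n → 𝒳 × ℝ} {X : ℕ → Ω → 𝒳} {ξ Y : ℕ → Ω → ℝ} {μ σ : 𝒳 → ℝ}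

theorem measurable_response (hM : IIDRegression P D₀ X ξ Y μ σ) {t : ℕ} (ht : 1 ≤ t) :
    Measurable (Y t) := by
  rw [show Y t = fun ω => μ (X t ω) + σ (X t ω) * ξ t ω from funext (hM.model t ht)]
  exact (hM.measurable_mu.comp (hM.measurable_X t ht)).add
    ((hM.measurable_sigma.comp (hM.measurable_X t ht)).mul (hM.measurable_noise t ht))

theorem past_le (hM : IIDRegression P D₀ X ξ Y μ σ) (s : ℕ) : past D₀ X Y s ≤ mΩ :=
  sup_le hM.measurable_holdout.comap_le (iSup₂_le fun k hk =>
    ((hM.measurable_X k (Finset.mem_Icc.1 hk).1).prodMk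
      (hM.measurable_response (Finset.mem_Icc.1 hk).1)).comap_le)

theorem map_noise (hM : IIDRegression P D₀ X ξ Y μ σ) {t : ℕ} (ht : 1 ≤ t) :
    P.map (ξ t) = P.map (ξ 1) := by
  simpa [Function.comp_def] using ((hM.identDistrib t ht).comp measurable_snd).map_eq

theorem map_X (hM : IIDRegression P D₀ X ξ Y μ σ) {t : ℕ} (ht : 1 ≤ t) :
    P.map (X t) = P.map (X 1) := by
  simpa [Function.comp_def] using ((hM.identDistrib t ht).comp measurable_fst).map_eq

variable [IsProbabilityMeasure P]

theorem map_pair (hM : IIDRegression P D₀ X ξ Y μ σ) {t : ℕ} (ht : 1 ≤ t) :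
    P.map (fun ω => (X t ω, ξ t ω)) = (P.map (X 1)).prod (P.map (ξ 1)) := by
  rw [(hM.identDistrib t ht).map_eq]
  exact (indepFun_iff_map_prod_eq_prod_map_map (hM.measurable_X 1 le_rfl).aemeasurable
    (hM.measurable_noise 1 le_rfl).aemeasurable).1 hM.indep_noise

/-- The past is a function of the holdout sample and of the earlier couples. The latter are
independent of the current couple by the iid assumption, and `indepFun_assoc` adjoins the holdout
sample. -/
theorem indep_past (hM : IIDRegression P D₀ X ξ Y μ σ) {t : ℕ} (ht : 1 ≤ t) :
    Indep (past D₀ X Y (t - 1))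
      (MeasurableSpace.comap (fun ω => (X t ω, ξ t ω)) inferInstance) P := by
  obtain ⟨s, rfl⟩ : ∃ s, t = s + 1 := ⟨t - 1, by omega⟩
  have hZ : ∀ i : ℕ, Measurable fun ω => (X (i + 1) ω, ξ (i + 1) ω) := fun i =>
    (hM.measurable_X _ (by omega)).prodMk (hM.measurable_noise _ (by omega))
  let W : Ω → (Finset.range s → 𝒳 × ℝ) := fun ω i => (X (i + 1) ω, ξ (i + 1) ω)
  have hW : Measurable W := measurable_pi_lambda _ fun i => hZ i
  have hWZ : IndepFun W (fun ω => (X (s + 1) ω, ξ (s + 1) ω)) P := by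
    have h := hM.indep.indepFun_finset (Finset.range s) {s} (by simp) hZ
    exact h.comp measurable_id (measurable_pi_apply (⟨s, by simp⟩ : ({s} : Finset ℕ)))
  have hDWZ : IndepFun D₀ (fun ω => (W ω, (X (s + 1) ω, ξ (s + 1) ω))) P := by
    refine hM.indep_holdout.comp (φ := id)
      (ψ := fun z : ℕ → 𝒳 × ℝ => ((fun i : Finset.range s => z i), z s)) measurable_id ?_
    fun_prop
  have h1 := indepFun_assoc hM.measurable_holdout hW (hZ s) hDWZ hWZ
  have hμ := hM.measurable_mu
  have hσ := hM.measurable_sigma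
  rw [IndepFun_iff_Indep] at h1
  refine indep_of_indep_of_le_left h1 ?_
  refine past_le_comap D₀ X Y (fun ω => (D₀ ω, W ω)) ⟨Prod.fst, measurable_fst, rfl⟩
    fun k hk1 hk => ?_
  obtain ⟨j, rfl⟩ : ∃ j, k = j + 1 := ⟨k - 1, by omega⟩
  have hj : j ∈ Finset.range s := by
    rw [Finset.mem_range]
    omega
  refine ⟨fun v => ((v.2 ⟨j, hj⟩).1, μ (v.2 ⟨j, hj⟩).1 + σ (v.2 ⟨j, hj⟩).1 * (v.2 ⟨j, hj⟩).2),
    by fun_prop, ?_⟩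
  funext ω
  simp [W, hM.model (j + 1) hk1 ω]

theorem indep_past_X (hM : IIDRegression P D₀ X ξ Y μ σ) {t : ℕ} (ht : 1 ≤ t) :
    Indep (past D₀ X Y (t - 1)) (MeasurableSpace.comap (X t) inferInstance) P := by
  refine indep_of_indep_of_le_right (hM.indep_past ht) ?_
  rw [show X t = Prod.fst ∘ (fun ω => (X t ω, ξ t ω)) from rfl, ← MeasurableSpace.comap_comp]
  exact MeasurableSpace.comap_mono measurable_fst.comap_le

theorem indep_past_noise (hM : IIDRegression P D₀ X ξ Y μ σ) {t : ℕ} (ht : 1 ≤ t) :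
    Indep (past D₀ X Y (t - 1)) (MeasurableSpace.comap (ξ t) inferInstance) P := by
  refine indep_of_indep_of_le_right (hM.indep_past ht) ?_
  rw [show ξ t = Prod.snd ∘ (fun ω => (X t ω, ξ t ω)) from rfl, ← MeasurableSpace.comap_comp]
  exact MeasurableSpace.comap_mono measurable_snd.comap_le

end IIDRegression

theorem past_mono {Ω 𝒳 : Type*} [MeasurableSpace 𝒳] {n : ℕ} (D₀ : Ω → Fin n → 𝒳 × ℝ)
    (X : ℕ → Ω → 𝒳) (Y : ℕ → Ω → ℝ) : Monotone (past D₀ X Y) := fun _ _ h =>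
  sup_le_sup le_rfl (biSup_mono fun k hk => by
    rw [Finset.mem_Icc] at hk ⊢
    omega)

theorem measurable_past {Ω 𝒳 : Type*} [MeasurableSpace 𝒳] {n : ℕ} (D₀ : Ω → Fin n → 𝒳 × ℝ)
    (X : ℕ → Ω → 𝒳) (Y : ℕ → Ω → ℝ) {t : ℕ} (ht : 1 ≤ t) :
    Measurable[past D₀ X Y t] fun ω => (X t ω, Y t ω) :=
  Measurable.of_comap_le (le_sup_of_le_right
    (le_iSup₂_of_le t (Finset.mem_Icc.2 ⟨ht, le_rfl⟩) le_rfl))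

/-! ### Measurability of the reaction -/

theorem measurableSet_mem_interval (B : ℝ) :
    MeasurableSet {p : ℝ × ℝ × ℝ × ℝ | p.1 ∈ interval B p.2.1 p.2.2.1 p.2.2.2} := by
  have : {p : ℝ × ℝ × ℝ × ℝ | p.1 ∈ interval B p.2.1 p.2.2.1 p.2.2.2} =
      ({p | p.2.2.2 ≤ 0} ∩ {p | p.1 = p.2.1}) ∪ ({p | p.2.2.2 ≤ 0}ᶜ ∩ ({p | B ≤ p.2.2.2} ∪
        ({p | p.2.1 - p.2.2.1 * radius B p.2.2.2 ≤ p.1} ∩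
          {p | p.1 ≤ p.2.1 + p.2.2.1 * radius B p.2.2.2}))) := by
    ext p
    by_cases h1 : p.2.2.2 ≤ 0
    · simp [interval, h1]
    · by_cases h2 : B ≤ p.2.2.2 <;> simp [interval, radius, h1, h2]
  rw [this]
  have hr := measurable_radius B
  refine ((measurableSet_le ?_ ?_).inter (measurableSet_eq_fun ?_ ?_)).union
    ((measurableSet_le ?_ ?_).compl.inter ((measurableSet_le ?_ ?_).union
      ((measurableSet_le ?_ ?_).inter (measurableSet_le ?_ ?_)))) <;> fun_prop

theorem measurable_react (B : ℝ) :
    Measurable fun p : ℝ × ℝ × ℝ × ℝ =>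
      react p.1 (interval B p.2.1 p.2.2.1 p.2.2.2) p.2.2.2 := by
  unfold react
  refine ((Measurable.ite (measurableSet_mem_interval B).compl measurable_const
    measurable_const).mul (Measurable.ite ?_ measurable_const measurable_const)).add
      (Measurable.ite ?_ measurable_const measurable_const)
  · exact measurableSet_le measurable_const (by fun_prop)
  · exact measurableSet_lt (by fun_prop) measurable_const

theorem react_mem_Icc (y : ℝ) (C : Set ℝ) (q : ℝ) : react y C q ∈ Set.Icc (0 : ℝ) 1 := by
  rw [react]
  rcases lt_or_ge q 0 with hq | hq
  · simp [hq, not_le.2 hq]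
  · simp only [hq, not_lt.2 hq, if_true, if_false]
    split_ifs <;> norm_num

end OnlineSCI

end

noncomputable section

namespace OnlineSCI

/-! ### Moments of a Robbins–Monro recursion with random step sizes -/

/-- The step size is random, so two one-sided bounds replace its exact order: `J ≤ t` bounds it
below, which is what the contraction needs, and `J ≥ r t` bounds it above off the event `bad`, which
is what the error and noise terms need. On `bad` the crude bound `c` suffices. -/
theorem exists_moment_recursion {Ω : Type*} [MeasurableSpace Ω] {P : Measure Ω}
    [IsProbabilityMeasure P] {d h ε : ℕ → Ω → ℝ} {J : ℕ → Ω → ℕ} {c β ρ D r : ℝ} (hc : 0 < c)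
    (hβ : 0 < β) (hρ : 0 < ρ) (hr : 0 < r) {k : ℕ} (hk : 1 ≤ k)
    (hdm : ∀ t, 1 ≤ t → Measurable (d t)) (hhm : ∀ t, 1 ≤ t → Measurable (h t))
    (hεm : ∀ t, 1 ≤ t → Measurable (ε t)) (hJm : ∀ t, 1 ≤ t → Measurable (J t))
    (hd : ∀ t, 1 ≤ t → ∀ ω, |d t ω| ≤ D) (hh : ∀ t, 1 ≤ t → ∀ ω, |h t ω| ≤ 1)
    (hε : ∀ t, 1 ≤ t → ∀ ω, ε t ω ∈ Set.Icc (0 : ℝ) 1)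
    (hJ : ∀ t, 1 ≤ t → ∀ ω, 1 ≤ J t ω ∧ J t ω ≤ t)
    (hstep : ∀ t, 1 ≤ t → ∀ ω, d (t + 1) ω = d t ω + c * (J t ω : ℝ) ^ (-β) * h t ω)
    (hdrift : ∀ t, 1 ≤ t →
      ∫ ω, c * (J t ω : ℝ) ^ (-β) * d t ω ^ (2 * k - 1) * h t ω ∂P ≤
        ∫ ω, (-ρ * (c * (J t ω : ℝ) ^ (-β) * d t ω ^ (2 * k)) +
          c * (J t ω : ℝ) ^ (-β) * (|d t ω| ^ (2 * k - 1) * ε t ω)) ∂P)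
    (hbad : ∀ p : ℝ, ∀ᶠ t : ℕ in atTop, P.real {ω | (J t ω : ℝ) < r * t} ≤ (t : ℝ) ^ (-p)) :
    ∃ A > 0, ∃ C ≥ 0, ∀ᶠ t : ℕ in atTop,
      ∫ ω, d (t + 1) ω ^ (2 * k) ∂P ≤ (1 - A * (t : ℝ) ^ (-β)) * ∫ ω, d t ω ^ (2 * k) ∂P +
        C * (t : ℝ) ^ (-β) * (∫ ω, ε t ω ^ (2 * k) ∂P + (t : ℝ) ^ (-(β * k))) := by
  have hkR : (0 : ℝ) < k := by exact_mod_cast hk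
  -- The drift contributes `-2kρ`. Half of it is spent, a quarter on Young's inequality for `ε` and
  -- a quarter on the Taylor remainder; `-kρ` is left.
  have hη : 0 < k * ρ / 2 := by positivity
  obtain ⟨K₁, hK₁, hyoung⟩ := exists_young k hk hη
  obtain ⟨K₂, hK₂, hpow⟩ := exists_pow_step k hk hη hc
  set c₁ := c * r ^ (-β)
  have hc₁ : 0 < c₁ := by positivity
  refine ⟨k * ρ * c, by positivity, K₁ * (c₁ + c) + K₂ * (c₁ ^ (k + 1) + c ^ (k + 1)),
    by positivity, ?_⟩
  -- This exponent makes the probability of `bad` at most `t^{-β} t^{-βk}`, the size of the noise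
  -- term.
  filter_upwards [hbad (β * (k + 1)), eventually_ge_atTop 1] with t hbt ht
  have ht0 : (0 : ℝ) < t := by exact_mod_cast ht
  set W : Ω → ℝ := fun ω => c * (J t ω : ℝ) ^ (-β)
  have hJ1 : ∀ ω, (1 : ℝ) ≤ J t ω := fun ω => by exact_mod_cast (hJ t ht ω).1
  have hJt : ∀ ω, (J t ω : ℝ) ≤ t := fun ω => by exact_mod_cast (hJ t ht ω).2
  have hW0 : ∀ ω, 0 < W ω := fun ω => by
    have := one_pos.trans_le (hJ1 ω)
    positivity
  have hWc : ∀ ω, W ω ≤ c := fun ω => by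
    have := Real.rpow_le_one_of_one_le_of_nonpos (hJ1 ω) (neg_nonpos.2 hβ.le)
    simp only [W]
    nlinarith
  have hWlow : ∀ ω, c * (t : ℝ) ^ (-β) ≤ W ω := fun ω => by
    have := Real.rpow_le_rpow_of_nonpos (one_pos.trans_le (hJ1 ω)) (hJt ω) (neg_nonpos.2 hβ.le)
    simp only [W]
    gcongr
  have hWm : Measurable W := by
    have := hJm t ht
    have h1 : Measurable fun ω => (J t ω : ℝ) := measurable_from_nat.comp this
    simp only [W]
    fun_prop
  set bad : Set Ω := {ω | (J t ω : ℝ) < r * t}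
  have hbadm : MeasurableSet bad :=
    measurableSet_lt (measurable_from_nat.comp (hJm t ht)) measurable_const
  have hWgood : ∀ ω, ω ∉ bad → W ω ≤ c₁ * (t : ℝ) ^ (-β) := fun ω hω => by
    have h1 : r * t ≤ J t ω := not_lt.1 hω
    have := Real.rpow_le_rpow_of_nonpos (by positivity) h1 (neg_nonpos.2 hβ.le)
    rw [Real.mul_rpow hr.le ht0.le] at this
    simp only [W, c₁]
    rw [mul_assoc]
    gcongr
  have hdm := hdm t ht
  have hhm := hhm t ht
  have hεm := hεm t ht
  have hd := hd t ht
  have hh := hh t ht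
  have hε := hε t ht
  have hD : 0 ≤ D := by
    obtain ⟨ω⟩ : Nonempty Ω := nonempty_of_isProbabilityMeasure P
    exact (abs_nonneg _).trans (hd ω)
  have hWabs : ∀ ω, |W ω| ≤ c := fun ω => by
    rw [abs_of_pos (hW0 ω)]
    exact hWc ω
  have heven : ∀ x : ℝ, 0 ≤ x ^ (2 * k) := fun x => (even_two_mul k).pow_nonneg x
  have habs : ∀ x : ℝ, |x| ^ (2 * k) = x ^ (2 * k) := fun x => (even_two_mul k).pow_abs x
  -- integrability
  have iD : Integrable (fun ω => d t ω ^ (2 * k)) P :=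
    integrable_of_abs_le (K := D ^ (2 * k)) (by fun_prop) fun ω => by
      rw [abs_pow]
      have := hd ω
      gcongr
  have iE : Integrable (fun ω => ε t ω ^ (2 * k)) P :=
    integrable_of_abs_le (K := 1) (by fun_prop) fun ω => by
      rw [abs_of_nonneg (heven _)]
      exact pow_le_one₀ (hε ω).1 (hε ω).2
  have iW : ∀ {f : Ω → ℝ}, Integrable f P → Integrable (fun ω => W ω * f ω) P := fun hf =>
    hf.bdd_mul hWm.aestronglyMeasurable (ae_of_all _ hWabs)
  have iWk : Integrable (fun ω => W ω ^ (k + 1)) P :=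
    integrable_of_abs_le (K := c ^ (k + 1)) (by fun_prop) fun ω => by
      rw [abs_pow]
      have := hWabs ω
      gcongr
  have iH : Integrable (fun ω => W ω * d t ω ^ (2 * k - 1) * h t ω) P :=
    integrable_of_abs_le (K := c * D ^ (2 * k - 1) * 1) (by fun_prop) fun ω => by
      rw [abs_mul, abs_mul, abs_pow]
      have h1 := hd ω
      have h2 := hh ω
      have h3 := hWabs ω
      gcongr
  have iDE : Integrable (fun ω => |d t ω| ^ (2 * k - 1) * ε t ω) P :=
    integrable_of_abs_le (K := D ^ (2 * k - 1) * 1) (by fun_prop) fun ω => by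
      rw [abs_mul, abs_pow, abs_abs, abs_of_nonneg (hε ω).1]
      have h1 := hd ω
      have h2 := hε ω
      gcongr
      exacts [h2.1, h2.2]
  have iadd : ∀ {f g : Ω → ℝ}, Integrable f P → Integrable g P →
      Integrable (fun ω => f ω + g ω) P := fun hf hg => hf.add hg
  have iBad : ∀ a : ℝ, Integrable (fun ω => bad.indicator (fun _ => a) ω) P := fun a =>
    (integrable_const a).indicator hbadm
  -- the one-step inequality
  have e1 : ∫ ω, d (t + 1) ω ^ (2 * k) ∂P ≤
      ∫ ω, (d t ω ^ (2 * k) + k * ρ / 2 * (W ω * d t ω ^ (2 * k)) + K₂ * W ω ^ (k + 1)) ∂P +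
        2 * k * ∫ ω, W ω * d t ω ^ (2 * k - 1) * h t ω ∂P := by
    have i2 := iadd (iadd iD ((iW iD).const_mul (k * ρ / 2))) (iWk.const_mul K₂)
    rw [← integral_const_mul, ← integral_add i2 (iH.const_mul _)]
    refine integral_mono_of_nonneg (ae_of_all _ fun ω => heven _)
      (iadd i2 (iH.const_mul _)) (ae_of_all _ fun ω => ?_)
    have := hpow (d t ω) (W ω) (h t ω) (hW0 ω).le (hWc ω) (hh ω)
    simp only [hstep t ht ω]
    linarith
  have e2 := mul_le_mul_of_nonneg_left (hdrift t ht) (by positivity : (0 : ℝ) ≤ 2 * k)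
  have e3 : ∫ ω, (d t ω ^ (2 * k) + k * ρ / 2 * (W ω * d t ω ^ (2 * k)) + K₂ * W ω ^ (k + 1)) ∂P +
      2 * k * ∫ ω, (-ρ * (W ω * d t ω ^ (2 * k)) + W ω * (|d t ω| ^ (2 * k - 1) * ε t ω)) ∂P ≤
      ∫ ω, ((1 - k * ρ * c * (t : ℝ) ^ (-β)) * d t ω ^ (2 * k) +
        K₁ * (W ω * ε t ω ^ (2 * k)) + K₂ * W ω ^ (k + 1)) ∂P := by
    have i1 := iadd ((iW iD).const_mul (-ρ)) (iW iDE)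
    have i2 := iadd (iadd iD ((iW iD).const_mul (k * ρ / 2))) (iWk.const_mul K₂)
    rw [← integral_const_mul, ← integral_add i2 (i1.const_mul _)]
    refine integral_mono (iadd i2 (i1.const_mul _)) (iadd (iadd (iD.const_mul _)
      ((iW iE).const_mul _)) (iWk.const_mul _)) fun ω => ?_
    have h1 := mul_le_mul_of_nonneg_left (hyoung (d t ω) (ε t ω) (hε ω).1) (hW0 ω).le
    have h2 : k * ρ * (c * (t : ℝ) ^ (-β)) * d t ω ^ (2 * k) ≤
        k * ρ * W ω * d t ω ^ (2 * k) := by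
      have := heven (d t ω)
      have := hWlow ω
      gcongr
    simp only
    linarith
  have e4 : ∫ ω, W ω * ε t ω ^ (2 * k) ∂P ≤
      c₁ * (t : ℝ) ^ (-β) * ∫ ω, ε t ω ^ (2 * k) ∂P + c * P.real bad := by
    rw [← integral_const_mul]
    have : c * P.real bad = ∫ ω, bad.indicator (fun _ => c) ω ∂P := by
      rw [integral_indicator_const _ hbadm, smul_eq_mul, mul_comm]
    rw [this, ← integral_add (iE.const_mul _) (iBad c)]
    refine integral_mono (iW iE) (iadd (iE.const_mul _) (iBad c)) fun ω => ?_
    have h0 := heven (ε t ω)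
    by_cases hω : ω ∈ bad
    · simp only [Set.indicator_of_mem hω]
      have h1 : ε t ω ^ (2 * k) ≤ 1 := pow_le_one₀ (hε ω).1 (hε ω).2
      have h2 : 0 ≤ c₁ * (t : ℝ) ^ (-β) * ε t ω ^ (2 * k) := by positivity
      nlinarith [hWc ω, hW0 ω]
    · simp only [Set.indicator_of_notMem hω, add_zero]
      have := hWgood ω hω
      gcongr
  have e5 : ∫ ω, W ω ^ (k + 1) ∂P ≤
      (c₁ * (t : ℝ) ^ (-β)) ^ (k + 1) + c ^ (k + 1) * P.real bad := by
    have h1 : c ^ (k + 1) * P.real bad = ∫ ω, bad.indicator (fun _ => c ^ (k + 1)) ω ∂P := by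
      rw [integral_indicator_const _ hbadm, smul_eq_mul, mul_comm]
    have h2 : (c₁ * (t : ℝ) ^ (-β)) ^ (k + 1) = ∫ _, (c₁ * (t : ℝ) ^ (-β)) ^ (k + 1) ∂P := by
      simp
    rw [h1, h2, ← integral_add (integrable_const _) (iBad _)]
    refine integral_mono iWk (iadd (integrable_const _) (iBad _)) fun ω => ?_
    have h0 := (hW0 ω).le
    by_cases hω : ω ∈ bad
    · simp only [Set.indicator_of_mem hω]
      have h3 : 0 ≤ (c₁ * (t : ℝ) ^ (-β)) ^ (k + 1) := by positivity
      have h4 : W ω ^ (k + 1) ≤ c ^ (k + 1) := by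
        have := hWc ω
        gcongr
      linarith
    · simp only [Set.indicator_of_notMem hω, add_zero]
      have := hWgood ω hω
      gcongr
  have e6 : ∫ ω, ((1 - k * ρ * c * (t : ℝ) ^ (-β)) * d t ω ^ (2 * k) +
        K₁ * (W ω * ε t ω ^ (2 * k)) + K₂ * W ω ^ (k + 1)) ∂P =
      (1 - k * ρ * c * (t : ℝ) ^ (-β)) * ∫ ω, d t ω ^ (2 * k) ∂P +
        K₁ * ∫ ω, W ω * ε t ω ^ (2 * k) ∂P + K₂ * ∫ ω, W ω ^ (k + 1) ∂P := by
    rw [integral_add (iadd (iD.const_mul _) ((iW iE).const_mul _)) (iWk.const_mul _),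
      integral_add (iD.const_mul _) ((iW iE).const_mul _), integral_const_mul,
      integral_const_mul, integral_const_mul]
  set x := (t : ℝ) ^ (-β)
  set y := (t : ℝ) ^ (-(β * k))
  have hx : 0 < x := by positivity
  have hy : 0 < y := by positivity
  have hxy : (t : ℝ) ^ (-(β * (k + 1))) = x * y := by
    simp only [x, y]
    rw [← Real.rpow_add ht0]
    congr 1
    ring
  have hxk : x ^ (k + 1) = x * y := by
    rw [← hxy]
    simp only [x]
    rw [← Real.rpow_natCast, ← Real.rpow_mul ht0.le]
    congr 1
    push_cast
    ring
  rw [hxy] at hbt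
  have hE0 : 0 ≤ ∫ ω, ε t ω ^ (2 * k) ∂P := integral_nonneg fun ω => heven _
  set E := ∫ ω, ε t ω ^ (2 * k) ∂P
  rw [mul_pow, hxk] at e5
  have e4' := mul_le_mul_of_nonneg_left e4 hK₁
  have e5' := mul_le_mul_of_nonneg_left e5 hK₂
  have b1 : c * P.real bad ≤ c * (x * y) := by gcongr
  have b2 : c ^ (k + 1) * P.real bad ≤ c ^ (k + 1) * (x * y) := by gcongr
  have b1' := mul_le_mul_of_nonneg_left b1 hK₁
  have b2' := mul_le_mul_of_nonneg_left b2 hK₂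
  have p1 : 0 ≤ K₁ * c * x * E := by positivity
  have p2 : 0 ≤ K₁ * c₁ * x * y := by positivity
  have p3 : 0 ≤ K₂ * (c₁ ^ (k + 1) + c ^ (k + 1)) * x * E := by positivity
  have e7 : ∫ ω, d (t + 1) ω ^ (2 * k) ∂P ≤
      (1 - k * ρ * c * x) * ∫ ω, d t ω ^ (2 * k) ∂P +
        K₁ * ∫ ω, W ω * ε t ω ^ (2 * k) ∂P + K₂ * ∫ ω, W ω ^ (k + 1) ∂P := by
    rw [← e6]
    exact (e1.trans (add_le_add le_rfl e2)).trans e3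
  refine e7.trans ?_
  linarith

/-! ### The number of selections -/

theorem eventually_exp_neg_le_rpow {a : ℝ} (ha : 0 < a) (K p : ℝ) :
    ∀ᶠ t : ℕ in atTop, K * Real.exp (-a * t) ≤ (t : ℝ) ^ (-p) := by
  have h1 := ((isLittleO_exp_neg_mul_rpow_atTop ha (-p)).const_mul_left K).comp_tendsto
    tendsto_natCast_atTop_atTop
  filter_upwards [h1.def one_pos, eventually_ge_atTop 1] with t h ht
  simp only [Function.comp_apply, Real.norm_eq_abs, one_mul] at h
  rw [abs_of_nonneg (by positivity : (0 : ℝ) ≤ (t : ℝ) ^ (-p))] at h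
  exact (le_abs_self _).trans h

/-- Chernoff's bound at parameter `-1`. Each factor is at most `1 - r/2 ≤ exp(-r/2)` since `exp(-1)
≤ 1/2`; with `t - 1` factors and the threshold `r t / 4` this leaves `exp(r/2) exp(-r t / 4)`, below
any power of `t`. -/
theorem eventually_measureReal_sum_lt_le {Ω : Type*} [MeasurableSpace Ω] {P : Measure Ω}
    [IsProbabilityMeasure P] {s : ℕ → Set Ω} (hs : ∀ i, MeasurableSet (s i)) {r : ℝ} (hr : 0 < r)
    (hP : ∀ i, P.real (s i) = r)
    (hind : iIndepFun (fun i => (s i).indicator (fun _ => (1 : ℝ))) P) (p : ℝ) :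
    ∀ᶠ t : ℕ in atTop,
      P.real {ω | 1 + ∑ i ∈ Finset.range (t - 1),
        (s i).indicator (fun _ => (1 : ℝ)) ω < r / 4 * t} ≤ (t : ℝ) ^ (-p) := by
  have hm : ∀ i, Measurable ((s i).indicator (fun _ => (1 : ℝ))) := fun i =>
    measurable_const.indicator (hs i)
  have hmgf : ∀ i, mgf ((s i).indicator (fun _ => (1 : ℝ))) P (-1) ≤ Real.exp (-(r / 2)) := by
    intro i
    have h1 : (fun ω => Real.exp (-1 * (s i).indicator (fun _ => (1 : ℝ)) ω)) =
        fun ω => 1 + (s i).indicator (fun _ => Real.exp (-1) - 1) ω := by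
      ext ω
      by_cases hω : ω ∈ s i <;> simp [hω]
    have h2 : Real.exp (-1) ≤ 1 / 2 := by
      rw [Real.exp_neg, inv_eq_one_div]
      gcongr
      linarith [Real.add_one_le_exp (1 : ℝ)]
    rw [mgf, h1, integral_add (integrable_const _) ((integrable_const _).indicator (hs i)),
      integral_indicator_const _ (hs i), hP i]
    simp only [integral_const, probReal_univ, smul_eq_mul, mul_one]
    have h3 := Real.add_one_le_exp (-(r / 2))
    nlinarith
  filter_upwards [eventually_exp_neg_le_rpow (a := r / 4) (by positivity) (Real.exp (r / 2)) p,
    eventually_ge_atTop 1] with t h ht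
  refine le_trans ?_ h
  have h4 := measure_le_le_exp_mul_mgf (μ := P) (t := -1) (r / 4 * t)
    (X := ∑ i ∈ Finset.range (t - 1), (s i).indicator (fun _ => (1 : ℝ))) (by norm_num) ?_
  · rw [hind.mgf_sum hm] at h4
    refine (measureReal_mono fun ω hω => ?_).trans (h4.trans ?_)
    · simp only [Set.mem_ofPred_eq, Finset.sum_apply] at hω ⊢
      linarith
    · have h5 : ∏ i ∈ Finset.range (t - 1), mgf ((s i).indicator (fun _ => (1 : ℝ))) P (-1) ≤
          Real.exp (-(r / 2)) ^ (t - 1) := by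
        refine (Finset.prod_le_prod (fun i _ => mgf_nonneg) fun i _ => hmgf i).trans_eq ?_
        simp
      refine (mul_le_mul_of_nonneg_left h5 (Real.exp_pos _).le).trans_eq ?_
      rw [← Real.exp_nat_mul, ← Real.exp_add, ← Real.exp_add, Nat.cast_sub ht]
      congr 1
      push_cast
      ring
  · refine integrable_of_abs_le (K := 1) ?_ fun ω => ?_
    · have := Finset.measurable_sum (Finset.range (t - 1)) fun i _ => hm i
      fun_prop
    · rw [abs_of_pos (Real.exp_pos _), Real.exp_le_one_iff, Finset.sum_apply]
      have : 0 ≤ ∑ i ∈ Finset.range (t - 1), (s i).indicator (fun _ => (1 : ℝ)) ω :=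
        Finset.sum_nonneg fun i _ => Set.indicator_nonneg (fun _ _ => zero_le_one) ω
      linarith

end OnlineSCI

end

noncomputable section

namespace OnlineSCI

/-! ### Runs of OnlineSCI -/

/-- The data of a run of OnlineSCI in the regression model. -/
structure Run (Ω 𝒳 : Type*) where
  (n : ℕ) (D₀ : Ω → Fin n → 𝒳 × ℝ) (X : ℕ → Ω → 𝒳) (ξ Y : ℕ → Ω → ℝ) (μ σ : 𝒳 → ℝ) (f : ℝ → ℝ)
  (S : 𝒳 → Bool) (α B c β q₁ : ℝ) (muHat sigmaHat : ℕ → Ω → 𝒳 → ℝ)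

namespace Run

section Defs

variable {Ω 𝒳 : Type*} (R : Run Ω 𝒳)

/-- The information available after time `t`. -/
@[reducible] def info [MeasurableSpace 𝒳] (t : ℕ) : MeasurableSpace Ω := past R.D₀ R.X R.Y t

/-- The state of the recursion after `m` steps. -/
def stateAt (m : ℕ) (ω : Ω) : ℝ × ℕ :=
  state R.α R.q₁ (fun j => R.c * (j : ℝ) ^ (-R.β)) (fun _ _ z _ => R.S z)
    (fun s ω' z q => interval R.B (R.muHat s ω' z) (R.sigmaHat s ω' z) q) R.X R.Y ω m

/-- The threshold `q_t`. -/
def level (t : ℕ) (ω : Ω) : ℝ := (R.stateAt (t - 1) ω).1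

/-- The count `J(t)`. -/
def count (t : ℕ) (ω : Ω) : ℕ := (R.stateAt (t - 1) ω).2

/-- The direction of the step at time `t` when the covariate is `x` and the noise is `z`. -/
def innovation (t : ℕ) (ω : Ω) (x : 𝒳) (z : ℝ) : ℝ :=
  if R.S x = true then
    react (R.μ x + R.σ x * z) (interval R.B (R.muHat t ω x) (R.sigmaHat t ω x) (R.level t ω))
      (R.level t ω) - R.α
  else 0

/-- The miscoverage at `x` of the prediction interval of time `t`. -/
def missAt (ν : Measure ℝ) (t : ℕ) (ω : Ω) (x : 𝒳) : ℝ :=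
  miss ν R.B (R.muHat t ω x) (R.sigmaHat t ω x) (R.level t ω) (R.μ x) (R.σ x)

/-- The truncated estimation error at `x`. -/
def err (K : ℝ) (t : ℕ) (ω : Ω) (x : 𝒳) : ℝ :=
  min 1 (K * (|R.muHat t ω x - R.μ x| + |R.sigmaHat t ω x - R.σ x|))

theorem stateAt_succ (m : ℕ) (ω : Ω) :
    R.stateAt (m + 1) ω =
      if R.S (R.X (m + 1) ω) = true then
        ((R.stateAt m ω).1 + R.c * ((R.stateAt m ω).2 : ℝ) ^ (-R.β) *
          (react (R.Y (m + 1) ω) (interval R.B (R.muHat (m + 1) ω (R.X (m + 1) ω))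
            (R.sigmaHat (m + 1) ω (R.X (m + 1) ω)) (R.stateAt m ω).1) (R.stateAt m ω).1 - R.α),
          (R.stateAt m ω).2 + 1)
      else R.stateAt m ω := by
  simp only [stateAt, state]

theorem level_succ (hY : ∀ t, 1 ≤ t → ∀ ω, R.Y t ω = R.μ (R.X t ω) + R.σ (R.X t ω) * R.ξ t ω)
    {t : ℕ} (ht : 1 ≤ t) (ω : Ω) :
    R.level (t + 1) ω = R.level t ω +
      R.c * (R.count t ω : ℝ) ^ (-R.β) * R.innovation t ω (R.X t ω) (R.ξ t ω) := by
  obtain ⟨m, rfl⟩ : ∃ m, t = m + 1 := ⟨t - 1, by omega⟩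
  simp only [level, count, innovation, Nat.add_sub_cancel, stateAt_succ,
    ← hY (m + 1) ht ω]
  split_ifs <;> simp

theorem count_eq {t : ℕ} (ω : Ω) :
    R.count t ω = 1 + ∑ i ∈ Finset.Icc 1 (t - 1), (R.S (R.X i ω)).toNat := by
  rw [count, stateAt, state_count]

theorem one_le_count (t : ℕ) (ω : Ω) : 1 ≤ R.count t ω := by
  rw [count_eq]
  omega

theorem count_le {t : ℕ} (ht : 1 ≤ t) (ω : Ω) : R.count t ω ≤ t := by
  rw [count_eq]
  have : ∑ i ∈ Finset.Icc 1 (t - 1), (R.S (R.X i ω)).toNat ≤ ∑ i ∈ Finset.Icc 1 (t - 1), 1 :=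
    Finset.sum_le_sum fun i _ => Bool.toNat_le _
  simp only [Finset.sum_const, Nat.card_Icc, smul_eq_mul, mul_one] at this
  omega

theorem abs_innovation_le (hα : R.α ∈ Set.Ioo (0 : ℝ) 1) (t : ℕ) (ω : Ω) (x : 𝒳) (z : ℝ) :
    |R.innovation t ω x z| ≤ 1 := by
  rw [innovation]
  split_ifs
  · have := react_mem_Icc (R.μ x + R.σ x * z)
      (interval R.B (R.muHat t ω x) (R.sigmaHat t ω x) (R.level t ω)) (R.level t ω)
    rw [abs_le]
    constructor <;> linarith [this.1, this.2, hα.1, hα.2]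
  · simp

/-- Below 0 the reaction is 1 and the level cannot go down; from `B` on the interval is all of `ℝ`,
the reaction is 0 and the level cannot go up. A single step has size at most `c`. -/
theorem level_mem (hY : ∀ t, 1 ≤ t → ∀ ω, R.Y t ω = R.μ (R.X t ω) + R.σ (R.X t ω) * R.ξ t ω)
    (hα : R.α ∈ Set.Ioo (0 : ℝ) 1) (hB : 0 < R.B) (hc : 0 < R.c) (hβ : 0 < R.β)
    (hq₁ : R.q₁ ∈ Set.Icc 0 R.B) {t : ℕ} (ht : 1 ≤ t) (ω : Ω) :
    R.level t ω ∈ Set.Icc (-R.c) (R.B + R.c) := by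
  induction t, ht using Nat.le_induction with
  | base =>
    change R.q₁ ∈ _
    constructor <;> linarith [hq₁.1, hq₁.2]
  | succ t ht ih =>
    rw [R.level_succ hY ht]
    have hγ0 : 0 ≤ R.c * (R.count t ω : ℝ) ^ (-R.β) := by positivity
    have hγ1 : R.c * (R.count t ω : ℝ) ^ (-R.β) ≤ R.c := by
      have h1 : (1 : ℝ) ≤ R.count t ω := by exact_mod_cast R.one_le_count t ω
      have := Real.rpow_le_one_of_one_le_of_nonpos h1 (neg_nonpos.2 hβ.le)
      nlinarith
    set γ := R.c * (R.count t ω : ℝ) ^ (-R.β)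
    rw [innovation]
    split_ifs with hS
    swap
    · simpa using ih
    set x := R.X t ω
    have hr := react_mem_Icc (R.μ x + R.σ x * R.ξ t ω)
      (interval R.B (R.muHat t ω x) (R.sigmaHat t ω x) (R.level t ω)) (R.level t ω)
    have h0 : R.level t ω < 0 → react (R.μ x + R.σ x * R.ξ t ω)
        (interval R.B (R.muHat t ω x) (R.sigmaHat t ω x) (R.level t ω)) (R.level t ω) = 1 := by
      intro h
      simp [react, h, not_le.2 h]
    have h1 : R.B ≤ R.level t ω → react (R.μ x + R.σ x * R.ξ t ω)
        (interval R.B (R.muHat t ω x) (R.sigmaHat t ω x) (R.level t ω)) (R.level t ω) = 0 := by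
      intro h
      have h' := hB.trans_le h
      simp [react, interval, not_le.2 h', not_lt.2 h'.le, h]
    set ρ := react (R.μ x + R.σ x * R.ξ t ω)
      (interval R.B (R.muHat t ω x) (R.sigmaHat t ω x) (R.level t ω)) (R.level t ω)
    have hlow : γ * (-1) ≤ γ * (ρ - R.α) := by gcongr; linarith [hr.1, hα.2]
    have hupp : γ * (ρ - R.α) ≤ γ * 1 := by gcongr; linarith [hr.2, hα.1]
    rcases lt_or_ge (R.level t ω) 0 with hq | hq
    · have : 0 ≤ γ * (ρ - R.α) := mul_nonneg hγ0 (by rw [h0 hq]; linarith [hα.2])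
      constructor <;> linarith [ih.1]
    rcases lt_or_ge (R.level t ω) R.B with hqB | hqB
    · constructor <;> linarith
    · have : 0 ≤ γ * (R.α - ρ) := mul_nonneg hγ0 (by rw [h1 hqB]; linarith [hα.1])
      constructor <;> linarith [ih.2]

theorem err_mem {K : ℝ} (hK : 0 ≤ K) (t : ℕ) (ω : Ω) (x : 𝒳) :
    R.err K t ω x ∈ Set.Icc (0 : ℝ) 1 :=
  ⟨le_min zero_le_one (by positivity), min_le_left _ _⟩

/-! ### Measurability of a run -/

variable [MeasurableSpace 𝒳]

theorem measurable_stateAt (hmu : IsEstimator R.info R.muHat)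
    (hsig : IsEstimator R.info R.sigmaHat) (hS : Measurable R.S) (m : ℕ) :
    Measurable[R.info m] (R.stateAt m) := by
  induction m with
  | zero =>
    exact measurable_const (a := (R.q₁, 1))
  | succ m ih =>
    -- The estimators of time `m + 1` depend on the past up to `m` only, but are evaluated at the
    -- covariate of time `m + 1`, so the larger σ-algebra is needed.
    let _ : MeasurableSpace Ω := R.info (m + 1)
    have hle : R.info m ≤ R.info (m + 1) := past_mono R.D₀ R.X R.Y (Nat.le_succ m)
    have hst : Measurable (R.stateAt m) := ih.mono hle le_rfl
    have hXY : Measurable fun ω => (R.X (m + 1) ω, R.Y (m + 1) ω) :=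
      measurable_past R.D₀ R.X R.Y (by omega)
    have hX : Measurable (R.X (m + 1)) := measurable_fst.comp hXY
    have hYm : Measurable (R.Y (m + 1)) := measurable_snd.comp hXY
    have hle' : ((R.info m).prod inferInstance : MeasurableSpace (Ω × 𝒳)) ≤
      Prod.instMeasurableSpace := sup_le_sup (MeasurableSpace.comap_mono hle) le_rfl
    have hm1 : Measurable fun ω => R.muHat (m + 1) ω (R.X (m + 1) ω) :=
      ((hmu (m + 1) (by omega)).mono hle' le_rfl).comp (measurable_id.prodMk hX)
    have hs1 : Measurable fun ω => R.sigmaHat (m + 1) ω (R.X (m + 1) ω) :=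
      ((hsig (m + 1) (by omega)).mono hle' le_rfl).comp (measurable_id.prodMk hX)
    have hr := (measurable_react R.B).comp (hYm.prodMk (hm1.prodMk (hs1.prodMk hst.fst)))
    have hJ : Measurable fun ω => ((R.stateAt m ω).2 : ℝ) := measurable_from_nat.comp hst.snd
    rw [show R.stateAt (m + 1) = fun ω => R.stateAt (m + 1) ω from rfl]
    simp only [stateAt_succ]
    refine Measurable.ite ((hS.comp hX) (measurableSet_singleton true)) ?_ hst
    refine Measurable.prodMk (hst.fst.add (Measurable.mul (by fun_prop) (hr.sub_const R.α))) ?_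
    exact (measurable_of_countable (fun j : ℕ => j + 1)).comp hst.snd

theorem measurable_level (hmu : IsEstimator R.info R.muHat)
    (hsig : IsEstimator R.info R.sigmaHat) (hS : Measurable R.S) (t : ℕ) :
    Measurable[R.info (t - 1)] (R.level t) :=
  measurable_fst.comp (R.measurable_stateAt hmu hsig hS (t - 1))

theorem measurable_count (hmu : IsEstimator R.info R.muHat)
    (hsig : IsEstimator R.info R.sigmaHat) (hS : Measurable R.S) (t : ℕ) :
    Measurable[R.info (t - 1)] (R.count t) :=
  measurable_snd.comp (R.measurable_stateAt hmu hsig hS (t - 1))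

theorem measurable_innovation (hmu : IsEstimator R.info R.muHat)
    (hsig : IsEstimator R.info R.sigmaHat) (hS : Measurable R.S) (hμ : Measurable R.μ)
    (hσ : Measurable R.σ) {t : ℕ} (ht : 1 ≤ t) :
    Measurable[(R.info (t - 1)).prod inferInstance]
      fun p : Ω × 𝒳 × ℝ => R.innovation t p.1 p.2.1 p.2.2 := by
  let _ : MeasurableSpace Ω := R.info (t - 1)
  have hq : Measurable (R.level t) := R.measurable_level hmu hsig hS t
  have hx : Measurable fun p : Ω × 𝒳 × ℝ => (p.1, p.2.1) := by fun_prop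
  have hm1 : Measurable fun p : Ω × 𝒳 × ℝ => R.muHat t p.1 p.2.1 := (hmu t ht).comp hx
  have hs1 : Measurable fun p : Ω × 𝒳 × ℝ => R.sigmaHat t p.1 p.2.1 := (hsig t ht).comp hx
  have hy : Measurable fun p : Ω × 𝒳 × ℝ => R.μ p.2.1 + R.σ p.2.1 * p.2.2 := by fun_prop
  have hq1 : Measurable fun p : Ω × 𝒳 × ℝ => R.level t p.1 := hq.comp measurable_fst
  have hr := (measurable_react R.B).comp (hy.prodMk (hm1.prodMk (hs1.prodMk hq1)))
  refine Measurable.ite ?_ (hr.sub_const R.α) measurable_const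
  exact (hS.comp (measurable_fst.comp measurable_snd)) (measurableSet_singleton true)

theorem measurable_err (hmu : IsEstimator R.info R.muHat)
    (hsig : IsEstimator R.info R.sigmaHat) (hμ : Measurable R.μ)
    (hσ : Measurable R.σ) (K : ℝ) {t : ℕ} (ht : 1 ≤ t) :
    Measurable[(R.info (t - 1)).prod inferInstance] fun p : Ω × 𝒳 => R.err K t p.1 p.2 := by
  let _ : MeasurableSpace Ω := R.info (t - 1)
  have hm1 : Measurable fun p : Ω × 𝒳 => R.muHat t p.1 p.2 := hmu t ht
  have hs1 : Measurable fun p : Ω × 𝒳 => R.sigmaHat t p.1 p.2 := hsig t ht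
  unfold err
  fun_prop

theorem isSetRule_interval (hmu : IsEstimator R.info R.muHat)
    (hsig : IsEstimator R.info R.sigmaHat) (hS : Measurable R.S) :
    IsSetRule R.info fun t ω x =>
      interval R.B (R.muHat t ω x) (R.sigmaHat t ω x) (R.level t ω) := by
  intro t ht
  let _ : MeasurableSpace Ω := R.info (t - 1)
  have hq : Measurable (R.level t) := R.measurable_level hmu hsig hS t
  have hx : Measurable fun p : Ω × 𝒳 × ℝ => (p.1, p.2.1) := by fun_prop
  have hm1 : Measurable fun p : Ω × 𝒳 × ℝ => R.muHat t p.1 p.2.1 := (hmu t ht).comp hx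
  have hs1 : Measurable fun p : Ω × 𝒳 × ℝ => R.sigmaHat t p.1 p.2.1 := (hsig t ht).comp hx
  have hq1 : Measurable fun p : Ω × 𝒳 × ℝ => R.level t p.1 := hq.comp measurable_fst
  exact ((measurable_snd.comp measurable_snd).prodMk (hm1.prodMk (hs1.prodMk hq1)))
    (measurableSet_mem_interval R.B)

end Defs

end Run

end OnlineSCI

end

/-! ### The oracle level and the standing assumptions on a run. -/

noncomputable section

namespace OnlineSCI

theorem tailQuantile_eq {Ω : Type*} [MeasurableSpace Ω] (P : Measure Ω) {ξ : Ω → ℝ}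
    (hξ : Measurable ξ) (u : ℝ) : tailQuantile P ξ u = upperQuantile (P.map ξ) u := by
  rw [tailQuantile, upperQuantile]
  congr 1
  ext z
  simp only [Set.mem_ofPred_eq, tail, map_measureReal_apply hξ measurableSet_Ioi]
  rfl

theorem sq_integral_le_integral_sq {Ω : Type*} [MeasurableSpace Ω] {P : Measure Ω}
    [IsProbabilityMeasure P] {f : Ω → ℝ} (hf : Measurable f) {K : ℝ} (hK : ∀ ω, |f ω| ≤ K) :
    (∫ ω, f ω ∂P) ^ 2 ≤ ∫ ω, f ω ^ 2 ∂P := by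
  have i1 := integrable_of_abs_le (P := P) hf hK
  have i2 : Integrable (fun ω => f ω ^ 2) P :=
    integrable_of_abs_le (K := K ^ 2) (by fun_prop) fun ω => by
      rw [abs_pow]
      have := hK ω
      gcongr
  set m := ∫ ω, f ω ∂P
  have h : 0 ≤ ∫ ω, (f ω - m) ^ 2 ∂P := integral_nonneg fun ω => sq_nonneg _
  have e : ∫ ω, (f ω - m) ^ 2 ∂P = ∫ ω, (f ω ^ 2 + ((-(2 * m)) * f ω + m ^ 2)) ∂P := by
    congr 1
    ext ω
    ring
  have i3 : Integrable (fun ω => -(2 * m) * f ω + m ^ 2) P :=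
    (i1.const_mul _).add (integrable_const _)
  rw [e, integral_add i2 i3, integral_add (i1.const_mul _) (integrable_const _),
    integral_const_mul] at h
  simp only [integral_const, probReal_univ, smul_eq_mul, one_mul] at h
  change 0 ≤ _ + (-(2 * m) * m + m ^ 2) at h
  linarith

theorem measurable_integral_snd {Ω 𝒳 : Type*} [MeasurableSpace Ω] [MeasurableSpace 𝒳]
    (ν : Measure 𝒳) [SFinite ν] {φ : Ω × 𝒳 → ℝ} (hφ : Measurable φ) :
    Measurable fun ω => ∫ x, φ (ω, x) ∂ν :=
  (hφ.stronglyMeasurable.integral_prod_right' (ν := ν)).measurable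

namespace Run

variable {Ω 𝒳 : Type*} [mΩ : MeasurableSpace Ω] [MeasurableSpace 𝒳]

/-- A run satisfies the assumptions on the model, the noise and the procedure. -/
structure Valid (R : Run Ω 𝒳) (P : Measure Ω) : Prop where
  model : IIDRegression P R.D₀ R.X R.ξ R.Y R.μ R.σ
  noise : NoiseRegular P (R.ξ 1) R.f R.σ
  decr : DecreasingDensity R.f R.σ
  measurable_S : Measurable R.S
  selected : 0 < P {ω | R.S (R.X 1 ω) = true}
  α_mem : R.α ∈ Set.Ioo (0 : ℝ) 1
  B_pos : 0 < R.B
  c_pos : 0 < R.c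
  β_mem : R.β ∈ Set.Ioo (1 / 2 : ℝ) 1
  q₁_mem : R.q₁ ∈ Set.Icc 0 R.B
  muHat : IsEstimator R.info R.muHat
  sigmaHat : IsEstimator R.info R.sigmaHat
  sigmaHat_nonneg : ∀ t, 1 ≤ t → ∀ ω x, 0 ≤ R.sigmaHat t ω x

/-- The law of the noise. -/
def noiseLaw (R : Run Ω 𝒳) (P : Measure Ω) : Measure ℝ := P.map (R.ξ 1)

/-- The law of the covariate. -/
def covLaw (R : Run Ω 𝒳) (P : Measure Ω) : Measure 𝒳 := P.map (R.X 1)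

/-- The standardized half-length of the oracle interval. -/
def zStar (R : Run Ω 𝒳) (P : Measure Ω) : ℝ := upperQuantile (R.noiseLaw P) (R.α / 2)

/-- The level whose radius is the standardized half-length of the oracle interval. -/
def qStar (R : Run Ω 𝒳) (P : Measure Ω) : ℝ := levelOf R.B (R.zStar P)

/-- The truncated estimation error averaged over the covariate. -/
def meanErr (R : Run Ω 𝒳) (P : Measure Ω) (K : ℝ) (t : ℕ) (ω : Ω) : ℝ :=
  ∫ x, R.err K t ω x ∂(R.covLaw P)

/-- The selection probability. -/
def selProb (R : Run Ω 𝒳) (P : Measure Ω) : ℝ := (R.covLaw P).real {x | R.S x = true}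

namespace Valid

variable {R : Run Ω 𝒳} {P : Measure Ω}

theorem unimodal (h : R.Valid P) : UnimodalDensity (R.noiseLaw P) R.f where
  nonneg := h.noise.density_nonneg
  eq := h.noise.density
  continuous := h.noise.continuous
  symmetric := h.noise.symmetric
  antitoneOn := h.decr.antitoneOn

theorem half_α_mem (h : R.Valid P) : R.α / 2 ∈ Set.Ioo (0 : ℝ) (1 / 2) :=
  ⟨by linarith [h.α_mem.1], by linarith [h.α_mem.2]⟩

theorem β_pos (h : R.Valid P) : 0 < R.β := by linarith [h.β_mem.1]

theorem info_le (h : R.Valid P) (t : ℕ) : R.info t ≤ mΩ := h.model.past_le t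

theorem measurable_level (h : R.Valid P) (t : ℕ) : Measurable (R.level t) :=
  (R.measurable_level h.muHat h.sigmaHat h.measurable_S t).mono (h.info_le _) le_rfl

theorem measurable_count (h : R.Valid P) (t : ℕ) : Measurable (R.count t) :=
  (R.measurable_count h.muHat h.sigmaHat h.measurable_S t).mono (h.info_le _) le_rfl

theorem info_prod_le (h : R.Valid P) {𝒵 : Type*} [MeasurableSpace 𝒵] (t : ℕ) :
    ((R.info t).prod inferInstance : MeasurableSpace (Ω × 𝒵)) ≤ Prod.instMeasurableSpace :=
  sup_le_sup (MeasurableSpace.comap_mono (h.info_le t)) le_rfl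

variable [IsProbabilityMeasure P]

theorem prob_noiseLaw (h : R.Valid P) : IsProbabilityMeasure (R.noiseLaw P) :=
  Measure.isProbabilityMeasure_map (h.model.measurable_noise 1 le_rfl).aemeasurable

theorem prob_covLaw (h : R.Valid P) : IsProbabilityMeasure (R.covLaw P) :=
  Measure.isProbabilityMeasure_map (h.model.measurable_X 1 le_rfl).aemeasurable

theorem zStar_pos (h : R.Valid P) : 0 < R.zStar P :=
  have := h.prob_noiseLaw
  h.unimodal.upperQuantile_pos h.half_α_mem

theorem f_zStar_pos (h : R.Valid P) : 0 < R.f (R.zStar P) :=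
  have := h.prob_noiseLaw
  h.unimodal.pos_upperQuantile h.half_α_mem

theorem tail_zStar (h : R.Valid P) : tail (R.noiseLaw P) (R.zStar P) = R.α / 2 :=
  have := h.prob_noiseLaw
  h.unimodal.tail_upperQuantile ⟨h.half_α_mem.1, by linarith [h.half_α_mem.2]⟩

theorem qStar_mem (h : R.Valid P) : R.qStar P ∈ Set.Ioo 0 R.B := by
  refine ⟨?_, levelOf_lt h.B_pos h.zStar_pos.le⟩
  have := levelOf_strictMono h.B_pos le_rfl h.zStar_pos
  rwa [levelOf_zero] at this

theorem abs_level_sub_le (h : R.Valid P) {t : ℕ} (ht : 1 ≤ t) (ω : Ω) :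
    |R.level t ω - R.qStar P| ≤ R.B + R.c := by
  have h1 := R.level_mem h.model.model h.α_mem h.B_pos h.c_pos h.β_pos h.q₁_mem ht ω
  have h2 := h.qStar_mem
  rw [abs_le]
  constructor <;> linarith [h1.1, h1.2, h2.1, h2.2]

theorem measurable_innovation (h : R.Valid P) {t : ℕ} (ht : 1 ≤ t) :
    Measurable fun p : Ω × 𝒳 × ℝ => R.innovation t p.1 p.2.1 p.2.2 :=
  (R.measurable_innovation h.muHat h.sigmaHat h.measurable_S h.model.measurable_mu
    h.model.measurable_sigma ht).mono (h.info_prod_le _) le_rfl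

theorem measurable_err (h : R.Valid P) (K : ℝ) {t : ℕ} (ht : 1 ≤ t) :
    Measurable fun p : Ω × 𝒳 => R.err K t p.1 p.2 :=
  (R.measurable_err h.muHat h.sigmaHat h.model.measurable_mu
    h.model.measurable_sigma K ht).mono (h.info_prod_le _) le_rfl

theorem measurable_muHat (h : R.Valid P) {t : ℕ} (ht : 1 ≤ t) :
    Measurable fun p : Ω × 𝒳 => R.muHat t p.1 p.2 :=
  (h.muHat t ht).mono (h.info_prod_le _) le_rfl

theorem measurable_sigmaHat (h : R.Valid P) {t : ℕ} (ht : 1 ≤ t) :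
    Measurable fun p : Ω × 𝒳 => R.sigmaHat t p.1 p.2 :=
  (h.sigmaHat t ht).mono (h.info_prod_le _) le_rfl

theorem measurable_meanErr_info (h : R.Valid P) (K : ℝ) {t : ℕ} (ht : 1 ≤ t) :
    Measurable[R.info (t - 1)] (R.meanErr P K t) := by
  have := h.prob_covLaw
  exact @measurable_integral_snd Ω 𝒳 (R.info (t - 1)) _ (R.covLaw P) _ _
    (R.measurable_err h.muHat h.sigmaHat h.model.measurable_mu h.model.measurable_sigma K ht)

theorem measurable_meanErr (h : R.Valid P) (K : ℝ) {t : ℕ} (ht : 1 ≤ t) :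
    Measurable (R.meanErr P K t) :=
  (h.measurable_meanErr_info K ht).mono (h.info_le _) le_rfl

theorem integrable_err (h : R.Valid P) {K : ℝ} (hK : 0 ≤ K) {t : ℕ} (ht : 1 ≤ t) (ω : Ω) :
    Integrable (R.err K t ω) (R.covLaw P) := by
  have := h.prob_covLaw
  refine integrable_of_abs_le (K := 1) ((h.measurable_err K ht).comp measurable_prodMk_left)
    fun x => ?_
  rw [abs_of_nonneg (R.err_mem hK t ω x).1]
  exact (R.err_mem hK t ω x).2

theorem meanErr_mem (h : R.Valid P) {K : ℝ} (hK : 0 ≤ K) {t : ℕ} (ht : 1 ≤ t) (ω : Ω) :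
    R.meanErr P K t ω ∈ Set.Icc (0 : ℝ) 1 := by
  have := h.prob_covLaw
  refine ⟨integral_nonneg fun x => (R.err_mem hK t ω x).1, ?_⟩
  refine (integral_mono (h.integrable_err hK ht ω) (integrable_const 1)
    fun x => (R.err_mem hK t ω x).2).trans_eq ?_
  simp

/-! ### Miscoverage and drift -/

/-- The truncation of the error at 1 is free, since both miscoverages lie in `[0, 1]`. It keeps all
later moments finite without moment assumptions on the estimators. -/
theorem exists_err_bound (h : R.Valid P) :
    ∃ K > 0, ∀ t, 1 ≤ t → ∀ ω x,
      |R.missAt (R.noiseLaw P) t ω x - idealMiss (R.noiseLaw P) R.B (R.level t ω)| ≤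
        R.err K t ω x := by
  have := h.prob_noiseLaw
  obtain ⟨C, hC⟩ := h.noise.bdd_mul
  obtain ⟨s₀, hs₀⟩ := h.noise.inv_sigma_bdd
  refine ⟨max 1 (s₀ * (2 * R.f 0 + 2 * (2 * C + 2))), by positivity, fun t ht ω x => le_min ?_ ?_⟩
  · have h1 : 0 ≤ R.missAt (R.noiseLaw P) t ω x := measureReal_nonneg
    have h2 : R.missAt (R.noiseLaw P) t ω x ≤ 1 := measureReal_le_one
    have h3 : 0 ≤ idealMiss (R.noiseLaw P) R.B (R.level t ω) ∧
        idealMiss (R.noiseLaw P) R.B (R.level t ω) ≤ 1 := by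
      rw [idealMiss]
      split_ifs with hB
      · simp
      · have h4 := tail_nonneg (ν := R.noiseLaw P) (radius R.B (R.level t ω))
        have h5 := tail_antitone (ν := R.noiseLaw P) (radius_nonneg (not_le.1 hB))
        rw [h.unimodal.tail_zero] at h5
        constructor <;> linarith
    rw [abs_le]
    constructor <;> linarith [h3.1, h3.2]
  · refine (abs_miss_sub_idealMiss_le h.unimodal h.B_pos (fun z => hC ⟨z, rfl⟩) _ _ _
      (h.sigmaHat_nonneg t ht ω x) (h.noise.sigma_pos x) (hs₀ ⟨x, rfl⟩)).trans ?_
    gcongr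
    exact le_max_right _ _

theorem integral_innovation (h : R.Valid P) (t : ℕ) (ω : Ω) (x : 𝒳)
    (hm : Measurable fun z => R.innovation t ω x z) :
    ∫ z, R.innovation t ω x z ∂(R.noiseLaw P) =
      if R.S x = true then R.missAt (R.noiseLaw P) t ω x - R.α else 0 := by
  have := h.prob_noiseLaw
  by_cases hS : R.S x = true
  · have hi := integrable_of_abs_le (P := R.noiseLaw P) hm
      (fun z => R.abs_innovation_le h.α_mem t ω x z)
    have e : (fun z => R.innovation t ω x z + R.α) = fun z => react (R.μ x + R.σ x * z)
        (interval R.B (R.muHat t ω x) (R.sigmaHat t ω x) (R.level t ω)) (R.level t ω) := by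
      ext z
      simp [innovation, hS]
    have h2 := integral_add hi (integrable_const R.α)
    simp only [integral_const, probReal_univ, smul_eq_mul, one_mul] at h2
    rw [e, integral_react h.unimodal _ _ _ _ _ (h.noise.sigma_pos x)] at h2
    rw [if_pos hS, missAt, h2]
    ring
  · simp [innovation, hS]

/-- The ideal miscoverage does not depend on the covariate, so selecting on the covariate merely
multiplies the drift by the selection probability. The estimation error is nonnegative and may be
averaged over all covariates, selected or not. -/
theorem mul_integral_innovation_le (h : R.Valid P) {κ : ℝ}
    (hκ : ∀ q ∈ Set.Icc (-R.c) (R.B + R.c), (q - R.qStar P) *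
      (idealMiss (R.noiseLaw P) R.B q - R.α) ≤ -κ * (q - R.qStar P) ^ 2) {K : ℝ} (hK : 0 ≤ K)
    (herr : ∀ t, 1 ≤ t → ∀ ω x,
      |R.missAt (R.noiseLaw P) t ω x - idealMiss (R.noiseLaw P) R.B (R.level t ω)| ≤
        R.err K t ω x) {t : ℕ} (ht : 1 ≤ t) (ω : Ω) :
    (R.level t ω - R.qStar P) *
        ∫ p, R.innovation t ω p.1 p.2 ∂((R.covLaw P).prod (R.noiseLaw P)) ≤
      -(R.selProb P * κ) * (R.level t ω - R.qStar P) ^ 2 +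
        |R.level t ω - R.qStar P| * R.meanErr P K t ω := by
  have := h.prob_noiseLaw
  have := h.prob_covLaw
  have hm : Measurable fun p : 𝒳 × ℝ => R.innovation t ω p.1 p.2 :=
    (h.measurable_innovation ht).comp measurable_prodMk_left
  have hi : Integrable (fun p : 𝒳 × ℝ => R.innovation t ω p.1 p.2)
      ((R.covLaw P).prod (R.noiseLaw P)) :=
    integrable_of_abs_le hm fun p => R.abs_innovation_le h.α_mem t ω p.1 p.2
  have hSm : MeasurableSet {x | R.S x = true} := h.measurable_S (measurableSet_singleton true)
  rw [integral_prod _ hi]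
  have hi' := hi.integral_prod_left
  set d := R.level t ω - R.qStar P with hd
  set π := idealMiss (R.noiseLaw P) R.B (R.level t ω)
  rw [← integral_const_mul]
  have hS : Integrable ({x | R.S x = true}.indicator fun _ => d * (π - R.α)) (R.covLaw P) :=
    (integrable_const _).indicator hSm
  have hE := (h.integrable_err hK ht ω).const_mul |d|
  calc ∫ x, d * ∫ z, R.innovation t ω x z ∂(R.noiseLaw P) ∂(R.covLaw P)
      ≤ ∫ x, ({x | R.S x = true}.indicator (fun _ => d * (π - R.α)) x + |d| * R.err K t ω x)
          ∂(R.covLaw P) := by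
        refine integral_mono (hi'.const_mul d) (hS.add hE) fun x => ?_
        simp only
        rw [h.integral_innovation t ω x (hm.comp measurable_prodMk_left)]
        have h0 : 0 ≤ |d| * R.err K t ω x :=
          mul_nonneg (abs_nonneg _) (R.err_mem hK t ω x).1
        by_cases hx : R.S x = true
        · rw [if_pos hx, Set.indicator_of_mem (by exact hx)]
          have h1 : d * (R.missAt (R.noiseLaw P) t ω x - π) ≤ |d| * R.err K t ω x := by
            refine (le_abs_self _).trans ?_
            rw [abs_mul]
            exact mul_le_mul_of_nonneg_left (herr t ht ω x) (abs_nonneg _)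
          linarith
        · rw [if_neg hx, Set.indicator_of_notMem (by exact hx)]
          linarith
    _ = R.selProb P * (d * (π - R.α)) + |d| * R.meanErr P K t ω := by
        rw [integral_add hS hE, integral_indicator_const _ hSm, integral_const_mul]
        rfl
    _ ≤ _ := by
        have h1 := hκ _ (R.level_mem h.model.model h.α_mem h.B_pos h.c_pos h.β_pos h.q₁_mem ht ω)
        have h2 := mul_le_mul_of_nonneg_left h1
          (measureReal_nonneg : 0 ≤ (R.covLaw P).real {x | R.S x = true})
        change R.selProb P * (d * (π - R.α)) ≤ R.selProb P * (-κ * d ^ 2) at h2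
        linarith

/-- The weight, step size times odd power, is known from the past, so the current couple can be
integrated out. One factor of the odd power combines with the innovation as in
`mul_integral_innovation_le`; the remaining power is even, hence a nonnegative multiplier. -/
theorem drift (h : R.Valid P) {κ : ℝ}
    (hκ : ∀ q ∈ Set.Icc (-R.c) (R.B + R.c), (q - R.qStar P) *
      (idealMiss (R.noiseLaw P) R.B q - R.α) ≤ -κ * (q - R.qStar P) ^ 2) {K : ℝ} (hK : 0 ≤ K)
    (herr : ∀ t, 1 ≤ t → ∀ ω x,
      |R.missAt (R.noiseLaw P) t ω x - idealMiss (R.noiseLaw P) R.B (R.level t ω)| ≤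
        R.err K t ω x) {k : ℕ} (hk : 1 ≤ k) {t : ℕ} (ht : 1 ≤ t) :
    ∫ ω, R.c * (R.count t ω : ℝ) ^ (-R.β) * (R.level t ω - R.qStar P) ^ (2 * k - 1) *
        R.innovation t ω (R.X t ω) (R.ξ t ω) ∂P ≤
      ∫ ω, (-(R.selProb P * κ) * (R.c * (R.count t ω : ℝ) ^ (-R.β) *
          (R.level t ω - R.qStar P) ^ (2 * k)) +
        R.c * (R.count t ω : ℝ) ^ (-R.β) *
          (|R.level t ω - R.qStar P| ^ (2 * k - 1) * R.meanErr P K t ω)) ∂P := by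
  have := h.prob_noiseLaw
  have := h.prob_covLaw
  have hc := h.c_pos
  set D := R.B + R.c
  have hD : 0 ≤ D := by linarith [h.B_pos, h.c_pos]
  set w : Ω → ℝ := fun ω =>
    R.c * (R.count t ω : ℝ) ^ (-R.β) * (R.level t ω - R.qStar P) ^ (2 * k - 1)
  have hγ : ∀ ω, 0 ≤ R.c * (R.count t ω : ℝ) ^ (-R.β) ∧
      R.c * (R.count t ω : ℝ) ^ (-R.β) ≤ R.c := fun ω => by
    have h1 : (1 : ℝ) ≤ R.count t ω := by exact_mod_cast R.one_le_count t ω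
    have := Real.rpow_le_one_of_one_le_of_nonpos h1 (neg_nonpos.2 h.β_pos.le)
    exact ⟨by positivity, by nlinarith⟩
  have hwK : ∀ ω, |w ω| ≤ R.c * D ^ (2 * k - 1) := fun ω => by
    simp only [w]
    rw [abs_mul, abs_pow, abs_of_nonneg (hγ ω).1]
    have h1 := h.abs_level_sub_le ht ω
    have h2 := (hγ ω).2
    gcongr
  have hwm' : Measurable[R.info (t - 1)] w := by
    have h1 := R.measurable_level h.muHat h.sigmaHat h.measurable_S t
    have h2 : Measurable[R.info (t - 1)] fun ω => (R.count t ω : ℝ) :=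
      measurable_from_nat.comp (R.measurable_count h.muHat h.sigmaHat h.measurable_S t)
    exact ((h2.pow_const _).const_mul _).mul ((h1.sub_const _).pow_const _)
  have hwm : Measurable w := hwm'.mono (h.info_le _) le_rfl
  have hφ : Measurable[(R.info (t - 1)).prod inferInstance]
      fun p : Ω × 𝒳 × ℝ => w p.1 * R.innovation t p.1 p.2.1 p.2.2 :=
    Measurable.mul (hwm'.comp (@measurable_fst Ω (𝒳 × ℝ) (R.info (t - 1)) _))
      (R.measurable_innovation h.muHat h.sigmaHat h.measurable_S
      h.model.measurable_mu h.model.measurable_sigma ht)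
  have hφK : ∀ p : Ω × 𝒳 × ℝ,
      |w p.1 * R.innovation t p.1 p.2.1 p.2.2| ≤ R.c * D ^ (2 * k - 1) * 1 := fun p => by
    rw [abs_mul]
    have h1 := hwK p.1
    have h2 := R.abs_innovation_le h.α_mem t p.1 p.2.1 p.2.2
    gcongr
  have hfreeze := integral_prodMk_of_indep (h.info_le (t - 1))
    ((h.model.measurable_X t ht).prodMk (h.model.measurable_noise t ht))
    (h.model.indep_past ht) hφ hφK
  have hmap : P.map (fun ω => (R.X t ω, R.ξ t ω)) = (R.covLaw P).prod (R.noiseLaw P) :=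
    h.model.map_pair ht
  rw [hmap] at hfreeze
  refine hfreeze.le.trans ?_
  have hφm := hφ.mono (h.info_prod_le (t - 1)) le_rfl
  have hint := (integrable_of_abs_le (P := P.prod ((R.covLaw P).prod (R.noiseLaw P)))
    hφm hφK).integral_prod_left
  have hγm : Measurable fun ω => R.c * (R.count t ω : ℝ) ^ (-R.β) := by
    have : Measurable fun ω => (R.count t ω : ℝ) := measurable_from_nat.comp (h.measurable_count t)
    fun_prop
  have hdm : Measurable fun ω => R.level t ω - R.qStar P := (h.measurable_level t).sub_const _
  have hεm := h.measurable_meanErr K ht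
  have hint1 : Integrable (fun ω => R.c * (R.count t ω : ℝ) ^ (-R.β) *
      (R.level t ω - R.qStar P) ^ (2 * k)) P :=
    integrable_of_abs_le (K := R.c * D ^ (2 * k)) (hγm.mul (hdm.pow_const _)) fun ω => by
      rw [abs_mul, abs_pow, abs_of_nonneg (hγ ω).1]
      have h1 := h.abs_level_sub_le ht ω
      have h2 := (hγ ω).2
      gcongr
  have hint2 : Integrable (fun ω => R.c * (R.count t ω : ℝ) ^ (-R.β) *
      (|R.level t ω - R.qStar P| ^ (2 * k - 1) * R.meanErr P K t ω)) P :=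
    integrable_of_abs_le (K := R.c * (D ^ (2 * k - 1) * 1))
      (hγm.mul ((hdm.abs.pow_const _).mul hεm)) fun ω => by
      rw [abs_mul, abs_of_nonneg (hγ ω).1, abs_mul, abs_pow, abs_abs,
        abs_of_nonneg (h.meanErr_mem hK ht ω).1]
      have h1 := h.abs_level_sub_le ht ω
      have h2 := (hγ ω).2
      have h3 := h.meanErr_mem hK ht ω
      gcongr
      all_goals first | exact h3.1 | exact h3.2 | exact mul_nonneg (by positivity) h3.1
  refine integral_mono hint ((hint1.const_mul _).add hint2) fun ω => ?_
  simp only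
  rw [integral_const_mul]
  have h1 := h.mul_integral_innovation_le hκ hK herr ht ω
  obtain ⟨j, rfl⟩ : ∃ j, k = j + 1 := ⟨k - 1, by omega⟩
  simp only [w, show 2 * (j + 1) - 1 = 2 * j + 1 by omega]
  set d := R.level t ω - R.qStar P
  set γ := R.c * (R.count t ω : ℝ) ^ (-R.β)
  have hd0 : |d| ^ (2 * j) = d ^ (2 * j) := (even_two_mul j).pow_abs d
  have h2 : 0 ≤ γ * d ^ (2 * j) :=
    mul_nonneg (hγ ω).1 ((even_two_mul j).pow_nonneg d)
  calc _ = γ * d ^ (2 * j) * (d * ∫ p, R.innovation t ω p.1 p.2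
          ∂((R.covLaw P).prod (R.noiseLaw P))) := by ring
    _ ≤ γ * d ^ (2 * j) * (-(R.selProb P * κ) * d ^ 2 + |d| * R.meanErr P K t ω) :=
        mul_le_mul_of_nonneg_left h1 h2
    _ = -(R.selProb P * κ) * (γ * d ^ (2 * (j + 1))) +
          γ * (|d| ^ (2 * j + 1) * R.meanErr P K t ω) := by
        rw [pow_succ |d|, hd0]
        ring

end Valid

end Run

end OnlineSCI

end

/-! ### Number of selections and estimation error along a run. -/

noncomputable section

namespace OnlineSCI

theorem eventually_log_rpow_mul_le {p p' : ℝ} (hp : p < p') (C s : ℝ) :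
    ∀ᶠ t : ℕ in atTop, C * (Real.log t ^ s * (t : ℝ) ^ (-p')) ≤ (t : ℝ) ^ (-p) := by
  have h1 := ((isLittleO_log_rpow_rpow_atTop s (sub_pos.2 hp)).const_mul_left C).comp_tendsto
    tendsto_natCast_atTop_atTop
  filter_upwards [h1.def one_pos, eventually_ge_atTop 1] with t h ht
  have ht0 : (0 : ℝ) < t := by exact_mod_cast ht
  simp only [Function.comp_apply, Real.norm_eq_abs, one_mul] at h
  rw [abs_of_nonneg (by positivity : (0 : ℝ) ≤ (t : ℝ) ^ (p' - p))] at h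
  calc C * (Real.log t ^ s * (t : ℝ) ^ (-p')) = C * Real.log t ^ s * (t : ℝ) ^ (-p') := by ring
    _ ≤ (t : ℝ) ^ (p' - p) * (t : ℝ) ^ (-p') := by
      gcongr
      exact (le_abs_self _).trans h
    _ = (t : ℝ) ^ (-p) := by
      rw [← Real.rpow_add ht0]
      congr 1
      ring

theorem Run.measurable_sq_error {Ω 𝒳 : Type*} [MeasurableSpace 𝒳] (R : Run Ω 𝒳)
    (hmu : IsEstimator R.info R.muHat) (hsig : IsEstimator R.info R.sigmaHat)
    (hμ : Measurable R.μ) (hσ : Measurable R.σ) {t : ℕ} (ht : 1 ≤ t) :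
    Measurable[(R.info (t - 1)).prod inferInstance] fun p : Ω × 𝒳 => ENNReal.ofReal
      ((|R.muHat t p.1 p.2 - R.μ p.2| + |R.sigmaHat t p.1 p.2 - R.σ p.2|) ^ 2) := by
  let _ : MeasurableSpace Ω := R.info (t - 1)
  have h1 : Measurable fun p : Ω × 𝒳 => R.muHat t p.1 p.2 := hmu t ht
  have h2 : Measurable fun p : Ω × 𝒳 => R.sigmaHat t p.1 p.2 := hsig t ht
  fun_prop

namespace Run.Valid

variable {Ω 𝒳 : Type*} [mΩ : MeasurableSpace Ω] [MeasurableSpace 𝒳]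
  {R : Run Ω 𝒳} {P : Measure Ω}

theorem selProb_eq (h : R.Valid P) {t : ℕ} (ht : 1 ≤ t) :
    P.real {ω | R.S (R.X t ω) = true} = R.selProb P := by
  have hS : MeasurableSet {x | R.S x = true} := h.measurable_S (measurableSet_singleton true)
  rw [selProb, covLaw, ← h.model.map_X ht, map_measureReal_apply (h.model.measurable_X t ht) hS]
  rfl

variable [IsProbabilityMeasure P]

theorem selProb_pos (h : R.Valid P) : 0 < R.selProb P := by
  rw [← h.selProb_eq le_rfl]
  exact ENNReal.toReal_pos h.selected.ne' (measure_ne_top _ _)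

theorem eventually_count_lt_le (h : R.Valid P) (p : ℝ) :
    ∀ᶠ t : ℕ in atTop,
      P.real {ω | (R.count t ω : ℝ) < R.selProb P / 4 * t} ≤ (t : ℝ) ^ (-p) := by
  have hsm : ∀ i, MeasurableSet {ω | R.S (R.X (i + 1) ω) = true} := fun i =>
    (h.measurable_S.comp (h.model.measurable_X (i + 1) (by omega))) (measurableSet_singleton true)
  have hind : iIndepFun
      (fun i => {ω | R.S (R.X (i + 1) ω) = true}.indicator (fun _ => (1 : ℝ))) P := by
    have hm : Measurable fun p : 𝒳 × ℝ => if R.S p.1 = true then (1 : ℝ) else 0 :=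
      Measurable.ite ((h.measurable_S.comp measurable_fst) (measurableSet_singleton true))
        measurable_const measurable_const
    convert h.model.indep.comp (fun _ p => if R.S p.1 = true then (1 : ℝ) else 0)
      (fun _ => hm) using 2 with i
    ext ω
    by_cases hS : R.S (R.X (i + 1) ω) = true <;> simp [hS]
  have hsum : ∀ n ω, (∑ i ∈ Finset.Icc 1 n, (R.S (R.X i ω)).toNat : ℕ) =
      ∑ i ∈ Finset.range n,
        {ω | R.S (R.X (i + 1) ω) = true}.indicator (fun _ => (1 : ℝ)) ω := by
    intro n ω
    induction n with
    | zero => simp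
    | succ n ih =>
      rw [Finset.sum_Icc_succ_top (by omega), Finset.sum_range_succ, Nat.cast_add, ih]
      congr 1
      by_cases hS : R.S (R.X (n + 1) ω) = true <;> simp [hS]
  filter_upwards [eventually_measureReal_sum_lt_le hsm h.selProb_pos
    (fun i => h.selProb_eq (by omega)) hind p] with t ht
  refine (measureReal_mono fun ω hω => ?_).trans ht
  simp only [Set.mem_ofPred_eq, R.count_eq, Nat.cast_add, Nat.cast_one, hsum] at hω ⊢
  exact hω

/-! ### Moments of the estimation error -/

theorem lintegral_err_sq_le (h : R.Valid P) {t : ℕ} (ht : 1 ≤ t) {b : ℝ}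
    (hb : (⨆ x, ∫⁻ ω, ENNReal.ofReal ((R.muHat t ω x - R.μ x) ^ 2) ∂P) +
      (⨆ x, ∫⁻ ω, ENNReal.ofReal ((R.sigmaHat t ω x - R.σ x) ^ 2) ∂P) ≤ ENNReal.ofReal b)
    (x : 𝒳) :
    ∫⁻ ω, ENNReal.ofReal ((|R.muHat t ω x - R.μ x| + |R.sigmaHat t ω x - R.σ x|) ^ 2) ∂P ≤
      ENNReal.ofReal (2 * b) := by
  have hm : Measurable fun ω => R.muHat t ω x :=
    (h.measurable_muHat ht).comp measurable_prodMk_right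
  calc _ ≤ ∫⁻ ω, ENNReal.ofReal 2 * (ENNReal.ofReal ((R.muHat t ω x - R.μ x) ^ 2) +
          ENNReal.ofReal ((R.sigmaHat t ω x - R.σ x) ^ 2)) ∂P := by
        refine lintegral_mono fun ω => ?_
        rw [← ENNReal.ofReal_add (sq_nonneg _) (sq_nonneg _), ← ENNReal.ofReal_mul zero_le_two]
        refine ENNReal.ofReal_le_ofReal ?_
        rw [← sq_abs (R.muHat t ω x - R.μ x), ← sq_abs (R.sigmaHat t ω x - R.σ x)]
        nlinarith [sq_nonneg (|R.muHat t ω x - R.μ x| - |R.sigmaHat t ω x - R.σ x|)]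
    _ = ENNReal.ofReal 2 * (∫⁻ ω, ENNReal.ofReal ((R.muHat t ω x - R.μ x) ^ 2) ∂P +
          ∫⁻ ω, ENNReal.ofReal ((R.sigmaHat t ω x - R.σ x) ^ 2) ∂P) := by
        rw [lintegral_const_mul' _ _ ENNReal.ofReal_ne_top, lintegral_add_left]
        fun_prop
    _ ≤ ENNReal.ofReal 2 * ENNReal.ofReal b := by
        gcongr
        refine le_trans (add_le_add ?_ ?_) hb
        · exact le_iSup (fun x => ∫⁻ ω, ENNReal.ofReal ((R.muHat t ω x - R.μ x) ^ 2) ∂P) x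
        · exact le_iSup (fun x => ∫⁻ ω, ENNReal.ofReal ((R.sigmaHat t ω x - R.σ x) ^ 2) ∂P) x
    _ = _ := (ENNReal.ofReal_mul zero_le_two).symm

theorem integral_err_sq_le (h : R.Valid P) {K : ℝ} (hK : 0 ≤ K) {t : ℕ} (ht : 1 ≤ t) {b : ℝ}
    (hb0 : 0 ≤ b)
    (hb : (⨆ x, ∫⁻ ω, ENNReal.ofReal ((R.muHat t ω x - R.μ x) ^ 2) ∂P) +
      (⨆ x, ∫⁻ ω, ENNReal.ofReal ((R.sigmaHat t ω x - R.σ x) ^ 2) ∂P) ≤ ENNReal.ofReal b)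
    (x : 𝒳) : ∫ ω, R.err K t ω x ^ 2 ∂P ≤ K ^ 2 * (2 * b) := by
  have hm : Measurable fun ω => R.err K t ω x :=
    (h.measurable_err K ht).comp measurable_prodMk_right
  rw [integral_eq_lintegral_of_nonneg_ae (ae_of_all _ fun ω => sq_nonneg _)
    (hm.pow_const 2).aestronglyMeasurable]
  refine ENNReal.toReal_le_of_le_ofReal (by positivity) ?_
  calc _ ≤ ∫⁻ ω, ENNReal.ofReal (K ^ 2) * ENNReal.ofReal
          ((|R.muHat t ω x - R.μ x| + |R.sigmaHat t ω x - R.σ x|) ^ 2) ∂P := by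
        refine lintegral_mono fun ω => ?_
        rw [← ENNReal.ofReal_mul (sq_nonneg K), ← mul_pow]
        refine ENNReal.ofReal_le_ofReal (pow_le_pow_left₀ (R.err_mem hK t ω x).1 ?_ 2)
        exact min_le_right _ _
    _ ≤ ENNReal.ofReal (K ^ 2) * ENNReal.ofReal (2 * b) := by
        rw [lintegral_const_mul' _ _ ENNReal.ofReal_ne_top]
        gcongr
        exact h.lintegral_err_sq_le ht hb x
    _ = _ := (ENNReal.ofReal_mul (sq_nonneg K)).symm

/-- Jensen in the covariate, then Fubini: the mean square at each fixed point is controlled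
uniformly. -/
theorem integral_meanErr_sq_le (h : R.Valid P) {K : ℝ} (hK : 0 ≤ K) {t : ℕ} (ht : 1 ≤ t) {b : ℝ}
    (hb0 : 0 ≤ b)
    (hb : (⨆ x, ∫⁻ ω, ENNReal.ofReal ((R.muHat t ω x - R.μ x) ^ 2) ∂P) +
      (⨆ x, ∫⁻ ω, ENNReal.ofReal ((R.sigmaHat t ω x - R.σ x) ^ 2) ∂P) ≤ ENNReal.ofReal b) :
    ∫ ω, R.meanErr P K t ω ^ 2 ∂P ≤ K ^ 2 * (2 * b) := by
  have := h.prob_covLaw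
  have hm := h.measurable_err K ht
  have habs : ∀ ω x, |R.err K t ω x| ≤ 1 := fun ω x => by
    rw [abs_of_nonneg (R.err_mem hK t ω x).1]
    exact (R.err_mem hK t ω x).2
  have hi : Integrable (fun p : Ω × 𝒳 => R.err K t p.1 p.2 ^ 2) (P.prod (R.covLaw P)) :=
    integrable_of_abs_le (K := 1) (hm.pow_const 2) fun p => by
      rw [abs_pow]
      exact pow_le_one₀ (abs_nonneg _) (habs _ _)
  calc ∫ ω, R.meanErr P K t ω ^ 2 ∂P ≤ ∫ ω, ∫ x, R.err K t ω x ^ 2 ∂(R.covLaw P) ∂P := by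
        refine integral_mono_of_nonneg (ae_of_all _ fun ω => sq_nonneg _) hi.integral_prod_left
          (ae_of_all _ fun ω => ?_)
        exact sq_integral_le_integral_sq (hm.comp measurable_prodMk_left) (habs ω)
    _ = ∫ x, ∫ ω, R.err K t ω x ^ 2 ∂P ∂(R.covLaw P) := integral_integral_swap hi
    _ ≤ ∫ _, K ^ 2 * (2 * b) ∂(R.covLaw P) :=
        integral_mono hi.integral_prod_right (integrable_const _) fun x =>
          h.integral_err_sq_le hK ht hb0 hb x
    _ = _ := by simp

/-- The covariate `X_t` is independent of the past, so averaging over its law with the past frozen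
is conditioning. This connects `meanErr` with the assumption in probability, which is stated through
a conditional expectation. -/
theorem meanErr_ae_eq_condExp (h : R.Valid P) {K : ℝ} (hK : 0 ≤ K) {t : ℕ} (ht : 1 ≤ t) :
    R.meanErr P K t =ᵐ[P] P[fun ω => R.err K t ω (R.X t ω) | R.info (t - 1)] := by
  have := h.prob_covLaw
  have hm := h.measurable_err K ht
  have habs : ∀ ω x, |R.err K t ω x| ≤ 1 := fun ω x => by
    rw [abs_of_nonneg (R.err_mem hK t ω x).1]
    exact (R.err_mem hK t ω x).2
  have hXm := h.model.measurable_X t ht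
  have hi : Integrable (fun ω => R.err K t ω (R.X t ω)) P :=
    integrable_of_abs_le (K := 1) (hm.comp (measurable_id.prodMk hXm)) fun ω => habs _ _
  have hmi : Integrable (R.meanErr P K t) P :=
    integrable_of_abs_le (K := 1) (h.measurable_meanErr K ht) fun ω => by
      rw [abs_of_nonneg (h.meanErr_mem hK ht ω).1]
      exact (h.meanErr_mem hK ht ω).2
  refine ae_eq_condExp_of_forall_setIntegral_eq (h.info_le (t - 1)) hi
    (fun s _ _ => hmi.integrableOn) (fun s hs _ => ?_)
    (h.measurable_meanErr_info K ht).stronglyMeasurable.aestronglyMeasurable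
  have hs' : MeasurableSet s := h.info_le _ _ hs
  have hφ : Measurable[(R.info (t - 1)).prod inferInstance]
      fun p : Ω × 𝒳 => s.indicator (fun _ => (1 : ℝ)) p.1 * R.err K t p.1 p.2 :=
    Measurable.mul ((measurable_const.indicator hs).comp (@measurable_fst Ω 𝒳 (R.info (t - 1)) _))
      (R.measurable_err h.muHat h.sigmaHat h.model.measurable_mu h.model.measurable_sigma K ht)
  have hf := integral_prodMk_of_indep (K := 1) (h.info_le (t - 1)) hXm (h.model.indep_past_X ht)
    hφ fun p => by
      rw [abs_mul]
      refine mul_le_one₀ ?_ (abs_nonneg _) (habs _ _)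
      by_cases hp : p.1 ∈ s <;> simp [hp]
  rw [h.model.map_X ht] at hf
  rw [← integral_indicator hs', ← integral_indicator hs']
  have e1 : ∀ g : Ω → ℝ, s.indicator g = fun ω => s.indicator (fun _ => (1 : ℝ)) ω * g ω :=
    fun g => by
      ext ω
      by_cases hω : ω ∈ s <;> simp [hω]
  rw [e1 (R.meanErr P K t), e1 fun ω => R.err K t ω (R.X t ω)]
  refine Eq.trans ?_ hf.symm
  congr 1
  ext ω
  simp only
  rw [integral_const_mul]
  rfl

/-- Off the exceptional event the averaged error is at most `K θ`; on it, the truncation bounds it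
by 1. -/
theorem integral_meanErr_pow_le (h : R.Valid P) {K : ℝ} (hK : 0 ≤ K) {t : ℕ} (ht : 1 ≤ t) {b : ℝ}
    (hb : (⨆ x, ∫⁻ ω, ENNReal.ofReal ((R.muHat t ω x - R.μ x) ^ 2) ∂P) +
      (⨆ x, ∫⁻ ω, ENNReal.ofReal ((R.sigmaHat t ω x - R.σ x) ^ 2) ∂P) ≤ ENNReal.ofReal b)
    {θ : ℝ} (hθ : 0 ≤ θ) (m : ℕ) :
    ∫ ω, R.meanErr P K t ω ^ m ∂P ≤ (K * θ) ^ m +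
      P.real {ω | θ ≤ (P[fun ω' => |R.muHat t ω' (R.X t ω') - R.μ (R.X t ω')| +
        |R.sigmaHat t ω' (R.X t ω') - R.σ (R.X t ω')| | R.info (t - 1)]) ω} := by
  have := h.prob_covLaw
  set g : Ω → ℝ := fun ω' => |R.muHat t ω' (R.X t ω') - R.μ (R.X t ω')| +
        |R.sigmaHat t ω' (R.X t ω') - R.σ (R.X t ω')| with hg
  have hXm := h.model.measurable_X t ht
  have hμm := h.model.measurable_mu
  have hσm := h.model.measurable_sigma
  -- the estimation error is integrable
  have hem' : Measurable[(R.info (t - 1)).prod inferInstance] fun p : Ω × 𝒳 => ENNReal.ofReal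
      ((|R.muHat t p.1 p.2 - R.μ p.2| + |R.sigmaHat t p.1 p.2 - R.σ p.2|) ^ 2) :=
     R.measurable_sq_error h.muHat h.sigmaHat hμm hσm ht
  have hgm : Measurable g := by
    have h1 : Measurable fun ω => R.muHat t ω (R.X t ω) :=
      (h.measurable_muHat ht).comp (measurable_id.prodMk hXm)
    have h2 : Measurable fun ω => R.sigmaHat t ω (R.X t ω) :=
      (h.measurable_sigmaHat ht).comp (measurable_id.prodMk hXm)
    simp only [hg]
    fun_prop
  have hg0 : ∀ ω, 0 ≤ g ω := fun ω => by positivity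
  have hg2 : Integrable (fun ω => g ω ^ 2) P := by
    refine ⟨(hgm.pow_const 2).aestronglyMeasurable, ?_⟩
    rw [hasFiniteIntegral_iff_ofReal (ae_of_all _ fun ω => sq_nonneg _)]
    have e := lintegral_prodMk_of_indep (h.info_le (t - 1)) hXm (h.model.indep_past_X ht) hem'
    simp only [hg]
    rw [e, h.model.map_X ht, lintegral_lintegral_swap
      (hem'.mono (h.info_prod_le _) le_rfl).aemeasurable]
    refine lt_of_le_of_lt (lintegral_mono fun x => h.lintegral_err_sq_le ht hb x) ?_
    rw [lintegral_const]
    exact ENNReal.mul_lt_top ENNReal.ofReal_lt_top (measure_lt_top _ _)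
  -- Without integrability the conditional expectation would be zero by convention and would say
  -- nothing about the error; this is where the pointwise mean-square bound enters.
  have hgi : Integrable g P := by
    refine (hg2.add (integrable_const 1)).mono' hgm.aestronglyMeasurable (ae_of_all _ fun ω => ?_)
    rw [Real.norm_eq_abs, abs_of_nonneg (hg0 ω), Pi.add_apply]
    nlinarith [sq_nonneg (g ω - 1)]
  have hei : Integrable (fun ω => R.err K t ω (R.X t ω)) P :=
    integrable_of_abs_le (K := 1) ((h.measurable_err K ht).comp (measurable_id.prodMk hXm))
      fun ω => by
        rw [abs_of_nonneg (R.err_mem hK t ω _).1]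
        exact (R.err_mem hK t ω _).2
  have hae : ∀ᵐ ω ∂P, R.meanErr P K t ω ≤ K * (P[g | R.info (t - 1)]) ω := by
    have h1 : P[fun ω => R.err K t ω (R.X t ω) | R.info (t - 1)] ≤ᵐ[P]
        P[K • g | R.info (t - 1)] :=
      condExp_mono hei (hgi.smul K) (ae_of_all _ fun ω => min_le_right _ _)
    filter_upwards [h.meanErr_ae_eq_condExp hK ht, h1,
      condExp_smul (μ := P) K g (R.info (t - 1))] with ω h1 h2 h3
    rw [h1]
    refine h2.trans_eq ?_
    rw [h3]
    rfl
  set A := {ω | θ ≤ (P[g | R.info (t - 1)]) ω}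
  have hA : MeasurableSet A := by
    refine measurableSet_le measurable_const ?_
    exact (stronglyMeasurable_condExp.mono (h.info_le _)).measurable
  have hAi : Integrable (A.indicator fun _ => (1 : ℝ)) P := (integrable_const _).indicator hA
  calc ∫ ω, R.meanErr P K t ω ^ m ∂P
      ≤ ∫ ω, ((K * θ) ^ m + A.indicator (fun _ => (1 : ℝ)) ω) ∂P := by
        refine integral_mono_of_nonneg
          (ae_of_all _ fun ω => pow_nonneg (h.meanErr_mem hK ht ω).1 m)
          ((integrable_const _).add hAi) ?_
        filter_upwards [hae] with ω hω
        have h0 := (h.meanErr_mem hK ht ω).1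
        by_cases hωA : ω ∈ A
        · rw [Set.indicator_of_mem hωA]
          have h1 := pow_le_one₀ h0 (h.meanErr_mem hK ht ω).2 (n := m)
          have h2 : 0 ≤ (K * θ) ^ m := by positivity
          linarith
        · rw [Set.indicator_of_notMem hωA, add_zero]
          have h1 : (P[g | R.info (t - 1)]) ω < θ := not_le.1 hωA
          gcongr
          exact hω.trans (by gcongr)
    _ = _ := by
        rw [integral_add (integrable_const _) hAi, integral_indicator_const _ hA]
        simp

end Run.Valid

end OnlineSCI

end

noncomputable section

namespace OnlineSCI

namespace Run.Valid

variable {Ω 𝒳 : Type*} [mΩ : MeasurableSpace Ω] [MeasurableSpace 𝒳]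
  {R : Run Ω 𝒳} {P : Measure Ω} [IsProbabilityMeasure P]

/-! ### Convergence of the thresholds -/

theorem exists_moment_le (h : R.Valid P) {K : ℝ} (hK : 0 ≤ K)
    (herr : ∀ t, 1 ≤ t → ∀ ω x,
      |R.missAt (R.noiseLaw P) t ω x - idealMiss (R.noiseLaw P) R.B (R.level t ω)| ≤
        R.err K t ω x) {k : ℕ} (hk : 1 ≤ k) {e : ℕ → ℝ} (he : SlowlyDecaying R.β e) {Ce : ℝ}
    (hmean : ∀ᶠ t : ℕ in atTop, ∫ ω, R.meanErr P K t ω ^ (2 * k) ∂P ≤ Ce * e t) :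
    ∃ C > 0, ∀ᶠ t : ℕ in atTop,
      ∫ ω, (R.level t ω - R.qStar P) ^ (2 * k) ∂P ≤ C * (e t + (t : ℝ) ^ (-(R.β * k))) := by
  have := h.prob_noiseLaw
  obtain ⟨κ, hκ0, hκ⟩ := exists_drift h.unimodal h.B_pos h.zStar_pos h.f_zStar_pos h.tail_zStar
    h.c_pos.le
  have hr := h.selProb_pos
  obtain ⟨A, hA, C, hC, hrec⟩ := exists_moment_recursion (P := P)
    (d := fun t ω => R.level t ω - R.qStar P)
    (h := fun t ω => R.innovation t ω (R.X t ω) (R.ξ t ω)) (ε := R.meanErr P K) (J := R.count)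
    (c := R.c) (β := R.β) (ρ := R.selProb P * κ) (D := R.B + R.c) (r := R.selProb P / 4)
    h.c_pos h.β_pos (by positivity) (by positivity) hk
    (fun t _ => (h.measurable_level t).sub_const _)
    (fun t ht => (h.measurable_innovation ht).comp (measurable_id.prodMk
      ((h.model.measurable_X t ht).prodMk (h.model.measurable_noise t ht))))
    (fun t ht => h.measurable_meanErr K ht) (fun t _ => h.measurable_count t)
    (fun t ht ω => h.abs_level_sub_le ht ω)
    (fun t _ ω => R.abs_innovation_le h.α_mem t ω _ _)
    (fun t ht ω => h.meanErr_mem hK ht ω)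
    (fun t ht ω => ⟨R.one_le_count t ω, R.count_le ht ω⟩)
    (fun t ht ω => by rw [R.level_succ h.model.model ht]; ring)
    (fun t ht => h.drift hκ hK herr hk ht)
    h.eventually_count_lt_le
  have hslow := he.add (slowlyDecaying_rpow (β := R.β) (p := R.β * k) h.β_mem.2
    (mul_nonneg h.β_pos.le k.cast_nonneg))
  refine exists_le_mul_of_recursion (C := C * max 1 Ce) h.β_pos hA hslow ?_
  filter_upwards [hrec, hmean, he.1] with t h1 h2 h3
  refine h1.trans ?_
  have hx : 0 ≤ (t : ℝ) ^ (-R.β) := by positivity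
  have hy : 0 ≤ (t : ℝ) ^ (-(R.β * k)) := by positivity
  have h4 : ∫ ω, R.meanErr P K t ω ^ (2 * k) ∂P + (t : ℝ) ^ (-(R.β * k)) ≤
      max 1 Ce * (e t + (t : ℝ) ^ (-(R.β * k))) := by
    have h5 : Ce * e t ≤ max 1 Ce * e t := by gcongr; exact le_max_right _ _
    have h6 : 1 * (t : ℝ) ^ (-(R.β * k)) ≤ max 1 Ce * (t : ℝ) ^ (-(R.β * k)) := by
      gcongr
      exact le_max_left _ _
    linarith
  calc _ ≤ (1 - A * (t : ℝ) ^ (-R.β)) * ∫ ω, (R.level t ω - R.qStar P) ^ (2 * k) ∂P +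
        C * (t : ℝ) ^ (-R.β) * (max 1 Ce * (e t + (t : ℝ) ^ (-(R.β * k)))) := by gcongr
    _ = _ := by ring

/-- The second moment with the mean-square rate as forcing term, followed by a square root. -/
theorem exists_integral_abs_level_sub_le (h : R.Valid P) {K : ℝ} (hK : 0 ≤ K)
    (herr : ∀ t, 1 ≤ t → ∀ ω x,
      |R.missAt (R.noiseLaw P) t ω x - idealMiss (R.noiseLaw P) R.B (R.level t ω)| ≤
        R.err K t ω x) {C₁ τ₀ τ : ℝ} (hC₁ : 0 < C₁) (hτ₀ : 0 < τ₀) (hτ : 0 < τ)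
    (hpoint : ErrorPointwise P R.μ R.σ R.muHat R.sigmaHat C₁ τ₀ τ) :
    ∃ C > 0, ∀ᶠ t : ℕ in atTop, ∫ ω, |R.level t ω - R.qStar P| ∂P ≤
      C * (Real.log t ^ τ₀ * (t : ℝ) ^ (-τ) + (t : ℝ) ^ (-(R.β / 2))) := by
  obtain ⟨C, hC, hle⟩ := h.exists_moment_le hK herr le_rfl
    (slowlyDecaying_rpow_log (β := R.β) (p := 2 * τ) (s := 2 * τ₀) h.β_mem.2 (by positivity)
      (by positivity)) (Ce := K ^ 2 * (2 * C₁)) (by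
    filter_upwards [hpoint, eventually_ge_atTop 1] with t hb ht
    have hlog : 0 ≤ Real.log t := Real.log_natCast_nonneg t
    refine (h.integral_meanErr_sq_le hK ht (by positivity) hb).trans_eq ?_
    ring)
  refine ⟨√C, Real.sqrt_pos.2 hC, ?_⟩
  filter_upwards [hle, eventually_ge_atTop 1] with t h1 ht
  have ht0 : (0 : ℝ) < t := by exact_mod_cast ht
  have hlog : 0 ≤ Real.log t := Real.log_natCast_nonneg t
  set x := Real.log t ^ τ₀ * (t : ℝ) ^ (-τ)
  set y := (t : ℝ) ^ (-(R.β / 2))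
  have hx : 0 ≤ x := by positivity
  have hy : 0 ≤ y := by positivity
  have hx2 : Real.log t ^ (2 * τ₀) * (t : ℝ) ^ (-(2 * τ)) = x ^ 2 := by
    rw [mul_pow, ← Real.rpow_mul_natCast hlog, ← Real.rpow_mul_natCast ht0.le]
    congr 2 <;> push_cast <;> ring
  have hy2 : (t : ℝ) ^ (-(R.β * (1 : ℕ))) = y ^ 2 := by
    rw [← Real.rpow_mul_natCast ht0.le]
    congr 1
    push_cast
    ring
  rw [hx2, hy2] at h1
  refine le_of_sq_le_sq ?_ (by positivity)
  refine (sq_integral_le_integral_sq ((h.measurable_level t).sub_const _).abs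
    (fun ω => by rw [abs_abs]; exact h.abs_level_sub_le ht ω)).trans ?_
  simp only [sq_abs]
  rw [mul_pow, Real.sq_sqrt hC.le]
  refine h1.trans ?_
  gcongr
  nlinarith

/-- Markov's inequality for a high even moment. The second moment would not give `1/t`, as `t^{-2τ}`
and `t^{-β}` may both be larger. -/
theorem eventually_measureReal_level_le (h : R.Valid P) {K : ℝ} (hK : 0 ≤ K)
    (herr : ∀ t, 1 ≤ t → ∀ ω x,
      |R.missAt (R.noiseLaw P) t ω x - idealMiss (R.noiseLaw P) R.B (R.level t ω)| ≤
        R.err K t ω x) {C₁ ν₀ ν τ₀ τ : ℝ} (hC₁ : 0 < C₁) (hν₀ : 0 < ν₀) (hν : 0 < ν)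
    (hprob : ErrorInProbability P R.info R.X R.μ R.σ R.muHat R.sigmaHat C₁ ν₀ ν)
    (hpoint : ErrorPointwise P R.μ R.σ R.muHat R.sigmaHat C₁ τ₀ τ) {δ : ℝ} (hδ : 0 < δ) :
    ∀ᶠ t : ℕ in atTop, P.real {ω | δ < |R.level t ω - R.qStar P|} ≤ 1 / t := by
  -- `k ≥ 3` gives `β k > 1` because `β > 1/2`, and `k ν ≥ 1` gives `2 k ν > 1`, so both terms of
  -- the moment bound are eventually below any multiple of `1/t`.
  obtain ⟨k, hk3, hkν⟩ : ∃ k : ℕ, 3 ≤ k ∧ 1 ≤ k * ν := by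
    obtain ⟨m, hm⟩ := exists_nat_ge (1 / ν)
    refine ⟨max 3 m, le_max_left _ _, ?_⟩
    rw [div_le_iff₀ hν] at hm
    refine hm.trans ?_
    gcongr
    exact le_max_right _ _
  have hk1 : 1 ≤ k := by omega
  have hkR : (3 : ℝ) ≤ k := by exact_mod_cast hk3
  obtain ⟨C, hC, hle⟩ := h.exists_moment_le hK herr hk1
    ((slowlyDecaying_rpow_log (β := R.β) (p := 2 * k * ν) (s := 2 * k * ν₀) h.β_mem.2
      (by positivity) (by positivity)).add (slowlyDecaying_rpow (p := 3) h.β_mem.2 (by norm_num)))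
    (Ce := max 1 ((K * C₁) ^ (2 * k))) (by
    filter_upwards [hpoint, hprob, eventually_ge_atTop 1] with t hb hp ht
    have ht0 : (0 : ℝ) < t := by exact_mod_cast ht
    have hlog : 0 ≤ Real.log t := Real.log_natCast_nonneg t
    have hθ : 0 ≤ C₁ * Real.log t ^ ν₀ * (t : ℝ) ^ (-ν) := by positivity
    refine (h.integral_meanErr_pow_le hK ht hb hθ (2 * k)).trans ?_
    have e1 : (K * (C₁ * Real.log t ^ ν₀ * (t : ℝ) ^ (-ν))) ^ (2 * k) =
        (K * C₁) ^ (2 * k) * (Real.log t ^ (2 * k * ν₀) * (t : ℝ) ^ (-(2 * k * ν))) := by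
      rw [show K * (C₁ * Real.log t ^ ν₀ * (t : ℝ) ^ (-ν)) =
        (K * C₁) * (Real.log t ^ ν₀ * (t : ℝ) ^ (-ν)) by ring, mul_pow, mul_pow (_ ^ _) (_ ^ _),
        ← Real.rpow_mul_natCast hlog, ← Real.rpow_mul_natCast ht0.le]
      congr 3 <;> push_cast <;> ring
    -- Holds because `π² > 3`.
    have e2 : 3 / (Real.pi ^ 2 * (t : ℝ) ^ 3) ≤ (t : ℝ) ^ (-3 : ℝ) := by
      rw [Real.rpow_neg ht0.le, show (3 : ℝ) = (3 : ℕ) by norm_num, Real.rpow_natCast,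
        div_le_iff₀ (by positivity)]
      have := Real.pi_gt_three
      have h3 : ((t : ℝ) ^ 3)⁻¹ * (Real.pi ^ 2 * (t : ℝ) ^ 3) = Real.pi ^ 2 := by field_simp
      rw [h3]
      push_cast
      nlinarith
    rw [e1, mul_add]
    refine add_le_add ?_ ((hp.trans e2).trans ?_)
    · gcongr
      exact le_max_right _ _
    · have : 0 ≤ (t : ℝ) ^ (-3 : ℝ) := by positivity
      nlinarith [le_max_left 1 ((K * C₁) ^ (2 * k))])
  have hβ : 1 < R.β * k := by nlinarith [h.β_mem.1]
  have hδk : 0 < δ ^ (2 * k) := by positivity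
  -- The factor 3 gives each of the three terms a third of `1/t`.
  filter_upwards [hle, eventually_log_rpow_mul_le (p := 1) (p' := 2 * k * ν) (by linarith)
    (3 * (C / δ ^ (2 * k))) (2 * k * ν₀),
    eventually_log_rpow_mul_le (p := 1) (p' := 3) (by norm_num)
    (3 * (C / δ ^ (2 * k))) 0, eventually_log_rpow_mul_le (p := 1) (p' := R.β * k) hβ
    (3 * (C / δ ^ (2 * k))) 0, eventually_ge_atTop 1] with t h1 h2 h3 h4 ht
  have ht0 : (0 : ℝ) < t := by exact_mod_cast ht
  rw [Real.rpow_zero, one_mul] at h3 h4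
  have hm : Measurable fun ω => (R.level t ω - R.qStar P) ^ (2 * k) :=
    ((h.measurable_level t).sub_const _).pow_const _
  have hi : Integrable (fun ω => (R.level t ω - R.qStar P) ^ (2 * k)) P :=
    integrable_of_abs_le (K := (R.B + R.c) ^ (2 * k)) hm fun ω => by
      rw [abs_pow]
      have := h.abs_level_sub_le ht ω
      gcongr
  have hmk := mul_meas_ge_le_integral_of_nonneg
    (ae_of_all P fun ω => (even_two_mul k).pow_nonneg (R.level t ω - R.qStar P)) hi (δ ^ (2 * k))
  have hsub : P.real {ω | δ < |R.level t ω - R.qStar P|} ≤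
      P.real {ω | δ ^ (2 * k) ≤ (R.level t ω - R.qStar P) ^ (2 * k)} := by
    refine measureReal_mono fun ω hω => ?_
    simp only [Set.mem_ofPred_eq] at hω ⊢
    rw [← (even_two_mul k).pow_abs (R.level t ω - R.qStar P)]
    gcongr
  have h5 : P.real {ω | δ < |R.level t ω - R.qStar P|} ≤
      C / δ ^ (2 * k) * (Real.log t ^ (2 * k * ν₀) * (t : ℝ) ^ (-(2 * k * ν)) +
        (t : ℝ) ^ (-(3 : ℝ)) + (t : ℝ) ^ (-(R.β * k))) := by
    rw [div_mul_eq_mul_div, le_div_iff₀ hδk, mul_comm]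
    exact ((mul_le_mul_of_nonneg_left hsub hδk.le).trans hmk).trans h1
  rw [Real.rpow_neg_one, inv_eq_one_div] at h2 h3 h4
  linarith

/-! ### Coverage of set rules -/

theorem measurableSet_mem (h : R.Valid P) {C : ℕ → Ω → 𝒳 → Set ℝ}
    (hC : IsSetRule R.info C) {t : ℕ} (ht : 1 ≤ t) :
    MeasurableSet {p : Ω × 𝒳 × ℝ | p.2.2 ∈ C t p.1 p.2.1} :=
  h.info_prod_le _ _ (hC t ht)

end Run.Valid

theorem Run.measurable_indicator_mem {Ω 𝒳 : Type*} [MeasurableSpace 𝒳] (R : Run Ω 𝒳)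
    {C : ℕ → Ω → 𝒳 → Set ℝ} (hC : IsSetRule R.info C) {t : ℕ} (ht : 1 ≤ t) (x : 𝒳) :
    Measurable[(R.info (t - 1)).prod inferInstance]
      ({p : Ω × ℝ | R.μ x + R.σ x * p.2 ∈ C t p.1 x}.indicator fun _ => (1 : ENNReal)) := by
  let _ : MeasurableSpace Ω := R.info (t - 1)
  have hm : Measurable fun p : Ω × ℝ => (p.1, x, R.μ x + R.σ x * p.2) := by fun_prop
  exact measurable_const.indicator (hm (hC t ht))

namespace Run.Valid

variable {Ω 𝒳 : Type*} [mΩ : MeasurableSpace Ω] [MeasurableSpace 𝒳]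
  {R : Run Ω 𝒳} {P : Measure Ω} [IsProbabilityMeasure P]

theorem measurableSet_preimage_mem (h : R.Valid P) {C : ℕ → Ω → 𝒳 → Set ℝ}
    (hC : IsSetRule R.info C) {t : ℕ} (ht : 1 ≤ t) (x : 𝒳) :
    MeasurableSet {p : Ω × ℝ | R.μ x + R.σ x * p.2 ∈ C t p.1 x} := by
  have hm : Measurable fun p : Ω × ℝ => (p.1, x, R.μ x + R.σ x * p.2) := by fun_prop
  exact hm (h.measurableSet_mem hC ht)

theorem measure_mem_eq_lintegral (h : R.Valid P) {C : ℕ → Ω → 𝒳 → Set ℝ}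
    (hC : IsSetRule R.info C) {t : ℕ} (ht : 1 ≤ t) (x : 𝒳) :
    P {ω | R.μ x + R.σ x * R.ξ t ω ∈ C t ω x} =
      ∫⁻ ω, R.noiseLaw P {z | R.μ x + R.σ x * z ∈ C t ω x} ∂P := by
  have hE := h.measurableSet_preimage_mem hC ht x
  have hξ := h.model.measurable_noise t ht
  have hf := lintegral_prodMk_of_indep (h.info_le (t - 1)) hξ (h.model.indep_past_noise ht)
    (R.measurable_indicator_mem hC ht x)
  rw [h.model.map_noise ht] at hf
  have e1 : ∀ ω, R.noiseLaw P {z | R.μ x + R.σ x * z ∈ C t ω x} = ∫⁻ z,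
      {p : Ω × ℝ | R.μ x + R.σ x * p.2 ∈ C t p.1 x}.indicator (fun _ => (1 : ENNReal)) (ω, z)
        ∂(R.noiseLaw P) := fun ω =>
    (lintegral_indicator_one (measurable_prodMk_left hE)).symm
  have e2 : P {ω | R.μ x + R.σ x * R.ξ t ω ∈ C t ω x} = ∫⁻ ω,
      {p : Ω × ℝ | R.μ x + R.σ x * p.2 ∈ C t p.1 x}.indicator (fun _ => (1 : ENNReal))
        (ω, R.ξ t ω) ∂P :=
    (lintegral_indicator_one ((measurable_id.prodMk hξ) hE)).symm
  rw [e2, hf]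
  simp only [e1]
  rfl

theorem condCoverage_eq_integral (h : R.Valid P) {C : ℕ → Ω → 𝒳 → Set ℝ}
    (hC : IsSetRule R.info C) {t : ℕ} (ht : 1 ≤ t) (x : 𝒳) :
    condCoverage P R.ξ R.μ R.σ C t x =
      ∫ ω, (R.noiseLaw P).real {z | R.μ x + R.σ x * z ∈ C t ω x} ∂P := by
  have := h.prob_noiseLaw
  rw [condCoverage, Measure.real, h.measure_mem_eq_lintegral hC ht x, ← integral_toReal]
  · rfl
  · exact (measurable_measure_prodMk_left (h.measurableSet_preimage_mem hC ht x)).aemeasurable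
  · exact ae_of_all _ fun ω => measure_lt_top _ _

/-- Given the past, the miscoverage at `x` is at most the ideal one at the current level plus the
error at `x`, and the ideal one exceeds `α` by at most `L |q_t - qStar|`. Integrating gives the
bound. -/
theorem le_condCoverage (h : R.Valid P) {K : ℝ} (hK : 0 ≤ K)
    (herr : ∀ t, 1 ≤ t → ∀ ω x,
      |R.missAt (R.noiseLaw P) t ω x - idealMiss (R.noiseLaw P) R.B (R.level t ω)| ≤
        R.err K t ω x) {L : ℝ}
    (hL : ∀ q, idealMiss (R.noiseLaw P) R.B q ≤ R.α + L * |q - R.qStar P|) {t : ℕ} (ht : 1 ≤ t)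
    (x : 𝒳) :
    1 - R.α - L * ∫ ω, |R.level t ω - R.qStar P| ∂P - ∫ ω, R.err K t ω x ∂P ≤
      condCoverage P R.ξ R.μ R.σ (fun t ω x =>
        interval R.B (R.muHat t ω x) (R.sigmaHat t ω x) (R.level t ω)) t x := by
  have := h.prob_noiseLaw
  have hC := R.isSetRule_interval h.muHat h.sigmaHat h.measurable_S
  have hdm : Measurable fun ω => |R.level t ω - R.qStar P| :=
    ((h.measurable_level t).sub_const _).abs
  have hdi : Integrable (fun ω => |R.level t ω - R.qStar P|) P :=
    integrable_of_abs_le (K := R.B + R.c) hdm fun ω => by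
      rw [abs_abs]
      exact h.abs_level_sub_le ht ω
  have hei : Integrable (fun ω => R.err K t ω x) P :=
    integrable_of_abs_le (K := 1) ((h.measurable_err K ht).comp measurable_prodMk_right)
      fun ω => by
        rw [abs_of_nonneg (R.err_mem hK t ω x).1]
        exact (R.err_mem hK t ω x).2
  rw [h.condCoverage_eq_integral hC ht x]
  have e : ∫ ω, ((1 - R.α - L * |R.level t ω - R.qStar P|) - R.err K t ω x) ∂P =
      1 - R.α - L * ∫ ω, |R.level t ω - R.qStar P| ∂P - ∫ ω, R.err K t ω x ∂P := by
    have hi : Integrable (fun ω => 1 - R.α - L * |R.level t ω - R.qStar P|) P :=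
      (integrable_const _).sub (hdi.const_mul L)
    rw [integral_sub hi hei, integral_sub (integrable_const _) (hdi.const_mul L),
      integral_const_mul]
    simp
  rw [← e]
  refine integral_mono (((integrable_const _).sub (hdi.const_mul L)).sub hei) ?_ fun ω => ?_
  · refine integrable_of_abs_le (K := 1) ?_ fun ω => ?_
    · exact (measurable_measure_prodMk_left
        (h.measurableSet_preimage_mem hC ht x)).ennreal_toReal
    · rw [abs_of_nonneg measureReal_nonneg]
      exact measureReal_le_one
  · have hset : MeasurableSet {z | R.μ x + R.σ x * z ∈
        interval R.B (R.muHat t ω x) (R.sigmaHat t ω x) (R.level t ω)} :=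
      (measurableSet_interval _ _ _ _).preimage (by fun_prop)
    have h1 : R.missAt (R.noiseLaw P) t ω x = 1 - (R.noiseLaw P).real {z | R.μ x + R.σ x * z ∈
        interval R.B (R.muHat t ω x) (R.sigmaHat t ω x) (R.level t ω)} := by
      rw [← probReal_compl_eq_one_sub hset]
      rfl
    have h2 := (abs_le.1 (herr t ht ω x)).2
    have h3 := hL (R.level t ω)
    simp only
    linarith

theorem integral_err_le (h : R.Valid P) {K : ℝ} (hK : 0 ≤ K) {t : ℕ} (ht : 1 ≤ t) {b : ℝ}
    (hb0 : 0 ≤ b)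
    (hb : (⨆ x, ∫⁻ ω, ENNReal.ofReal ((R.muHat t ω x - R.μ x) ^ 2) ∂P) +
      (⨆ x, ∫⁻ ω, ENNReal.ofReal ((R.sigmaHat t ω x - R.σ x) ^ 2) ∂P) ≤ ENNReal.ofReal (b ^ 2))
    (x : 𝒳) : ∫ ω, R.err K t ω x ∂P ≤ 2 * K * b := by
  refine le_of_sq_le_sq ?_ (by positivity)
  refine (sq_integral_le_integral_sq (K := 1)
    ((h.measurable_err K ht).comp measurable_prodMk_right) fun ω => ?_).trans ?_
  · change |R.err K t ω x| ≤ 1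
    rw [abs_of_nonneg (R.err_mem hK t ω x).1]
    exact (R.err_mem hK t ω x).2
  · refine (h.integral_err_sq_le hK ht (sq_nonneg b) hb x).trans ?_
    nlinarith [sq_nonneg (K * b)]

/-! ### Length -/

/-- The inequality `|g| ≤ g² / (2s) + s / 2` stands in for Cauchy–Schwarz and requires no
measurability of `g`. -/
theorem lintegral_abs_le_of_sq {g : Ω → ℝ} {s : ℝ} (hs : 0 < s)
    (h2 : ∫⁻ ω, ENNReal.ofReal (g ω ^ 2) ∂P ≤ ENNReal.ofReal (s ^ 2)) :
    ∫⁻ ω, ENNReal.ofReal |g ω| ∂P ≤ ENNReal.ofReal s := by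
  calc ∫⁻ ω, ENNReal.ofReal |g ω| ∂P
      ≤ ∫⁻ ω, (ENNReal.ofReal (1 / (2 * s)) * ENNReal.ofReal (g ω ^ 2) + ENNReal.ofReal (s / 2))
          ∂P := by
        refine lintegral_mono fun ω => ?_
        rw [← ENNReal.ofReal_mul (by positivity), ← ENNReal.ofReal_add (by positivity)
          (by positivity)]
        refine ENNReal.ofReal_le_ofReal ?_
        have h3 : 1 / (2 * s) * g ω ^ 2 + s / 2 = (|g ω| ^ 2 + s ^ 2) / (2 * s) := by
          rw [sq_abs]
          field_simp
        rw [h3, le_div_iff₀ (by positivity)]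
        nlinarith [sq_nonneg (|g ω| - s)]
    _ = ENNReal.ofReal (1 / (2 * s)) * ∫⁻ ω, ENNReal.ofReal (g ω ^ 2) ∂P +
          ENNReal.ofReal (s / 2) := by
        rw [lintegral_add_right _ measurable_const, lintegral_const_mul' _ _ ENNReal.ofReal_ne_top]
        simp
    _ ≤ ENNReal.ofReal (1 / (2 * s)) * ENNReal.ofReal (s ^ 2) + ENNReal.ofReal (s / 2) := by gcongr
    _ = ENNReal.ofReal s := by
        rw [← ENNReal.ofReal_mul (by positivity), ← ENNReal.ofReal_add (by positivity)
          (by positivity)]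
        congr 1
        field_simp
        ring

/-- The Neyman–Pearson comparison is applied for each frozen past and then averaged. It is linear in
the probability, so only the averaged coverage matters. -/
theorem volume_oracleSet_le (h : R.Valid P) {C : ℕ → Ω → 𝒳 → Set ℝ}
    (hC : IsSetRule R.info C) {t : ℕ} (ht : 1 ≤ t) (x : 𝒳) {η : ℝ}
    (hcov : 1 - R.α - η ≤ condCoverage P R.ξ R.μ R.σ C t x) :
    volume (oracleSet P (R.ξ 1) R.μ R.σ R.α x) ≤
      ∫⁻ ω, volume (C t ω x) ∂P + ENNReal.ofReal (R.σ x / R.f (R.zStar P) * η) := by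
  have := h.prob_noiseLaw
  have hσ := h.noise.sigma_pos x
  have hf := h.f_zStar_pos
  have hz := h.zStar_pos
  set k := ENNReal.ofReal (R.σ x / R.f (R.zStar P))
  have horacle : oracleSet P (R.ξ 1) R.μ R.σ R.α x = Set.Icc (R.μ x - R.σ x * R.zStar P)
      (R.μ x + R.σ x * R.zStar P) := by
    rw [oracleSet, tailQuantile_eq P (h.model.measurable_noise 1 le_rfl)]
    rfl
  have hIcc : R.noiseLaw P (Set.Icc (-R.zStar P) (R.zStar P)) = ENNReal.ofReal (1 - R.α) := by
    rw [← ofReal_measureReal, h.unimodal.real_Icc (by linarith), h.unimodal.tail_neg,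
      h.tail_zStar]
    congr 1
    ring
  have hCm : ∀ ω, MeasurableSet (C t ω x) := fun ω => by
    have hm : Measurable fun y : ℝ => (ω, x, y) := by fun_prop
    exact hm (h.measurableSet_mem hC ht)
  have hvm : Measurable fun ω => R.noiseLaw P {z | R.μ x + R.σ x * z ∈ C t ω x} :=
    measurable_measure_prodMk_left (h.measurableSet_preimage_mem hC ht x)
  have key : volume (oracleSet P (R.ξ 1) R.μ R.σ R.α x) +
      k * P {ω | R.μ x + R.σ x * R.ξ t ω ∈ C t ω x} ≤
      ∫⁻ ω, volume (C t ω x) ∂P + k * ENNReal.ofReal (1 - R.α) := by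
    calc _ = ∫⁻ ω, (volume (oracleSet P (R.ξ 1) R.μ R.σ R.α x) +
            k * R.noiseLaw P {z | R.μ x + R.σ x * z ∈ C t ω x}) ∂P := by
          rw [lintegral_add_left measurable_const, lintegral_const_mul' _ _ ENNReal.ofReal_ne_top,
            h.measure_mem_eq_lintegral hC ht x]
          simp [k]
      _ ≤ ∫⁻ ω, (volume (C t ω x) + k * ENNReal.ofReal (1 - R.α)) ∂P := by
          refine lintegral_mono fun ω => ?_
          rw [horacle, ← hIcc]
          exact h.unimodal.volume_oracle_add_le hz.le hf (R.μ x) hσ (hCm ω)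
      _ = _ := by
          rw [lintegral_add_right _ measurable_const]
          simp
  have hcov' : ENNReal.ofReal (1 - R.α - η) ≤ P {ω | R.μ x + R.σ x * R.ξ t ω ∈ C t ω x} := by
    rw [← ofReal_measureReal]
    exact ENNReal.ofReal_le_ofReal hcov
  -- Valid for either sign of `1 - α - η`.
  have hsplit : ENNReal.ofReal (1 - R.α) ≤ ENNReal.ofReal (1 - R.α - η) + ENNReal.ofReal η := by
    refine le_trans (le_of_eq ?_) ENNReal.ofReal_add_le
    congr 1
    ring
  have hfin : k * ENNReal.ofReal (1 - R.α - η) ≠ ⊤ :=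
    ENNReal.mul_ne_top ENNReal.ofReal_ne_top ENNReal.ofReal_ne_top
  rw [ENNReal.ofReal_mul (by positivity)]
  -- The finite coverage term is added to both sides instead of being subtracted; the expected
  -- volume may be infinite.
  refine (ENNReal.add_le_add_iff_right hfin).1 ?_
  calc _ ≤ volume (oracleSet P (R.ξ 1) R.μ R.σ R.α x) +
        k * P {ω | R.μ x + R.σ x * R.ξ t ω ∈ C t ω x} := by gcongr
    _ ≤ ∫⁻ ω, volume (C t ω x) ∂P + k * ENNReal.ofReal (1 - R.α) := key
    _ ≤ ∫⁻ ω, volume (C t ω x) ∂P +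
        k * (ENNReal.ofReal (1 - R.α - η) + ENNReal.ofReal η) := by gcongr
    _ = _ := by ring

/-- Within `δ` of `qStar`, the length `2 σ̂ r` exceeds `2 σ zStar` by at most `2 ζ |σ̂ - σ| + 2 s L
|q_t - qStar|`, as `r ≤ ζ` and `r` is Lipschitz in the level. Elsewhere the truncation `M` is used.
-/
theorem lintegral_min_volume_le (h : R.Valid P) {ζ L δ s : ℝ} (hζ : 0 ≤ ζ) (hL0 : 0 ≤ L)
    (hL : ∀ q ≤ R.qStar P + δ,
      radius R.B q ≤ ζ ∧ radius R.B q ≤ R.zStar P + L * |q - R.qStar P|)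
    (hδ : R.qStar P + δ < R.B) (hs : ∀ x, R.σ x ≤ s) {t : ℕ} (ht : 1 ≤ t) {b : ℝ} (hb0 : 0 < b)
    (x : 𝒳) (hb : ∫⁻ ω, ENNReal.ofReal ((R.sigmaHat t ω x - R.σ x) ^ 2) ∂P ≤
      ENNReal.ofReal (b ^ 2)) {p : ℝ} (hp : P.real {ω | δ < |R.level t ω - R.qStar P|} ≤ p)
    {M : ℝ} (hM : 0 < M) :
    ∫⁻ ω, min (volume (interval R.B (R.muHat t ω x) (R.sigmaHat t ω x) (R.level t ω)))
        (ENNReal.ofReal M) ∂P ≤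
      volume (oracleSet P (R.ξ 1) R.μ R.σ R.α x) + ENNReal.ofReal
        (2 * ζ * b + 2 * s * L * ∫ ω, |R.level t ω - R.qStar P| ∂P + M * p) := by
  have hσ := h.noise.sigma_pos x
  have hs0 : 0 < s := hσ.trans_le (hs x)
  have hz := h.zStar_pos
  have hp0 : 0 ≤ p := measureReal_nonneg.trans hp
  have hqm := h.measurable_level t
  have hdm : Measurable fun ω => |R.level t ω - R.qStar P| := (hqm.sub_const _).abs
  have hsm : Measurable fun ω => R.sigmaHat t ω x :=
    (h.measurable_sigmaHat ht).comp measurable_prodMk_right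
  have hdi : Integrable (fun ω => |R.level t ω - R.qStar P|) P :=
    integrable_of_abs_le (K := R.B + R.c) hdm fun ω => by
      rw [abs_abs]
      exact h.abs_level_sub_le ht ω
  have hd0 : 0 ≤ ∫ ω, |R.level t ω - R.qStar P| ∂P := integral_nonneg fun ω => abs_nonneg _
  set A := {ω | δ < |R.level t ω - R.qStar P|}
  have hA : MeasurableSet A := measurableSet_lt measurable_const hdm
  have horacle : volume (oracleSet P (R.ξ 1) R.μ R.σ R.α x) =
      ENNReal.ofReal (2 * R.σ x * R.zStar P) := by
    rw [volume_oracleSet, tailQuantile_eq P (h.model.measurable_noise 1 le_rfl)]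
    rfl
  calc _ ≤ ∫⁻ ω, (ENNReal.ofReal (2 * R.σ x * R.zStar P) +
          (ENNReal.ofReal (2 * ζ) * ENNReal.ofReal |R.sigmaHat t ω x - R.σ x| +
          (ENNReal.ofReal (2 * s * L) * ENNReal.ofReal |R.level t ω - R.qStar P| +
            A.indicator (fun _ => ENNReal.ofReal M) ω))) ∂P := by
        refine lintegral_mono fun ω => ?_
        by_cases hω : ω ∈ A
        · rw [Set.indicator_of_mem hω]
          refine (min_le_right _ _).trans ?_
          rw [← add_assoc, ← add_assoc]
          exact le_add_self
        · rw [Set.indicator_of_notMem hω, add_zero]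
          refine (min_le_left _ _).trans ?_
          have hd : |R.level t ω - R.qStar P| ≤ δ := not_lt.1 hω
          have hq : R.level t ω ≤ R.qStar P + δ := by linarith [(abs_le.1 hd).2]
          rw [volume_interval (hq.trans_lt hδ), ← ENNReal.ofReal_mul (by positivity),
            ← ENNReal.ofReal_mul (by positivity), ← ENNReal.ofReal_add (by positivity)
              (by positivity), ← ENNReal.ofReal_add (by positivity) (by positivity)]
          refine ENNReal.ofReal_le_ofReal ?_
          obtain ⟨h1, h2⟩ := hL _ hq
          have h0 := radius_nonneg (hq.trans_lt hδ)
          set r := radius R.B (R.level t ω)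
          have h3 : (R.sigmaHat t ω x - R.σ x) * r ≤ |R.sigmaHat t ω x - R.σ x| * ζ :=
            mul_le_mul (le_abs_self _) h1 h0 (abs_nonneg _)
          have h4 : R.σ x * r ≤ R.σ x * (R.zStar P + L * |R.level t ω - R.qStar P|) := by gcongr
          have h5 : R.σ x * (L * |R.level t ω - R.qStar P|) ≤
              s * (L * |R.level t ω - R.qStar P|) := by
            gcongr
            exact hs x
          linarith
    _ = ENNReal.ofReal (2 * R.σ x * R.zStar P) +
          (ENNReal.ofReal (2 * ζ) * ∫⁻ ω, ENNReal.ofReal |R.sigmaHat t ω x - R.σ x| ∂P +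
          (ENNReal.ofReal (2 * s * L) * ∫⁻ ω, ENNReal.ofReal |R.level t ω - R.qStar P| ∂P +
            ENNReal.ofReal M * P A)) := by
        rw [lintegral_add_left measurable_const, lintegral_add_left (by fun_prop),
          lintegral_add_left (by fun_prop), lintegral_const_mul' _ _ ENNReal.ofReal_ne_top,
          lintegral_const_mul' _ _ ENNReal.ofReal_ne_top, lintegral_indicator_const hA]
        simp
    _ ≤ ENNReal.ofReal (2 * R.σ x * R.zStar P) +
          (ENNReal.ofReal (2 * ζ) * ENNReal.ofReal b +
          (ENNReal.ofReal (2 * s * L) * ENNReal.ofReal (∫ ω, |R.level t ω - R.qStar P| ∂P) +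
            ENNReal.ofReal M * ENNReal.ofReal p)) := by
        gcongr
        · exact lintegral_abs_le_of_sq hb0 hb
        · rw [ofReal_integral_eq_lintegral_ofReal hdi (ae_of_all _ fun ω => abs_nonneg _)]
        · rw [← ofReal_measureReal]
          exact ENNReal.ofReal_le_ofReal hp
    _ = _ := by
        rw [horacle, ← ENNReal.ofReal_mul (by positivity), ← ENNReal.ofReal_mul (by positivity),
          ← ENNReal.ofReal_mul (by positivity), ← ENNReal.ofReal_add (by positivity)
            (by positivity), ← ENNReal.ofReal_add (by positivity) (by positivity), add_assoc]

end Run.Valid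

end OnlineSCI

end

/-! ### Assembly: coverage, length and domination. -/

theorem mainTheorem6
    {Ω 𝒳 : Type*} [MeasurableSpace Ω] [MeasurableSpace 𝒳]
    (P : Measure Ω) [IsProbabilityMeasure P]
    -- the iid regression model and its holdout sample
    (n : ℕ) (D₀ : Ω → Fin n → 𝒳 × ℝ) (X : ℕ → Ω → 𝒳) (ξ Y : ℕ → Ω → ℝ) (μ σ : 𝒳 → ℝ) (f : ℝ → ℝ)
    (hmodel : OnlineSCI.IIDRegression P D₀ X ξ Y μ σ)
    (hnoise : OnlineSCI.NoiseRegular P (ξ 1) f σ)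
    (hdecr : OnlineSCI.DecreasingDensity f σ)
    -- the time-constant selection
    (S : 𝒳 → Bool) (hS : Measurable S) (hr : 0 < P {ω | S (X 1 ω) = true})
    -- the parameters of the procedure
    (α B c β q₁ : ℝ) (hα : α ∈ Set.Ioo (0 : ℝ) 1) (hB : 0 < B) (hc : 0 < c)
    (hβ : β ∈ Set.Ioo (1 / 2 : ℝ) 1) (hq₁ : q₁ ∈ Set.Icc 0 B)
    -- the estimators
    (muHat sigmaHat : ℕ → Ω → 𝒳 → ℝ)
    (hmuHat : OnlineSCI.IsEstimator (OnlineSCI.past D₀ X Y) muHat)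
    (hsigmaHat : OnlineSCI.IsEstimator (OnlineSCI.past D₀ X Y) sigmaHat)
    (hsigmaHat_nonneg : ∀ t, 1 ≤ t → ∀ ω x, 0 ≤ sigmaHat t ω x)
    (C₁ ν₀ ν τ₀ τ : ℝ) (hC₁ : 0 < C₁) (hν₀ : 0 < ν₀) (hν : ν ∈ Set.Ioc (0 : ℝ) (1 / 2))
    (hτ₀ : 0 < τ₀) (hτ : τ ∈ Set.Ioc (0 : ℝ) (1 / 2))
    (hprob : OnlineSCI.ErrorInProbability P (OnlineSCI.past D₀ X Y) X μ σ muHat sigmaHat C₁ ν₀ ν)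
    (hpoint : OnlineSCI.ErrorPointwise P μ σ muHat sigmaHat C₁ τ₀ τ) :
    -- (i) approximate conditional coverage
    (∃ C₀ : ℝ, 0 < C₀ ∧ ∃ T₀ : ℕ, 1 ≤ T₀ ∧ ∀ t : ℕ, T₀ ≤ t → ∀ x : 𝒳,
      1 - α - C₀ * (OnlineSCI.rho β t + Real.log t ^ τ₀ * (t : ℝ) ^ (-τ)
          + Real.log t ^ ν₀ * (t : ℝ) ^ (-ν)) ≤
        OnlineSCI.condCoverage P ξ μ σ
          (OnlineSCI.sciSet α B q₁ c β S muHat sigmaHat X Y) t x) ∧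
    -- (ii) the expected truncated length is at most the oracle length, up to vanishing terms
    (1 - τ < β → ∃ C₀ : ℝ, 0 < C₀ ∧ ∃ T₀ : ℕ, 1 ≤ T₀ ∧ ∀ t : ℕ, T₀ ≤ t → ∀ x : 𝒳,
      ∀ M : ℝ, 0 < M →
        ∫⁻ ω, min (volume (OnlineSCI.sciSet α B q₁ c β S muHat sigmaHat X Y t ω x))
            (ENNReal.ofReal M) ∂P ≤
          volume (OnlineSCI.oracleSet P (ξ 1) μ σ α x)
            + ENNReal.ofReal (C₀ * (Real.log t ^ (τ₀ / 2) * (t : ℝ) ^ (1 / 2 - τ / 2 - β / 2))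
              + M / t)) ∧
    -- (iii) approximate domination of any method with approximate conditional coverage
    (1 - τ < β → ∃ C₀ : ℝ, 0 < C₀ ∧ ∃ T₀ : ℕ, 1 ≤ T₀ ∧
      ∀ (C' : ℕ → Ω → 𝒳 → Set ℝ) (η' : ℕ → ℝ),
        OnlineSCI.IsSetRule (OnlineSCI.past D₀ X Y) C' →
        (∀ t, 1 ≤ t → 0 < η' t) → Tendsto η' atTop (𝓝 0) →
        (∀ t, 1 ≤ t → ∀ x : 𝒳, 1 - α - η' t ≤ OnlineSCI.condCoverage P ξ μ σ C' t x) →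
        ∀ t : ℕ, T₀ ≤ t → ∀ x : 𝒳, ∀ M : ℝ, 0 < M →
          ∫⁻ ω, min (volume (OnlineSCI.sciSet α B q₁ c β S muHat sigmaHat X Y t ω x))
              (ENNReal.ofReal M) ∂P ≤
            (∫⁻ ω, volume (C' t ω x) ∂P)
              + ENNReal.ofReal (C₀ * (Real.log t ^ (τ₀ / 2) * (t : ℝ) ^ (1 / 2 - τ / 2 - β / 2))
                + C₀ * η' t + M / t)) := by
  set R : OnlineSCI.Run Ω 𝒳 :=
    ⟨n, D₀, X, ξ, Y, μ, σ, f, S, α, B, c, β, q₁, muHat, sigmaHat⟩ with hR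
  have h : R.Valid P := ⟨hmodel, hnoise, hdecr, hS, hr, hα, hB, hc, hβ, hq₁, hmuHat, hsigmaHat,
    hsigmaHat_nonneg⟩
  have := h.prob_noiseLaw
  have hset : OnlineSCI.sciSet α B q₁ c β S muHat sigmaHat X Y = fun t ω x =>
      OnlineSCI.interval R.B (R.muHat t ω x) (R.sigmaHat t ω x) (R.level t ω) := rfl
  rw [hset]
  obtain ⟨K, hK, herr⟩ := h.exists_err_bound
  obtain ⟨C, hC, hmean⟩ := h.exists_integral_abs_level_sub_le hK.le herr hC₁ hτ₀ hτ.1 hpoint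
  have hbound : ∀ t : ℕ, 1 ≤ t → C₁ * Real.log t ^ (2 * τ₀) * (t : ℝ) ^ (-(2 * τ)) =
      (√C₁ * (Real.log t ^ τ₀ * (t : ℝ) ^ (-τ))) ^ 2 := fun t ht => by
    have ht0 : (0 : ℝ) < t := by exact_mod_cast ht
    rw [mul_pow, Real.sq_sqrt hC₁.le, mul_pow, ← Real.rpow_mul_natCast (Real.log_natCast_nonneg t),
      ← Real.rpow_mul_natCast ht0.le, mul_assoc]
    congr 3 <;> push_cast <;> ring
  -- From time 3 on, powers of the logarithm are at least 1 and can be inserted into upper bounds.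
  have hlog3 : ∀ t : ℕ, 3 ≤ t → 1 ≤ Real.log t := fun t ht => by
    have ht3 : (3 : ℝ) ≤ t := by exact_mod_cast ht
    rw [Real.le_log_iff_exp_le (by linarith)]
    linarith [Real.exp_one_lt_three]
  have hlength : ∃ C₀ : ℝ, 0 < C₀ ∧ ∃ T₀ : ℕ, 1 ≤ T₀ ∧ ∀ t : ℕ, T₀ ≤ t → ∀ x : 𝒳,
      ∀ M : ℝ, 0 < M →
        ∫⁻ ω, min (volume (OnlineSCI.interval R.B (R.muHat t ω x) (R.sigmaHat t ω x)
            (R.level t ω))) (ENNReal.ofReal M) ∂P ≤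
          volume (OnlineSCI.oracleSet P (ξ 1) μ σ α x)
            + ENNReal.ofReal (C₀ * (Real.log t ^ (τ₀ / 2) * (t : ℝ) ^ (1 / 2 - τ / 2 - β / 2))
              + M / t) := by
    have hz := h.zStar_pos
    obtain ⟨L, hL0, hL⟩ := OnlineSCI.exists_radius_le h.B_pos hz.le
      (le_add_of_nonneg_right zero_le_one : R.zStar P ≤ R.zStar P + 1)
    obtain ⟨s, hs⟩ := hdecr.sigma_bdd
    set s' := max s 1
    have hs' : ∀ x, R.σ x ≤ s' := fun x => (hs ⟨x, rfl⟩).trans (le_max_left _ _)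
    have hs0 : 0 < s' := one_pos.trans_le (le_max_right _ _)
    -- Any radius above `zStar` would serve in place of `zStar + 1`: levels within `δ` of `qStar`
    -- then stay away from `B`, where the length is infinite.
    set δ := OnlineSCI.levelOf R.B (R.zStar P + 1) - R.qStar P with hδ
    have hδ0 : 0 < δ :=
      sub_pos.2 (OnlineSCI.levelOf_strictMono h.B_pos hz.le (lt_add_one (R.zStar P)))
    have hδq : R.qStar P + δ = OnlineSCI.levelOf R.B (R.zStar P + 1) := by
      rw [hδ]
      ring
    obtain ⟨T, hT⟩ := eventually_atTop.1 (((hmean.and (h.eventually_measureReal_level_le hK.le herr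
      hC₁ hν₀ hν.1 hprob hpoint hδ0)).and hpoint).and
        (OnlineSCI.eventually_log_rpow_mul_le (p := τ / 2 + β / 2 - 1 / 2) (p' := τ)
          (by linarith [hτ.1, hβ.2]) 1 τ₀))
    refine ⟨2 * (R.zStar P + 1) * √C₁ + 2 * s' * L * (C * 2) + 1, by positivity, max 3 T,
      le_max_of_le_left (by norm_num), fun t ht x M hM => ?_⟩
    have ht3 : 3 ≤ t := (le_max_left _ _).trans ht
    have ht1 : 1 ≤ t := by omega
    obtain ⟨⟨⟨h1, h2⟩, h3⟩, h4⟩ := hT t ((le_max_right _ _).trans ht)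
    have ht0 : (1 : ℝ) ≤ t := by exact_mod_cast ht1
    have hlog := hlog3 t ht3
    rw [hbound t ht1] at h3
    have hb : ∫⁻ ω, ENNReal.ofReal ((R.sigmaHat t ω x - R.σ x) ^ 2) ∂P ≤
        ENNReal.ofReal ((√C₁ * (Real.log t ^ τ₀ * (t : ℝ) ^ (-τ))) ^ 2) :=
      ((le_iSup (fun x => ∫⁻ ω, ENNReal.ofReal ((sigmaHat t ω x - σ x) ^ 2) ∂P) x).trans
        le_add_self).trans h3
    refine (h.lintegral_min_volume_le (by linarith) hL0 (fun q hq => hL q (hδq ▸ hq))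
      (hδq ▸ OnlineSCI.levelOf_lt h.B_pos (by linarith)) hs' ht1 (by positivity) x hb h2
      hM).trans ?_
    refine add_le_add le_rfl (ENNReal.ofReal_le_ofReal ?_)
    rw [one_mul] at h4
    have e1 : (t : ℝ) ^ (-(τ / 2 + β / 2 - 1 / 2)) = (t : ℝ) ^ (1 / 2 - τ / 2 - β / 2) := by
      congr 1
      ring
    set W := Real.log t ^ (τ₀ / 2) * (t : ℝ) ^ (1 / 2 - τ / 2 - β / 2)
    set y := Real.log t ^ τ₀ * (t : ℝ) ^ (-τ)
    -- Both error scales lie below `W`: the scale `t^{-τ}` with its logarithm because `τ/2 + β/2 -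
    -- 1/2 < τ`, and `t^{-β/2}` because `τ ≤ 1/2`.
    have hWt : (t : ℝ) ^ (1 / 2 - τ / 2 - β / 2) ≤ W :=
      le_mul_of_one_le_left (by positivity) (Real.one_le_rpow hlog (by positivity))
    have hyW : y ≤ W := h4.trans (e1.le.trans hWt)
    have hβW : (t : ℝ) ^ (-(R.β / 2)) ≤ W := by
      refine le_trans (Real.rpow_le_rpow_of_exponent_le ht0 ?_) hWt
      change -(β / 2) ≤ _
      linarith [hτ.2]
    have h5 : ∫ ω, |R.level t ω - R.qStar P| ∂P ≤ C * 2 * W := by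
      refine h1.trans ?_
      rw [mul_assoc]
      gcongr
      linarith
    have hW0 : 0 ≤ W := by positivity
    calc 2 * (R.zStar P + 1) * (√C₁ * y) +
          2 * s' * L * ∫ ω, |R.level t ω - R.qStar P| ∂P + M * (1 / t)
        ≤ 2 * (R.zStar P + 1) * (√C₁ * W) + 2 * s' * L * (C * 2 * W) + M * (1 / t) := by gcongr
      _ = (2 * (R.zStar P + 1) * √C₁ + 2 * s' * L * (C * 2)) * W + M / t := by ring
      _ ≤ (2 * (R.zStar P + 1) * √C₁ + 2 * s' * L * (C * 2) + 1) * W + M / t := by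
        have := le_add_of_nonneg_right (a := 2 * (R.zStar P + 1) * √C₁ + 2 * s' * L * (C * 2))
          zero_le_one
        gcongr ?_ * W + _
  refine ⟨?_, fun _ => hlength, fun _ => ?_⟩
  · obtain ⟨L, hL0, hL⟩ := OnlineSCI.exists_idealMiss_le h.unimodal h.B_pos h.tail_zStar
    obtain ⟨T, hT⟩ := eventually_atTop.1 (hmean.and hpoint)
    refine ⟨L * C + 2 * K * √C₁ + 1, by positivity, max 3 T,
      le_max_of_le_left (by norm_num), fun t ht x => ?_⟩
    have ht3 : 3 ≤ t := (le_max_left _ _).trans ht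
    have ht1 : 1 ≤ t := by omega
    obtain ⟨h1, h2⟩ := hT t ((le_max_right _ _).trans ht)
    have ht0 : (1 : ℝ) ≤ t := by exact_mod_cast ht1
    have hlog := hlog3 t ht3
    rw [hbound t ht1] at h2
    refine le_trans ?_ (h.le_condCoverage hK.le herr hL ht1 x)
    have h3 := h.integral_err_le hK.le ht1 (by positivity) h2 x
    have h4 := mul_le_mul_of_nonneg_left h1 hL0
    -- For `β < 3/4` this is `β/3 ≤ β/2`; otherwise the term `t^{β-1}` of `rho` suffices, as `1 - β
    -- ≤ β/2`.
    have hρ : (t : ℝ) ^ (-(R.β / 2)) ≤ OnlineSCI.rho β t := by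
      change (t : ℝ) ^ (-(β / 2)) ≤ _
      have hsq : 1 ≤ Real.log t ^ (1 / 2 : ℝ) := Real.one_le_rpow hlog (by norm_num)
      rw [OnlineSCI.rho]
      split_ifs with hβ'
      · refine le_trans ?_ (le_mul_of_one_le_left (by positivity) hsq)
        exact Real.rpow_le_rpow_of_exponent_le ht0 (by linarith [hβ.1])
      · refine le_add_of_nonneg_of_le (by positivity) ?_
        exact Real.rpow_le_rpow_of_exponent_le ht0 (by linarith [not_lt.1 hβ'])
    set y := Real.log t ^ τ₀ * (t : ℝ) ^ (-τ)
    have hy0 : 0 ≤ y := by positivity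
    have hw0 : 0 ≤ Real.log t ^ ν₀ * (t : ℝ) ^ (-ν) := by positivity
    have hρ0 : 0 ≤ OnlineSCI.rho β t := le_trans (by positivity) hρ
    have p1 : L * C * (t : ℝ) ^ (-(R.β / 2)) ≤ L * C * OnlineSCI.rho β t := by gcongr
    have p2 : 0 ≤ (2 * K * √C₁ + 1) * OnlineSCI.rho β t := by positivity
    have p3 : 0 ≤ (L * C + 2 * K * √C₁ + 1) * (Real.log t ^ ν₀ * (t : ℝ) ^ (-ν)) := by
      positivity
    change 1 - α - _ ≤ 1 - α - _ - _
    linarith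
  · obtain ⟨C₀, hC₀, T₀, hT₀, hle⟩ := hlength
    obtain ⟨s, hs⟩ := hdecr.sigma_bdd
    have hf := h.f_zStar_pos
    set s' := max s 1
    have hs' : ∀ x, R.σ x ≤ s' := fun x => (hs ⟨x, rfl⟩).trans (le_max_left _ _)
    have hs0 : 0 < s' := one_pos.trans_le (le_max_right _ _)
    -- The second summand bounds, uniformly in `x`, the length that can be saved per unit of missing
    -- coverage; it does not depend on the competing rule.
    refine ⟨C₀ + s' / R.f (R.zStar P), by positivity, T₀, hT₀,
      fun C' η' hC' hη' _ hcov t ht x M hM => ?_⟩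
    have ht1 : 1 ≤ t := hT₀.trans ht
    have hη := hη' t ht1
    refine (hle t ht x M hM).trans ?_
    have h1 := h.volume_oracleSet_le hC' ht1 x (hcov t ht1 x)
    refine (add_le_add h1 le_rfl).trans ?_
    have hσ := h.noise.sigma_pos x
    have hlog : 0 ≤ Real.log t := Real.log_natCast_nonneg t
    rw [add_assoc, ← ENNReal.ofReal_add (by positivity) (by positivity)]
    refine add_le_add le_rfl (ENNReal.ofReal_le_ofReal ?_)
    set W := Real.log t ^ (τ₀ / 2) * (t : ℝ) ^ (1 / 2 - τ / 2 - β / 2)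
    have hW0 : 0 ≤ W := by positivity
    have h2 : R.σ x / R.f (R.zStar P) * η' t ≤ s' / R.f (R.zStar P) * η' t := by
      gcongr
      exact hs' x
    have h3 : 0 ≤ s' / R.f (R.zStar P) * W := by positivity
    have h4 : 0 ≤ C₀ * η' t := by positivity
    linarith
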